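/- Let $E=(-M,N)$, $M,N\le\infty$, be a nonempty open interval, let $\theta\in E$, and let $a>0$ and $b$ be measurable functions on $E$ with $b/a$ and $1/a$ locally integrable on $E$. Put $C(x)=\int_\theta^x b/a$ and define measures on $E$ by $$\mu(dx)=\frac{e^{C(x)}}{a(x)}\,dx,\qquad \nu(dx)=e^{C(x)}dx,\qquad \hat\nu(dx)=\hat\nu_p(dx)=e^{-C(x)/(p-1)}dx,$$ where $p=2$ in the Poincaré-type inequalities. For $c\ge 0$ let $L^c=a\,\frac{d^2}{dx^2}+b\,\frac{d}{dx}-c$. Let $\#\in\{NN,DD,DN,ND\}$, the first letter referring to the endpoint $-M$ and the second one to $N$ (D: Dirichlet, N: Neumann). Call $f:E\to\mathbb R$ *admissible* if it is locally absolutely continuous on $E$ and tends to $0$ at each D-endpoint (nothing is imposed at an N-endpoint). Write $\mu(\alpha,\beta)=\mu((\alpha,\beta))$, and similarly for the other measures; suprema are over points $x,y\in E$; values in $[0,\infty]$ are allowed, with $0/0=0\cdot\infty=0$. **Poincaré-type inequalities.** Let $\lambda_c^{\#}\in[0,\infty]$ be the largest $\lambda$ such that $$\lambda\,\|f\|_{\mu,2}^2\le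 \|f'\|_{\nu,2}^2+\|\sqrt c\, f\|_{\mu,2}^2$$ for all admissible $f$, where in the case NN one supposes $\mu(E)<\infty$ and considers only $f\in L^1(\mu)$ with $\mu(f)=0$. Put $\lambda^{\#}=\lambda_0^{\#}$. For measures $m,s$ on $E$ let $$\kappa^{NN}(m,s)=\sup_{x<y}\frac{s(x,y)}{m(-M,x)^{-1}+m(y,N)^{-1}},\qquad \kappa^{DD}(m,s)=\sup_{x\le y}\frac{m(x,y)}{s(-M,x)^{-1}+s(y,N)^{-1}},$$ $$\kappa^{DN}(m,s)=\sup_{x}\,s(-M,x)\,m(x,N),\qquad \kappa^{ND}(m,s)=\sup_{x}\,m(-M,x)\,s(x,N).$$ 1. (Without killing.) With $\kappa^{\#}=\kappa^{\#}(\mu,\hat\nu)$, $\quad\kappa^{\#}\le(\lambda^{\#})^{-1}\le4\kappa^{\#}$. 2. (With killing.) Let $c\ge0$ on $E$ and let $h>0$ be $L^c$-harmonic on $E$, that is, $h$ is differentiable, $h'$ is locally absolutely continuous and $L^ch=0$ a.e.; let $h$ satisfy the Neumann condition $e^{C}h'\to0$ at each N-endpoint. Put $\mu_c=h^2\mu$,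 $\hat\nu_c=h^{-2}\hat\nu$ and $\kappa_c^{\#}=\kappa^{\#}(\mu_c,\hat\nu_c)$. Then $\kappa_c^{\#}\le(\lambda_c^{\#})^{-1}\le4\kappa_c^{\#}$. (For NN these conditions on $h$ force $c=0$ a.e., so killing is effective only in the other three cases.) **Hardy-type inequalities.** Let $1<p\le q<\infty$. 3. (With $L^q$.) Let $A^{\#}\in[0,\infty]$ be the smallest $A$ such that $\|f\|_{\mu,q}\le A\|f'\|_{\nu,p}$ for all admissible $f$; in the case NN the left-hand side is replaced by $\inf_{k\in\mathbb R}\|f-k\|_{\mu,q}$. Then $B^{\#}\le A^{\#}\le2B^{\#}$, where $$B^{DD}=\sup_{x\le y}\frac{\mu(x,y)^{1/q}}{\{\hat\nu(-M,x)^{1-p}+\hat\nu(y,N)^{1-p}\}^{1/p}},\qquad B^{NN}=\sup_{x<y}\frac{\hat\nu(x,y)^{(p-1)/p}}{\{\mu(-M,x)^{-1/(q-1)}+\mu(y,N)^{-1/(q-1)}\}^{(q-1)/q}},$$ $$B^{DN}=\sup_x\hat\nu(-M,x)^{(p-1)/p}\mu(x,N)^{1/q},\qquad B^{ND}=\sup_x\mu(-M,x)^{1/q}\,\hat\nu(x,N)^{(p-1)/p}.$$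 4. (With a normed space $\mathbb B$.) Let $\mathcal G$ be a set of measurable functions $g\ge0$ and $\|f\|_{\mathbb B}=\sup_{g\in\mathcal G}\int_E|f|\,g\,d\mu$. Let $A_{\mathbb B}^{\#}\in[0,\infty]$ be the smallest $A$ such that $\||f|^q\|_{\mathbb B}^{1/q}\le A\|f'\|_{\nu,p}$ for all admissible $f$; in the case NN the left-hand side is replaced by $\inf_{k\in\mathbb R}\||f-k|^q\|_{\mathbb B}^{1/q}$. Then $B_{\mathbb B}^{\#}\le A_{\mathbb B}^{\#}\le2B_{\mathbb B}^{\#}$, where $$B_{\mathbb B}^{DD}=\sup_{x\le y}\frac{\|1_{(x,y)}\|_{\mathbb B}^{1/q}}{\{\hat\nu(-M,x)^{1-p}+\hat\nu(y,N)^{1-p}\}^{1/p}},$$ $$B_{\mathbb B}^{DN}=\sup_x\hat\nu(-M,x)^{(p-1)/p}\|1_{(x,N)}\|_{\mathbb B}^{1/q},\qquad B_{\mathbb B}^{ND}=\sup_x\|1_{(-M,x)}\|_{\mathbb B}^{1/q}\,\hat\nu(x,N)^{(p-1)/p},$$ $$B_{\mathbb B}^{NN}=\sup_{x<y}\hat\nu(x,y)^{(p-1)/p}\Big(\inf_{k\in\mathbb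 R}\big\||k|^q1_{(-M,x)}+|1-k|^q1_{(y,N)}\big\|_{\mathbb B}\Big)^{1/q},$$ and for $\mathbb B=L^1(\mu)$ (that is, $\mathcal G=\{1\}$) these are the constants of part 3. -/

import Mathlib

open MeasureTheory Set Filter Topology
open scoped ENNReal NNReal

namespace ChenHardy

/-- The four types of boundary conditions on an interval: the first letter refers to the left
endpoint and the second to the right endpoint (`D` is Dirichlet, `N` is Neumann). -/
inductive Boundary where
  | NN
  | DD
  | DN
  | ND

/-- The left endpoint carries a Dirichlet condition. -/
def Boundary.LeftD : Boundary → Prop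
  | .NN => False
  | .DD => True
  | .DN => True
  | .ND => False

/-- The right endpoint carries a Dirichlet condition. -/
def Boundary.RightD : Boundary → Prop
  | .NN => False
  | .DD => True
  | .DN => False
  | .ND => True

/-- The coefficients of an elliptic operator `L = a d²/dx² + b d/dx` on an open interval
`E = (-M, N)`, `M, N ≤ ∞`, with a reference point `θ ∈ E`. -/
structure Diffusion where
  /-- `-M` is the left endpoint. -/
  M : EReal
  /-- `N` is the right endpoint. -/
  N : EReal
  /-- The reference point. -/
  θ : ℝ
  /-- The second order coefficient. -/
  a : ℝ → ℝ
  /-- The first order coefficient. -/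
  b : ℝ → ℝ
  left_lt : -M < (θ : EReal)
  lt_right : (θ : EReal) < N
  measurable_a : Measurable a
  measurable_b : Measurable b
  a_pos : ∀ x : ℝ, -M < (x : EReal) → (x : EReal) < N → 0 < a x
  locInt_b_div_a : LocallyIntegrableOn (fun x => b x / a x)
    {x : ℝ | -M < (x : EReal) ∧ (x : EReal) < N} volume
  locInt_inv_a : LocallyIntegrableOn (fun x => 1 / a x)
    {x : ℝ | -M < (x : EReal) ∧ (x : EReal) < N} volume

/-- A function is locally absolutely continuous on an interval `E` if it is absolutely continuous
on every compact subinterval of `E`. -/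
def LocAC (f : ℝ → ℝ) (E : Set ℝ) : Prop :=
  ∀ x ∈ E, ∀ y ∈ E, AbsolutelyContinuousOnInterval f x y

/-- The norm `‖f‖_𝔹 = sup_{g ∈ 𝒢} ∫ |f| g dμ` given by a family `𝒢` of nonnegative functions. -/
noncomputable def normB (𝒢 : Set (ℝ → ℝ≥0)) (μ : Measure ℝ) (f : ℝ → ℝ) : ℝ≥0∞ :=
  ⨆ g ∈ 𝒢, ∫⁻ x, ‖f x‖ₑ * (g x : ℝ≥0∞) ∂μ

namespace Diffusion

variable (D : Diffusion)

/-- The interval `E = (-M, N)`. -/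
def E : Set ℝ := {x : ℝ | -D.M < (x : EReal) ∧ (x : EReal) < D.N}

/-- The part `(-M, x)` of `E`. -/
def leftOf (x : ℝ) : Set ℝ := D.E ∩ Iio x

/-- The part `(x, N)` of `E`. -/
def rightOf (x : ℝ) : Set ℝ := D.E ∩ Ioi x

/-- The filter of real `x` tending to `-M` from within `E`. -/
noncomputable def leftEnd : Filter ℝ := comap (fun x : ℝ => (x : EReal)) (𝓝[>] (-D.M))

/-- The filter of real `x` tending to `N` from within `E`. -/
noncomputable def rightEnd : Filter ℝ := comap (fun x : ℝ => (x : EReal)) (𝓝[<] D.N)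

/-- `C(x) = ∫_θ^x b/a`. -/
noncomputable def C (x : ℝ) : ℝ := ∫ t in D.θ..x, D.b t / D.a t

/-- The speed measure `dμ = (e^C / a) dx` on `E`. -/
noncomputable def mu : Measure ℝ :=
  (volume.restrict D.E).withDensity fun x => ENNReal.ofReal (Real.exp (D.C x) / D.a x)

/-- The measure `dν = e^C dx` on `E`. -/
noncomputable def nu : Measure ℝ :=
  (volume.restrict D.E).withDensity fun x => ENNReal.ofReal (Real.exp (D.C x))

/-- The measure `dν̂ = e^{-C/(p-1)} dx` on `E`; for `p = 2` it is the scale measure. -/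
noncomputable def nuHat (p : ℝ) : Measure ℝ :=
  (volume.restrict D.E).withDensity fun x => ENNReal.ofReal (Real.exp (-D.C x / (p - 1)))

/-- The measure `μ_c = h² μ`. -/
noncomputable def muC (h : ℝ → ℝ) : Measure ℝ :=
  D.mu.withDensity fun x => ENNReal.ofReal (h x ^ 2)

/-- The measure `ν̂_c = h⁻² ν̂`. -/
noncomputable def nuHatC (h : ℝ → ℝ) : Measure ℝ :=
  (D.nuHat 2).withDensity fun x => ENNReal.ofReal ((h x ^ 2)⁻¹)

/-- The operator `L^c f = a f'' + b f' - c f`. -/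
noncomputable def Lc (c f : ℝ → ℝ) (x : ℝ) : ℝ :=
  D.a x * deriv (deriv f) x + D.b x * deriv f x - c x * f x

/-- `h` is `L^c`-harmonic on `E`: `h` is differentiable, `h'` is locally absolutely continuous, and
`L^c h = 0` almost everywhere (if the coefficients are continuous, this says that `h` is a
classical solution). -/
def IsHarmonic (c h : ℝ → ℝ) : Prop :=
  DifferentiableOn ℝ h D.E ∧ LocAC (deriv h) D.E ∧ ∀ᵐ x ∂(volume.restrict D.E), D.Lc c h x = 0

/-- `h` satisfies the Neumann (zero flux) condition `e^C h' → 0` at each endpoint of type `N`. -/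
def IsNeumann (bc : Boundary) (h : ℝ → ℝ) : Prop :=
  (¬ bc.LeftD → Tendsto (fun x => Real.exp (D.C x) * deriv h x) D.leftEnd (𝓝 0)) ∧
  (¬ bc.RightD → Tendsto (fun x => Real.exp (D.C x) * deriv h x) D.rightEnd (𝓝 0))

/-- The functions to which the inequalities apply: locally absolutely continuous functions on `E`
that tend to `0` at each endpoint of type `D`. At an endpoint of type `N` nothing is imposed. -/
def Admissible (bc : Boundary) (f : ℝ → ℝ) : Prop :=
  LocAC f D.E ∧ (bc.LeftD → Tendsto f D.leftEnd (𝓝 0)) ∧ (bc.RightD → Tendsto f D.rightEnd (𝓝 0))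

/-- In the `NN` case: `f` is `μ`-integrable with `μ(f) = 0`. No condition in the other cases. -/
def MeanZero : Boundary → (ℝ → ℝ) → Prop
  | .NN, f => Integrable f D.mu ∧ ∫ x, f x ∂D.mu = 0
  | .DD, _ => True
  | .DN, _ => True
  | .ND, _ => True

/-- The optimal (largest) constant in the Poincaré-type inequality
`lam ‖f‖²_{μ,2} ≤ ‖f'‖²_{ν,2} + ‖√c f‖²_{μ,2}`. -/
noncomputable def poincareConst (c : ℝ → ℝ) (bc : Boundary) : ℝ≥0∞ :=
  sSup {lam : ℝ≥0∞ | ∀ f : ℝ → ℝ, D.Admissible bc f → D.MeanZero bc f →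
    lam * eLpNorm f 2 D.mu ^ 2 ≤
      eLpNorm (deriv f) 2 D.nu ^ 2 + eLpNorm (fun x => √(c x) * f x) 2 D.mu ^ 2}

/-- The left-hand side `‖f‖_{μ,q}` of the Hardy-type inequality. In the `NN` case functions are
taken modulo constants: the left-hand side is `inf_k ‖f - k‖_{μ,q}`. -/
noncomputable def hardyLHS (q : ℝ) : Boundary → (ℝ → ℝ) → ℝ≥0∞
  | .NN, f => ⨅ k : ℝ, eLpNorm (fun x => f x - k) (ENNReal.ofReal q) D.mu
  | .DD, f => eLpNorm f (ENNReal.ofReal q) D.mu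
  | .DN, f => eLpNorm f (ENNReal.ofReal q) D.mu
  | .ND, f => eLpNorm f (ENNReal.ofReal q) D.mu

/-- The optimal (smallest) constant in the Hardy-type inequality
`‖f‖_{μ,q} ≤ A ‖f'‖_{ν,p}`. -/
noncomputable def hardyConst (p q : ℝ) (bc : Boundary) : ℝ≥0∞ :=
  sInf {A : ℝ≥0∞ | ∀ f : ℝ → ℝ, D.Admissible bc f →
    D.hardyLHS q bc f ≤ A * eLpNorm (deriv f) (ENNReal.ofReal p) D.nu}

/-- The left-hand side `‖|f|^q‖_𝔹^{1/q}` of the Hardy-type inequality with a normed space `𝔹`. In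
the `NN` case functions are again taken modulo constants. -/
noncomputable def hardyLHSB (𝒢 : Set (ℝ → ℝ≥0)) (q : ℝ) : Boundary → (ℝ → ℝ) → ℝ≥0∞
  | .NN, f => ⨅ k : ℝ, normB 𝒢 D.mu (fun x => |f x - k| ^ q) ^ (1 / q)
  | .DD, f => normB 𝒢 D.mu (fun x => |f x| ^ q) ^ (1 / q)
  | .DN, f => normB 𝒢 D.mu (fun x => |f x| ^ q) ^ (1 / q)
  | .ND, f => normB 𝒢 D.mu (fun x => |f x| ^ q) ^ (1 / q)

/-- The optimal (smallest) constant in the Hardy-type inequality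
`‖|f|^q‖_𝔹^{1/q} ≤ A ‖f'‖_{ν,p}`. -/
noncomputable def hardyConstB (𝒢 : Set (ℝ → ℝ≥0)) (p q : ℝ) (bc : Boundary) : ℝ≥0∞ :=
  sInf {A : ℝ≥0∞ | ∀ f : ℝ → ℝ, D.Admissible bc f →
    D.hardyLHSB 𝒢 q bc f ≤ A * eLpNorm (deriv f) (ENNReal.ofReal p) D.nu}

/-- The isoperimetric constant `κ` for a speed measure `m` and a scale measure `s` on `E`. -/
noncomputable def kappa (m s : Measure ℝ) : Boundary → ℝ≥0∞
  | .NN => ⨆ x ∈ D.E, ⨆ y ∈ D.E, ⨆ _ : x < y,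
      s (Ioo x y) / ((m (D.leftOf x))⁻¹ + (m (D.rightOf y))⁻¹)
  | .DD => ⨆ x ∈ D.E, ⨆ y ∈ D.E, ⨆ _ : x ≤ y,
      m (Ioo x y) / ((s (D.leftOf x))⁻¹ + (s (D.rightOf y))⁻¹)
  | .DN => ⨆ x ∈ D.E, s (D.leftOf x) * m (D.rightOf x)
  | .ND => ⨆ x ∈ D.E, m (D.leftOf x) * s (D.rightOf x)

/-- The isoperimetric constant `B` of the Hardy-type inequality. -/
noncomputable def hardyIso (p q : ℝ) : Boundary → ℝ≥0∞
  | .NN => ⨆ x ∈ D.E, ⨆ y ∈ D.E, ⨆ _ : x < y,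
      D.nuHat p (Ioo x y) ^ ((p - 1) / p) /
        (D.mu (D.leftOf x) ^ (-(1 / (q - 1))) + D.mu (D.rightOf y) ^ (-(1 / (q - 1))))
          ^ ((q - 1) / q)
  | .DD => ⨆ x ∈ D.E, ⨆ y ∈ D.E, ⨆ _ : x ≤ y,
      D.mu (Ioo x y) ^ (1 / q) /
        (D.nuHat p (D.leftOf x) ^ (1 - p) + D.nuHat p (D.rightOf y) ^ (1 - p)) ^ (1 / p)
  | .DN => ⨆ x ∈ D.E, D.nuHat p (D.leftOf x) ^ ((p - 1) / p) * D.mu (D.rightOf x) ^ (1 / q)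
  | .ND => ⨆ x ∈ D.E, D.mu (D.leftOf x) ^ (1 / q) * D.nuHat p (D.rightOf x) ^ ((p - 1) / p)

/-- The isoperimetric constant `B_𝔹` of the Hardy-type inequality with a normed space `𝔹`.
In the `NN` case, if `𝔹 = L¹(μ)` then the infimum over `k` equals
`(μ(-M,x)^{-1/(q-1)} + μ(y,N)^{-1/(q-1)})^{-(q-1)}`. -/
noncomputable def hardyIsoB (𝒢 : Set (ℝ → ℝ≥0)) (p q : ℝ) : Boundary → ℝ≥0∞
  | .NN => ⨆ x ∈ D.E, ⨆ y ∈ D.E, ⨆ _ : x < y,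
      D.nuHat p (Ioo x y) ^ ((p - 1) / p) *
        (⨅ k : ℝ, normB 𝒢 D.mu (fun t =>
          (D.leftOf x).indicator (fun _ => |k| ^ q) t +
          (D.rightOf y).indicator (fun _ => |1 - k| ^ q) t)) ^ (1 / q)
  | .DD => ⨆ x ∈ D.E, ⨆ y ∈ D.E, ⨆ _ : x ≤ y,
      normB 𝒢 D.mu ((Ioo x y).indicator fun _ => 1) ^ (1 / q) /
        (D.nuHat p (D.leftOf x) ^ (1 - p) + D.nuHat p (D.rightOf y) ^ (1 - p)) ^ (1 / p)
  | .DN => ⨆ x ∈ D.E, D.nuHat p (D.leftOf x) ^ ((p - 1) / p) *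
      normB 𝒢 D.mu ((D.rightOf x).indicator fun _ => 1) ^ (1 / q)
  | .ND => ⨆ x ∈ D.E, normB 𝒢 D.mu ((D.leftOf x).indicator fun _ => 1) ^ (1 / q) *
      D.nuHat p (D.rightOf x) ^ ((p - 1) / p)

end Diffusion

end ChenHardy

namespace ChenHardy

/-! ### Distribution functions of finite atomless measures on the line -/

section Distribution

variable (ρ : Measure ℝ)

/-! Write σ for the density of ν̂. Its exponent is chosen so that σ^(1-p) = e^C, hence ‖f'‖^p in
L^p(ν) is the p-energy ∫ |f'|^p σ^(1-p), and the least energy needed to climb from 0 to 1 across an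
interval I is ν̂(I)^(1-p). The constants B and κ compare masses with these capacities.

Lower bounds: insert functions of least energy, the ramps `ramp`, into the inequality and let the
foot of the ramp tend to a Dirichlet endpoint (`hardyIsoB_le`).

Upper bounds with a Dirichlet end: after clipping, f vanishes at the end of a compact interval, so
|f| is at most the distribution function F of |f'| dx. The level sets of F are rays, whose mass is
controlled by B and their capacity. That capacity is at most the energy of the truncation (F/t)^γ ∧
1 with γ the conjugate of p (`measure_rpow_le_levelEnergy`). Integrated against d(t^p), these
energies give at most p γ^(p-1) ≤ 2^p times the energy of f (`lintegral_levelEnergy_le`); this is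
Maz'ya's capacitary inequality and the source of the factor 2. The layer-cake formula and the
Lorentz embedding `lintegral_antitone_rpow_le` pass from levels to the q-norm. With two Dirichlet
ends F is replaced by the minimum of the distribution functions from the left and from the right;
the two energies live on disjoint sets, so they add up without loss (`lintegral_min_rpow_le`).

Neumann-Neumann: this case is dual to the doubly Dirichlet one. For k the q-mean of f, integration
by parts writes ∫ |f-k|^q dm as a pairing of f' with the primitive Φ of |f-k|^(q-1) sign(f-k), which
vanishes at both ends. Hölder's inequality and the doubly Dirichlet inequality for Φ, with the two
measures exchanged and the conjugate exponents q' ≤ p', give the factor 2 again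
(`lintegral_sub_rpow_le`). For a general 𝔹 one k has to serve all g in 𝒢 simultaneously. The
admissible k for one g form a compact interval, so by Helly's theorem on the line pairs suffice, and
for a pair connectedness yields a common point (`exists_common_of_le`, `exists_normB_sub_le`).

Killing: the substitution f = h g turns the energy ∫ f'^2 e^C + c f^2 e^C/a into ∫ g'^2 h^2 e^C plus
a boundary term, so μ and ν̂ become μ_c and ν̂_c (`ae_energyDensity_eq`). The flux e^C h' is
monotone, which controls the boundary term at Neumann ends. In the NN case it vanishes identically,
so h is constant and c = 0 almost everywhere. The case without killing is h = 1. -/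

theorem measureReal_le_of_isLowerSet [IsFiniteMeasure ρ] [NullSingletonClass ρ] {A : Set ℝ}
    (hA : IsLowerSet A) {t : ℝ} (ht : 0 ≤ t) (h : ∀ x ∈ A, ρ.real (Iio x) ≤ t) :
    ρ.real A ≤ t := by
  by_cases hmax : ∃ x ∈ A, ∀ y ∈ A, y ≤ x
  · obtain ⟨x, hx, hxA⟩ := hmax
    have : A = Iic x := Subset.antisymm (fun y hy => hxA y hy) (fun y hy => hA hy hx)
    rw [this, measureReal_congr Iio_ae_eq_Iic.symm]
    exact h x hx
  -- Without a greatest element, the lower set is a countable directed union of open rays ending at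
  -- rational points of the set, and continuity from below applies.
  · push Not at hmax
    have hU : A = ⋃ q : {q : ℚ // (q : ℝ) ∈ A}, Iio ((q : ℚ) : ℝ) := by
      ext x
      simp only [mem_iUnion, mem_Iio]
      constructor
      · intro hx
        obtain ⟨y, hy, hxy⟩ := hmax x hx
        obtain ⟨q, hxq, hqy⟩ := exists_rat_btwn hxy
        exact ⟨⟨q, hA hqy.le hy⟩, hxq⟩
      · rintro ⟨⟨q, hq⟩, hx⟩
        exact hA (le_of_lt hx) hq
    have hdir : Directed (· ⊆ ·) (fun q : {q : ℚ // (q : ℝ) ∈ A} => Iio ((q : ℚ) : ℝ)) :=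
      Monotone.directed_le fun a b hab => Iio_subset_Iio (by exact_mod_cast hab)
    have : ρ A ≤ ENNReal.ofReal t := by
      rw [hU, hdir.measure_iUnion]
      refine iSup_le fun q => ?_
      rw [← ofReal_measureReal]
      exact ENNReal.ofReal_le_ofReal (h _ q.2)
    exact ENNReal.toReal_le_of_le_ofReal ht this

theorem measureReal_le_of_isUpperSet [IsFiniteMeasure ρ] [NullSingletonClass ρ] {A : Set ℝ}
    (hA : IsUpperSet A) {t : ℝ} (ht : 0 ≤ t) (h : ∀ x ∈ A, ρ.real (Ioi x) ≤ t) :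
    ρ.real A ≤ t := by
  by_cases hmin : ∃ x ∈ A, ∀ y ∈ A, x ≤ y
  · obtain ⟨x, hx, hxA⟩ := hmin
    have : A = Ici x := Subset.antisymm (fun y hy => hxA y hy) (fun y hy => hA hy hx)
    rw [this, measureReal_congr Ioi_ae_eq_Ici.symm]
    exact h x hx
  · push Not at hmin
    have hU : A = ⋃ q : {q : ℚ // (q : ℝ) ∈ A}, Ioi ((q : ℚ) : ℝ) := by
      ext x
      simp only [mem_iUnion, mem_Ioi]
      constructor
      · intro hx
        obtain ⟨y, hy, hxy⟩ := hmin x hx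
        obtain ⟨q, hxq, hqy⟩ := exists_rat_btwn hxy
        exact ⟨⟨q, hA hxq.le hy⟩, hqy⟩
      · rintro ⟨⟨q, hq⟩, hx⟩
        exact hA (le_of_lt hx) hq
    have hdir : Directed (· ⊆ ·) (fun q : {q : ℚ // (q : ℝ) ∈ A} => Ioi ((q : ℚ) : ℝ)) :=
      Antitone.directed_le fun a b hab => Ioi_subset_Ioi (by exact_mod_cast hab)
    have : ρ A ≤ ENNReal.ofReal t := by
      rw [hU, hdir.measure_iUnion]
      refine iSup_le fun q => ?_
      rw [← ofReal_measureReal]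
      exact ENNReal.ofReal_le_ofReal (h _ q.2)
    exact ENNReal.toReal_le_of_le_ofReal ht this

theorem monotone_measureReal_Iio [IsFiniteMeasure ρ] : Monotone fun x => ρ.real (Iio x) :=
  fun _ _ h => measureReal_mono (Iio_subset_Iio h)

theorem antitone_measureReal_Ioi [IsFiniteMeasure ρ] : Antitone fun x => ρ.real (Ioi x) :=
  fun _ _ h => measureReal_mono (Ioi_subset_Ioi h)

theorem measureReal_Iio_add_Ioi [IsFiniteMeasure ρ] [NullSingletonClass ρ] (x : ℝ) :
    ρ.real (Iio x) + ρ.real (Ioi x) = ρ.real univ := by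
  rw [measureReal_congr Iio_ae_eq_Iic, ← compl_Iic, measureReal_add_measureReal_compl
    measurableSet_Iic]

/-- A finite atomless measure is pushed forward to Lebesgue measure by its distribution
function. -/
theorem map_measureReal_Iio [IsFiniteMeasure ρ] [NullSingletonClass ρ] :
    ρ.map (fun x => ρ.real (Iio x)) = volume.restrict (Ioc 0 (ρ.real univ)) := by
  have hF := (monotone_measureReal_Iio ρ).measurable
  have : IsFiniteMeasure (ρ.map (fun x => ρ.real (Iio x))) := Measure.isFiniteMeasure_map _ _
  refine Measure.ext_of_Iic _ _ fun t => ?_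
  rw [Measure.map_apply hF measurableSet_Iic, Measure.restrict_apply measurableSet_Iic]
  have hvol : Iic t ∩ Ioc 0 (ρ.real univ) = Ioc 0 (min t (ρ.real univ)) := by
    ext x; simp only [mem_inter_iff, mem_Iic, mem_Ioc, le_min_iff]; tauto
  rw [hvol, Real.volume_Ioc, sub_zero]
  rcases lt_or_ge t 0 with ht | ht
  · have : (fun x => ρ.real (Iio x)) ⁻¹' Iic t = ∅ := by
      ext x
      simp only [mem_preimage, mem_Iic, mem_empty_iff_false, iff_false, not_le]
      exact ht.trans_le measureReal_nonneg
    rw [this, measure_empty, ENNReal.ofReal_of_nonpos ((min_le_left _ _).trans ht.le)]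
  rw [← ofReal_measureReal]
  congr 1
  rcases le_or_gt (ρ.real univ) t with h | h
  · have : (fun x => ρ.real (Iio x)) ⁻¹' Iic t = univ := by
      ext x
      simp only [mem_preimage, mem_Iic, mem_univ, iff_true]
      exact (measureReal_mono (subset_univ _)).trans h
    rw [this, min_eq_right h]
  rw [min_eq_left h.le]
  -- The sublevel set is a lower set, which gives ≤. Its complement is an upper set whose tails have
  -- mass below R - t, where R is the total mass, and this gives ≥.
  refine le_antisymm (measureReal_le_of_isLowerSet ρ ?_ ht fun x hx => hx) ?_
  · intro x y hyx hx
    exact (monotone_measureReal_Iio ρ hyx).trans hx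
  · have h2 : ρ.real ((fun x => ρ.real (Iio x)) ⁻¹' Iic t)ᶜ ≤ ρ.real univ - t := by
      refine measureReal_le_of_isUpperSet ρ ?_ (by linarith) fun x hx => ?_
      · intro x y hxy hx
        simp only [mem_compl_iff, mem_preimage, mem_Iic, not_le] at hx ⊢
        exact hx.trans_le (monotone_measureReal_Iio ρ hxy)
      · simp only [mem_compl_iff, mem_preimage, mem_Iic, not_le] at hx
        have := measureReal_Iio_add_Ioi ρ x
        linarith
    have := measureReal_add_measureReal_compl (μ := ρ)
      (s := (fun x => ρ.real (Iio x)) ⁻¹' Iic t) (hF measurableSet_Iic)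
    linarith

/-- The two distribution functions add up to the total mass R, so this is the previous statement
reflected by u ↦ R - u. -/
theorem map_measureReal_Ioi [IsFiniteMeasure ρ] [NullSingletonClass ρ] :
    ρ.map (fun x => ρ.real (Ioi x)) = volume.restrict (Ioc 0 (ρ.real univ)) := by
  have hF := (monotone_measureReal_Iio ρ).measurable
  have h1 : (fun x => ρ.real (Ioi x)) =
      (fun u => ρ.real univ - u) ∘ (fun x => ρ.real (Iio x)) := by
    ext x
    have := measureReal_Iio_add_Ioi ρ x
    simp only [Function.comp]
    linarith
  rw [h1, ← Measure.map_map (by fun_prop) hF, map_measureReal_Iio]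
  have h2 := (Measure.measurePreserving_sub_left volume (ρ.real univ)).restrict_preimage
    (s := Ioc 0 (ρ.real univ)) measurableSet_Ioc
  have h3 : (fun u => ρ.real univ - u) ⁻¹' Ioc 0 (ρ.real univ) = Ico 0 (ρ.real univ) := by
    ext u; simp only [mem_preimage, mem_Ioc, mem_Ico]; constructor <;> rintro ⟨a, b⟩ <;>
      constructor <;> linarith
  rw [h3, restrict_Ico_eq_restrict_Ioc] at h2
  exact h2.map_eq

theorem lintegral_rpow_Ioc {k R : ℝ} (hk : 1 ≤ k) (hR : 0 ≤ R) :
    ∫⁻ u in Ioc 0 R, ENNReal.ofReal (k * u ^ (k - 1)) = ENNReal.ofReal (R ^ k) := by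
  have hi : IntervalIntegrable (fun u : ℝ => k * u ^ (k - 1)) volume 0 R :=
    (intervalIntegral.intervalIntegrable_rpow' (by linarith)).const_mul _
  rw [← ofReal_integral_eq_lintegral_ofReal]
  · rw [← intervalIntegral.integral_of_le hR, intervalIntegral.integral_const_mul,
      integral_rpow (Or.inl (by linarith))]
    congr 1
    rw [sub_add_cancel, Real.zero_rpow (by linarith)]
    field_simp
    simp
  · exact (intervalIntegrable_iff_integrableOn_Ioc_of_le hR).1 hi
  · filter_upwards [ae_restrict_mem measurableSet_Ioc] with u hu
    have := hu.1.le
    simp only [Pi.zero_apply]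
    positivity

end Distribution

/-! ### The capacitary inequality -/

/-- The embedding of Lorentz spaces `L^{s,r} ⊆ L^{s,s}`, `r ≤ s`. -/
theorem lintegral_antitone_rpow_le {N : ℝ → ℝ≥0∞} (hN : Antitone N) {r s : ℝ} (hr : 1 ≤ r)
    (hrs : r ≤ s) :
    ENNReal.ofReal s * ∫⁻ t in Ioi (0 : ℝ), N t * ENNReal.ofReal (t ^ (s - 1)) ≤
      (∫⁻ t in Ioi (0 : ℝ), N t ^ (r / s) * ENNReal.ofReal (r * t ^ (r - 1))) ^ (s / r) := by
  have hr0 : 0 < r := by linarith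
  have hs0 : 0 < s := by linarith
  have hsr : 1 ≤ s / r := (one_le_div hr0).2 hrs
  set d : ℝ → ℝ≥0∞ := fun t => N t ^ (r / s) * ENNReal.ofReal (r * t ^ (r - 1)) with hd
  have hNm : Measurable N := hN.measurable
  have hdm : Measurable d := by fun_prop
  rcases eq_or_ne (∫⁻ t in Ioi (0 : ℝ), d t) ∞ with htop | hfin
  · rw [htop, ENNReal.top_rpow_of_pos (by positivity)]
    exact le_top
  -- The right side is a power of the total mass of κ. Since N is antitone, replacing N(u) by N(t)
  -- for u < t shows that the distribution function K(t) = κ(-∞,t) dominates N(t)^(r/s) t^r.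
  set κ : Measure ℝ := (volume.restrict (Ioi (0 : ℝ))).withDensity d with hκ
  have hκfin : IsFiniteMeasure κ := isFiniteMeasure_withDensity hfin
  have hκat : NullSingletonClass κ :=
    ⟨fun x => withDensity_absolutelyContinuous _ _ (measure_singleton x)⟩
  have hU : ∀ t, 0 < t → N t ^ (r / s) * ENNReal.ofReal (t ^ r) ≤
      ENNReal.ofReal (κ.real (Iio t)) := by
    intro t ht
    rw [ofReal_measureReal, hκ, withDensity_apply _ measurableSet_Iio,
      Measure.restrict_restrict measurableSet_Iio, ← lintegral_rpow_Ioc hr ht.le,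
      ← restrict_Ioo_eq_restrict_Ioc, ← lintegral_const_mul _ (by fun_prop)]
    have : Iio t ∩ Ioi 0 = Ioo 0 t := by ext; simp [and_comm]
    rw [this]
    refine setLIntegral_mono hdm fun u hu => ?_
    simp only [hd]
    gcongr
    exact hN hu.2.le
  -- Splitting N = (N^(r/s))^(s/r-1) · N^(r/s) and applying `hU` to the first factor bounds the
  -- integrand by (s/r) K^(s/r-1) dK, the differential of K^(s/r).
  have hpt : ∀ t ∈ Ioi (0 : ℝ), ENNReal.ofReal s * (N t * ENNReal.ofReal (t ^ (s - 1))) ≤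
      (d * fun t => ENNReal.ofReal (s / r * κ.real (Iio t) ^ (s / r - 1))) t := by
    intro t ht
    have ht : 0 < t := ht
    have h1 : N t = (N t ^ (r / s)) ^ (s / r - 1) * N t ^ (r / s) := by
      rcases eq_or_ne (N t) 0 with h0 | h0
      · rw [h0, ENNReal.zero_rpow_of_pos (by positivity), mul_zero]
      rcases eq_or_ne (N t) ∞ with h2 | h2
      · have := hU t ht
        rw [h2, ENNReal.top_rpow_of_pos (by positivity), ENNReal.top_mul] at this
        · exact absurd (top_le_iff.1 this) ENNReal.ofReal_ne_top
        · simp only [ne_eq, ENNReal.ofReal_eq_zero, not_le]; positivity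
      · rw [← ENNReal.rpow_mul, ← ENNReal.rpow_add _ _ h0 h2]
        have : r / s * (s / r - 1) + r / s = 1 := by field_simp; ring
        rw [this, ENNReal.rpow_one]
    have h2 : s * t ^ (s - 1) = (s / r) * (t ^ r) ^ (s / r - 1) * (r * t ^ (r - 1)) := by
      rw [← Real.rpow_mul ht.le]
      have : s - 1 = r * (s / r - 1) + (r - 1) := by field_simp; ring
      rw [this, Real.rpow_add ht]
      field_simp
    calc ENNReal.ofReal s * (N t * ENNReal.ofReal (t ^ (s - 1)))
        = N t * ENNReal.ofReal (s * t ^ (s - 1)) := by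
          rw [ENNReal.ofReal_mul hs0.le]; ring
      _ = ENNReal.ofReal (s / r) * (N t ^ (r / s) * ENNReal.ofReal (t ^ r)) ^ (s / r - 1) *
            d t := by
          rw [h2, ENNReal.ofReal_mul (by positivity), ENNReal.ofReal_mul (by positivity),
            ← ENNReal.ofReal_rpow_of_nonneg (by positivity) (by linarith),
            ENNReal.mul_rpow_of_nonneg _ _ (by linarith)]
          conv_lhs => rw [h1]
          simp only [hd]
          ring
      _ ≤ ENNReal.ofReal (s / r) * (ENNReal.ofReal (κ.real (Iio t))) ^ (s / r - 1) * d t := by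
          refine mul_le_mul_left (mul_le_mul_right ?_ _) _
          exact ENNReal.rpow_le_rpow (hU t ht) (by linarith)
      _ = _ := by
          rw [ENNReal.ofReal_rpow_of_nonneg measureReal_nonneg (by linarith),
            ← ENNReal.ofReal_mul (by positivity), mul_comm]
          rfl
  have hFm := (monotone_measureReal_Iio κ).measurable
  calc ENNReal.ofReal s * ∫⁻ t in Ioi (0 : ℝ), N t * ENNReal.ofReal (t ^ (s - 1))
      = ∫⁻ t in Ioi (0 : ℝ), ENNReal.ofReal s * (N t * ENNReal.ofReal (t ^ (s - 1))) :=
        (lintegral_const_mul _ (by fun_prop)).symm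
    _ ≤ ∫⁻ t in Ioi (0 : ℝ),
          (d * fun t => ENNReal.ofReal (s / r * κ.real (Iio t) ^ (s / r - 1))) t :=
        setLIntegral_mono (by fun_prop) hpt
    _ = ∫⁻ t, ENNReal.ofReal (s / r * κ.real (Iio t) ^ (s / r - 1)) ∂κ :=
        (lintegral_withDensity_eq_lintegral_mul _ hdm (by fun_prop)).symm
    _ = ∫⁻ u, ENNReal.ofReal (s / r * u ^ (s / r - 1)) ∂(κ.map fun x => κ.real (Iio x)) := by
        rw [lintegral_map (by fun_prop) hFm]
    _ = ENNReal.ofReal (κ.real univ ^ (s / r)) := by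
        rw [map_measureReal_Iio, lintegral_rpow_Ioc hsr measureReal_nonneg]
    _ = _ := by
        rw [← ENNReal.ofReal_rpow_of_nonneg measureReal_nonneg (by positivity),
          ofReal_measureReal, hκ, withDensity_apply _ MeasurableSet.univ, setLIntegral_univ]

/-- The `r`-energy of the truncation `(F / t)^γ ∧ 1` of a function `F` with derivative `φ`. -/
noncomputable def levelEnergy (m : Measure ℝ) (φ : ℝ → ℝ≥0∞) (F : ℝ → ℝ) (r γ t : ℝ) : ℝ≥0∞ :=
  ∫⁻ x in {x | F x < t}, (ENNReal.ofReal (γ * F x ^ (γ - 1) * t ^ (-γ)) * φ x) ^ r ∂m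

/-- The function (F/t)^γ climbs from 0 to 1 over {F < t}: because F carries φ m to Lebesgue measure,
its derivative f φ with respect to m has integral 1 there. Hölder's inequality against the constant
1 then gives 1 ≤ energy^(1/r) · m(A)^(1/γ). -/
theorem measure_rpow_le_levelEnergy {m : Measure ℝ} {φ : ℝ → ℝ≥0∞} (hφ : Measurable φ)
    {F : ℝ → ℝ} (hF : Measurable F) {R : ℝ}
    (hmap : (m.withDensity φ).map F = volume.restrict (Ioc 0 R))
    {r γ : ℝ} (hr : r.HolderConjugate γ) {t : ℝ} (ht : 0 < t) (htR : t ≤ R)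
    {A : Set ℝ} (hA : {x | F x < t} ⊆ A) :
    m A ^ (1 - r) ≤ levelEnergy m φ F r γ t := by
  have hγ : 1 < γ := hr.symm.lt
  have hr1 : 1 < r := hr.lt
  have hS : MeasurableSet {x | F x < t} := measurableSet_lt hF measurable_const
  set f : ℝ → ℝ≥0∞ := fun x => ENNReal.ofReal (γ * F x ^ (γ - 1) * t ^ (-γ)) with hf
  have hfm : Measurable f := by fun_prop
  have h1 : ∫⁻ x in {x | F x < t}, (f x * φ x) ∂m = 1 := by
    have e1 : ∫⁻ x in {x | F x < t}, f x ∂(m.withDensity φ) =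
        ∫⁻ x in {x | F x < t}, (f x * φ x) ∂m := by
      rw [setLIntegral_withDensity_eq_setLIntegral_mul _ hφ hfm hS]
      simp only [Pi.mul_apply, mul_comm]
    rw [← e1]
    have e2 : ∫⁻ x in F ⁻¹' (Iio t), f x ∂(m.withDensity φ) =
        ∫⁻ u in Iio t, ENNReal.ofReal (γ * u ^ (γ - 1) * t ^ (-γ)) ∂((m.withDensity φ).map F) :=
      by
      rw [setLIntegral_map measurableSet_Iio (by fun_prop) hF]
    change ∫⁻ x in F ⁻¹' (Iio t), f x ∂(m.withDensity φ) = 1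
    rw [e2, hmap, Measure.restrict_restrict measurableSet_Iio]
    have : Iio t ∩ Ioc 0 R = Ioo 0 t := by
      ext x; simp only [mem_inter_iff, mem_Iio, mem_Ioc, mem_Ioo]
      constructor
      · rintro ⟨a, b, c⟩; exact ⟨b, a⟩
      · rintro ⟨a, b⟩; exact ⟨b, a, b.le.trans htR⟩
    rw [this, restrict_Ioo_eq_restrict_Ioc]
    simp_rw [ENNReal.ofReal_mul' (Real.rpow_nonneg ht.le (-γ))]
    rw [lintegral_mul_const' _ _ ENNReal.ofReal_ne_top, lintegral_rpow_Ioc hγ.le ht.le,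
      ← ENNReal.ofReal_mul (by positivity), ← Real.rpow_add ht]
    simp
  have h2 := ENNReal.lintegral_mul_le_Lp_mul_Lq (m.restrict {x | F x < t}) hr
    (f := fun x => f x * φ x) (g := fun _ => 1) (by fun_prop) (by fun_prop)
  simp only [Pi.mul_apply, mul_one, h1, ENNReal.one_rpow, lintegral_one,
    Measure.restrict_apply_univ] at h2
  have h3 : (1 : ℝ≥0∞) ≤ levelEnergy m φ F r γ t * m A ^ (r - 1) := by
    have h4 : (1 : ℝ≥0∞) ^ r ≤ ((∫⁻ x in {x | F x < t}, (f x * φ x) ^ r ∂m) ^ (1 / r) *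
      m A ^ (1 / γ)) ^ r := by
      refine ENNReal.rpow_le_rpow (h2.trans ?_) (by linarith)
      gcongr
    rw [ENNReal.one_rpow, ENNReal.mul_rpow_of_nonneg _ _ (by linarith), ← ENNReal.rpow_mul,
      ← ENNReal.rpow_mul] at h4
    have e1 : 1 / r * r = 1 := by field_simp
    have e2 : 1 / γ * r = r - 1 := by
      have := hr.inv_add_inv_eq_one
      field_simp at this ⊢
      linarith
    rwa [e1, e2, ENNReal.rpow_one] at h4
  have := ENNReal.div_le_of_le_mul h3
  rwa [one_div, ← ENNReal.rpow_neg, neg_sub] at this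

/-- Weighted arithmetic-geometric mean: r^(1/r) γ^(1/γ) ≤ r/r + γ/γ = 2. This makes the final
constant independent of the exponents; it is sharp for r = γ = 2. -/
theorem mul_rpow_conj_le_two_rpow {r γ : ℝ} (hr : r.HolderConjugate γ) :
    r * γ ^ (r - 1) ≤ 2 ^ r := by
  have h0 := hr.pos
  have h1 := hr.symm.pos
  have h := Real.geom_mean_le_arith_mean2_weighted (inv_nonneg.2 h0.le) (inv_nonneg.2 h1.le)
    h0.le h1.le hr.inv_add_inv_eq_one
  rw [inv_mul_cancel₀ h0.ne', inv_mul_cancel₀ h1.ne', one_add_one_eq_two] at h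
  have h2 := Real.rpow_le_rpow (by positivity) h h0.le
  rw [Real.mul_rpow (by positivity) (by positivity), ← Real.rpow_mul h0.le,
    ← Real.rpow_mul h1.le, inv_mul_cancel₀ h0.ne', Real.rpow_one] at h2
  have e2 : γ⁻¹ * r = r - 1 := by
    have := hr.inv_add_inv_eq_one
    field_simp at this ⊢
    linarith
  rwa [e2] at h2

/-- By Tonelli the t-integral is taken first, over t > F(x). Because (γ-1) r = γ and γ r = γ + r,
the powers of F(x) cancel and the inner integral is r γ^(r-1) whenever F(x) > 0, and 0 when F(x) =
0. -/
theorem lintegral_levelEnergy_le {m : Measure ℝ} [SFinite m] {φ : ℝ → ℝ≥0∞} (hφ : Measurable φ)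
    {F : ℝ → ℝ} (hF : Measurable F) (hF0 : ∀ x, 0 ≤ F x) {r γ : ℝ} (hr : r.HolderConjugate γ)
    (T : ℝ) :
    ∫⁻ t in Ioc 0 T, levelEnergy m φ F r γ t * ENNReal.ofReal (r * t ^ (r - 1)) ≤
      2 ^ r * ∫⁻ x in {x | F x < T}, φ x ^ r ∂m := by
  have hγ : 1 < γ := hr.symm.lt
  have hr1 : 1 < r := hr.lt
  have hγr : γ * r = γ + r := by
    have := hr.inv_add_inv_eq_one
    field_simp at this
    linarith
  have hinner : ∀ u : ℝ, 0 ≤ u → ∫⁻ t in Ioi u,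
      ENNReal.ofReal (γ * u ^ (γ - 1) * t ^ (-γ)) ^ r * ENNReal.ofReal (r * t ^ (r - 1)) ≤
        2 ^ r := by
    intro u hu
    rcases hu.eq_or_lt with rfl | hu
    · rw [Real.zero_rpow (by linarith)]
      simp [ENNReal.zero_rpow_of_pos hr.pos]
    have e1 : ∀ t ∈ Ioi u, ENNReal.ofReal (γ * u ^ (γ - 1) * t ^ (-γ)) ^ r *
        ENNReal.ofReal (r * t ^ (r - 1)) =
        ENNReal.ofReal (γ ^ r * u ^ γ * r * t ^ (-γ - 1)) := by
      intro t ht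
      have ht0 : 0 < t := hu.trans ht
      rw [ENNReal.ofReal_rpow_of_nonneg (by positivity) hr.pos.le,
        ← ENNReal.ofReal_mul (by positivity), Real.mul_rpow (by positivity) (by positivity),
        Real.mul_rpow (by positivity) (by positivity), ← Real.rpow_mul hu.le,
        ← Real.rpow_mul ht0.le]
      have a1 : (γ - 1) * r = γ := by linarith
      have a2 : -γ - 1 = -γ * r + (r - 1) := by linarith
      rw [a1, a2, Real.rpow_add ht0]
      congr 1
      ring
    rw [setLIntegral_congr_fun measurableSet_Ioi e1, ← ofReal_integral_eq_lintegral_ofReal]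
    · rw [integral_const_mul, integral_Ioi_rpow_of_lt (by linarith) hu]
      have : γ ^ r * u ^ γ * r * (-u ^ (-γ - 1 + 1) / (-γ - 1 + 1)) = r * γ ^ (r - 1) := by
        rw [sub_add_cancel, Real.rpow_neg hu.le, Real.rpow_sub_one (by positivity)]
        have : u ^ γ ≠ 0 := by positivity
        field_simp
      rw [this]
      calc ENNReal.ofReal (r * γ ^ (r - 1)) ≤ ENNReal.ofReal (2 ^ r) :=
            ENNReal.ofReal_le_ofReal (mul_rpow_conj_le_two_rpow hr)
        _ = 2 ^ r := by
            rw [← ENNReal.ofReal_rpow_of_pos two_pos]; simp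
    · exact (integrableOn_Ioi_rpow_of_lt (by linarith) hu).const_mul _
    · filter_upwards [ae_restrict_mem measurableSet_Ioi] with t ht
      have ht0 : 0 < t := hu.trans ht
      simp only [Pi.zero_apply]
      have := hr.pos
      positivity
  set k : ℝ → ℝ → ℝ≥0∞ := fun t x => {z : ℝ × ℝ | F z.2 < z.1}.indicator
    (fun z => (ENNReal.ofReal (γ * F z.2 ^ (γ - 1) * z.1 ^ (-γ)) * φ z.2) ^ r *
      ENNReal.ofReal (r * z.1 ^ (r - 1))) (t, x) with hk
  have hkm : Measurable (Function.uncurry k) := by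
    refine Measurable.indicator (by fun_prop) ?_
    exact measurableSet_lt (by fun_prop) (by fun_prop)
  have h1 : ∀ t, levelEnergy m φ F r γ t * ENNReal.ofReal (r * t ^ (r - 1)) = ∫⁻ x, k t x ∂m := by
    intro t
    rw [levelEnergy, ← lintegral_mul_const _ (by fun_prop),
      ← lintegral_indicator (measurableSet_lt hF measurable_const)]
    rfl
  simp_rw [h1]
  rw [lintegral_lintegral_swap hkm.aemeasurable, ← lintegral_indicator
    (measurableSet_lt hF measurable_const), ← lintegral_const_mul _
      (Measurable.indicator (by fun_prop) (measurableSet_lt hF measurable_const))]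
  refine lintegral_mono fun x => ?_
  by_cases hx : F x < T
  · rw [indicator_of_mem (show x ∈ {x | F x < T} from hx)]
    have e : ∀ t, k t x = (Ioi (F x)).indicator (fun t =>
        (ENNReal.ofReal (γ * F x ^ (γ - 1) * t ^ (-γ)) ^ r *
          ENNReal.ofReal (r * t ^ (r - 1))) * φ x ^ r) t := by
      intro t
      simp only [hk, indicator, mem_ofPred_eq, mem_Ioi]
      split_ifs
      · rw [ENNReal.mul_rpow_of_nonneg _ _ hr.pos.le]; ring
      · rfl
    simp_rw [e]
    refine (setLIntegral_le_lintegral _ _).trans ?_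
    rw [lintegral_indicator measurableSet_Ioi, lintegral_mul_const _ (by fun_prop)]
    gcongr
    exact hinner _ (hF0 x)
  · have : ∫⁻ t in Ioc 0 T, k t x = ∫⁻ t in Ioc 0 T, 0 := by
      refine setLIntegral_congr_fun measurableSet_Ioc fun t ht => ?_
      simp only [hk, indicator, mem_ofPred_eq]
      rw [if_neg (by have := ht.2; linarith)]
    rw [this]
    simp

/-- Passing from level sets to integrals. -/
theorem lintegral_rpow_le_of_level {n : Measure ℝ} {H : ℝ → ℝ} (hH : Measurable H)
    (hH0 : ∀ x, 0 ≤ H x) {r s : ℝ} (hr : 1 ≤ r) (hrs : r ≤ s) {T : ℝ}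
    (hT : ∀ x, H x ≤ T) {B K : ℝ≥0∞} (hB : B ≠ ∞) {e : ℝ → ℝ≥0∞}
    (he : ∀ t ∈ Ioo 0 T, n {x | t < H x} ≤ B ^ s * e t ^ (s / r))
    (hK : ∫⁻ t in Ioc 0 T, e t * ENNReal.ofReal (r * t ^ (r - 1)) ≤ K) :
    ∫⁻ x, ENNReal.ofReal (H x ^ s) ∂n ≤ (B ^ r * K) ^ (s / r) := by
  have hr0 : 0 < r := by linarith
  have hs0 : 0 < s := by linarith
  rw [lintegral_rpow_eq_lintegral_meas_lt_mul n (ae_of_all _ hH0) hH.aemeasurable hs0]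
  have hN : Antitone fun t => n {x | t < H x} := fun a b hab =>
    measure_mono fun x hx => lt_of_le_of_lt hab hx
  refine (lintegral_antitone_rpow_le hN hr hrs).trans ?_
  refine ENNReal.rpow_le_rpow ?_ (by positivity)
  -- Levels t ≥ T are not exceeded because H ≤ T, so the bound `he`, available only below T, is
  -- enough.
  have h1 : ∫⁻ t in Ioi (0 : ℝ), n {x | t < H x} ^ (r / s) * ENNReal.ofReal (r * t ^ (r - 1)) =
      ∫⁻ t in Ioo (0 : ℝ) T, n {x | t < H x} ^ (r / s) * ENNReal.ofReal (r * t ^ (r - 1)) := by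
    rw [← lintegral_indicator measurableSet_Ioi, ← lintegral_indicator measurableSet_Ioo]
    congr 1
    ext t
    simp only [indicator, mem_Ioi, mem_Ioo]
    by_cases h : t < T
    · simp [h]
    · have : {x | t < H x} = ∅ := by
        ext x; simp only [mem_ofPred_eq, mem_empty_iff_false, iff_false, not_lt]
        exact (hT x).trans (not_lt.1 h)
      simp only [h, and_false, if_false, this, measure_empty]
      rw [ENNReal.zero_rpow_of_pos (by positivity)]
      simp
  rw [h1]
  have hm : Measurable fun t => n {x | t < H x} := hN.measurable
  calc _ ≤ ∫⁻ t in Ioo (0 : ℝ) T, B ^ r * (e t * ENNReal.ofReal (r * t ^ (r - 1))) := by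
        refine setLIntegral_mono' measurableSet_Ioo fun t ht => ?_
        rw [← mul_assoc]
        gcongr
        calc n {x | t < H x} ^ (r / s) ≤ (B ^ s * e t ^ (s / r)) ^ (r / s) := by
              gcongr; exact he t ht
          _ = B ^ r * e t := by
              rw [ENNReal.mul_rpow_of_nonneg _ _ (by positivity), ← ENNReal.rpow_mul,
                ← ENNReal.rpow_mul]
              have e1 : s * (r / s) = r := by field_simp
              have e2 : s / r * (r / s) = 1 := by field_simp
              rw [e1, e2, ENNReal.rpow_one]
    _ = B ^ r * ∫⁻ t in Ioo (0 : ℝ) T, e t * ENNReal.ofReal (r * t ^ (r - 1)) :=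
        lintegral_const_mul' _ _ (ENNReal.rpow_ne_top_of_nonneg hr0.le hB)
    _ ≤ B ^ r * K := by
        gcongr
        rw [restrict_Ioo_eq_restrict_Ioc]; exact hK

theorem measurable_levelEnergy {m : Measure ℝ} [SFinite m] {φ : ℝ → ℝ≥0∞} (hφ : Measurable φ)
    {F : ℝ → ℝ} (hF : Measurable F) (r γ : ℝ) : Measurable (levelEnergy m φ F r γ) := by
  have h1 : levelEnergy m φ F r γ = fun t => ∫⁻ x, {z : ℝ × ℝ | F z.2 < z.1}.indicator
      (fun z => (ENNReal.ofReal (γ * F z.2 ^ (γ - 1) * z.1 ^ (-γ)) * φ z.2) ^ r) (t, x) ∂m := by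
    ext t
    rw [levelEnergy, ← lintegral_indicator (measurableSet_lt hF measurable_const)]
    rfl
  rw [h1]
  refine Measurable.lintegral_prod_right' (Measurable.indicator (by fun_prop) ?_)
  exact measurableSet_lt (by fun_prop) (by fun_prop)

/-- Left continuity of the distribution function. The rational witness lets level sets be written as
countable directed unions of rays or intervals on which the isoperimetric hypothesis applies. -/
theorem exists_rat_lt_measureReal_Iio {ρ : Measure ℝ} [IsFiniteMeasure ρ] [NullSingletonClass ρ]
    {x t : ℝ} (ht : 0 ≤ t) (h : t < ρ.real (Iio x)) :
    ∃ q : ℚ, (q : ℝ) < x ∧ t < ρ.real (Iio (q : ℝ)) := by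
  by_contra! hcon
  refine absurd h (not_lt.2 (measureReal_le_of_isLowerSet ρ (isLowerSet_Iio x) ht fun y hy => ?_))
  obtain ⟨q, hyq, hqx⟩ := exists_rat_btwn (show y < x from hy)
  exact (monotone_measureReal_Iio ρ hyq.le).trans (hcon q hqx)

theorem exists_rat_lt_measureReal_Ioi {ρ : Measure ℝ} [IsFiniteMeasure ρ] [NullSingletonClass ρ]
    {x t : ℝ} (ht : 0 ≤ t) (h : t < ρ.real (Ioi x)) :
    ∃ q : ℚ, x < (q : ℝ) ∧ t < ρ.real (Ioi (q : ℝ)) := by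
  by_contra! hcon
  refine absurd h (not_lt.2 (measureReal_le_of_isUpperSet ρ (isUpperSet_Ioi x) ht fun y hy => ?_))
  obtain ⟨q, hyq, hqx⟩ := exists_rat_btwn (show x < y from hy)
  exact (antitone_measureReal_Ioi ρ hqx.le).trans (hcon q hyq)

theorem two_mul_rpow_mul (B I : ℝ≥0∞) {r : ℝ} (hr : 0 ≤ r) :
    B ^ r * (2 ^ r * I) = (2 * B) ^ r * I := by
  rw [ENNReal.mul_rpow_of_nonneg _ _ hr]; ring

theorem nullSingletonClass_withDensity {m : Measure ℝ} [NullSingletonClass m] (φ : ℝ → ℝ≥0∞) :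
    NullSingletonClass (m.withDensity φ) :=
  ⟨fun x => withDensity_absolutelyContinuous _ _ (measure_singleton x)⟩

theorem measure_ne_zero_of_withDensity_pos {m : Measure ℝ} {φ : ℝ → ℝ≥0∞} {A : Set ℝ} {t : ℝ} (ht : 0 ≤ t)
    (h : t < (m.withDensity φ).real A) : m A ≠ 0 := by
  intro h0
  rw [measureReal_def, withDensity_absolutelyContinuous m φ h0] at h
  simp at h
  linarith

/-! ### Weighted Hardy inequalities for distribution functions -/

section Core

variable {m n : Measure ℝ} [SFinite m] [NullSingletonClass m] {φ : ℝ → ℝ≥0∞} {r γ s : ℝ}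
  {B : ℝ≥0∞}

/-- The weighted Hardy inequality with Dirichlet conditions at both ends. -/
theorem lintegral_min_rpow_le (hφ : Measurable φ) (hfin : ∫⁻ x, φ x ∂m ≠ ∞)
    (hr : r.HolderConjugate γ) (hrs : r ≤ s) (hB : B ≠ ∞)
    (h : ∀ x y, x ≤ y → m (Iio x) ≠ 0 → m (Ioi y) ≠ 0 →
      n (Ioo x y) ≤ B ^ s * (m (Iio x) ^ (1 - r) + m (Ioi y) ^ (1 - r)) ^ (s / r)) :
    ∫⁻ x, ENNReal.ofReal (min ((m.withDensity φ).real (Iio x))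
        ((m.withDensity φ).real (Ioi x)) ^ s) ∂n ≤
      ((2 * B) ^ r * ∫⁻ x, φ x ^ r ∂m) ^ (s / r) := by
  have hr1 := hr.lt
  have hs0 : 0 < s := by linarith
  have hsr : 0 ≤ s / r := by positivity
  have hρ : IsFiniteMeasure (m.withDensity φ) := isFiniteMeasure_withDensity hfin
  have hρ' : NullSingletonClass (m.withDensity φ) := nullSingletonClass_withDensity φ
  set ρ := m.withDensity φ with hρdef
  set F : ℝ → ℝ := fun x => ρ.real (Iio x) with hF
  set G : ℝ → ℝ := fun x => ρ.real (Ioi x) with hG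
  have hFmono : Monotone F := monotone_measureReal_Iio ρ
  have hGanti : Antitone G := antitone_measureReal_Ioi ρ
  have hFm : Measurable F := hFmono.measurable
  have hGm : Measurable G := hGanti.measurable
  have hF0 : ∀ x, 0 ≤ F x := fun x => measureReal_nonneg
  have hG0 : ∀ x, 0 ≤ G x := fun x => measureReal_nonneg
  set R := ρ.real univ with hR
  have hFG : ∀ x, F x + G x = R := measureReal_Iio_add_Ioi ρ
  rw [← two_mul_rpow_mul _ _ hr.pos.le]
  -- As F + G = R, the minimum never exceeds R/2. For the same reason {F < R/2} and {G < R/2} are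
  -- disjoint, so the energies from the two sides together stay below the full energy.
  refine lintegral_rpow_le_of_level (T := R / 2)
    (e := fun t => levelEnergy m φ F r γ t + levelEnergy m φ G r γ t) (hFm.min hGm)
    (fun x => le_min (hF0 x) (hG0 x)) hr1.le hrs ?_ hB ?_ ?_
  · intro x
    rcases le_total (F x) (G x) with h1 | h1
    · rw [min_eq_left h1]; have := hFG x; linarith
    · rw [min_eq_right h1]; have := hFG x; linarith
  · rintro t ⟨ht0, htR⟩
    -- Every rational interval in the union has F > t at its left end and G > t at its right end, so
    -- {F < t} lies to the left of it and {G < t} to the right.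
    have hU : {x | t < min (F x) (G x)} = ⋃ ab : {ab : ℚ × ℚ // t < F ab.1 ∧ t < G ab.2},
        Ioo ((ab.1.1 : ℚ) : ℝ) ((ab.1.2 : ℚ) : ℝ) := by
      ext x
      simp only [mem_ofPred_eq, lt_min_iff, mem_iUnion, mem_Ioo]
      constructor
      · rintro ⟨h1, h2⟩
        obtain ⟨a, hax, ha⟩ := exists_rat_lt_measureReal_Iio ht0.le h1
        obtain ⟨b, hbx, hb⟩ := exists_rat_lt_measureReal_Ioi ht0.le h2
        exact ⟨⟨(a, b), ha, hb⟩, hax, hbx⟩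
      · rintro ⟨⟨⟨a, b⟩, ha, hb⟩, hax, hbx⟩
        exact ⟨ha.trans_le (hFmono hax.le), hb.trans_le (hGanti hbx.le)⟩
    have hdir : Directed (· ⊆ ·) (fun ab : {ab : ℚ × ℚ // t < F ab.1 ∧ t < G ab.2} =>
        Ioo ((ab.1.1 : ℚ) : ℝ) ((ab.1.2 : ℚ) : ℝ)) := by
      rintro ⟨⟨a, b⟩, ha, hb⟩ ⟨⟨a', b'⟩, ha', hb'⟩
      refine ⟨⟨(min a a', max b b'), ?_, ?_⟩, ?_, ?_⟩
      · rcases min_choice a a' with h | h <;> rw [h] <;> assumption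
      · rcases max_choice b b' with h | h <;> rw [h] <;> assumption
      · refine Ioo_subset_Ioo ?_ ?_
        · exact_mod_cast min_le_left _ _
        · exact_mod_cast le_max_left _ _
      · refine Ioo_subset_Ioo ?_ ?_
        · exact_mod_cast min_le_right _ _
        · exact_mod_cast le_max_right _ _
    rw [hU, hdir.measure_iUnion]
    refine iSup_le ?_
    rintro ⟨⟨a, b⟩, ha, hb⟩
    simp only at ha hb ⊢
    rcases le_or_gt (a : ℝ) b with hab | hab
    · refine (h a b hab (measure_ne_zero_of_withDensity_pos ht0.le ha)
        (measure_ne_zero_of_withDensity_pos ht0.le hb)).trans ?_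
      gcongr
      · refine measure_rpow_le_levelEnergy hφ hFm (map_measureReal_Iio ρ) hr ht0 (by linarith) ?_
        intro x hx
        by_contra hcon
        exact absurd (hFmono (not_lt.1 hcon)) (not_le.2 (lt_trans hx ha))
      · refine measure_rpow_le_levelEnergy hφ hGm (map_measureReal_Ioi ρ) hr ht0 (by linarith) ?_
        intro x hx
        by_contra hcon
        exact absurd (hGanti (not_lt.1 hcon)) (not_le.2 (lt_trans hx hb))
    · rw [Ioo_eq_empty (not_lt.2 hab.le), measure_empty]
      exact zero_le
  · simp_rw [add_mul]
    have hm := measurable_levelEnergy (m := m) hφ hFm r γ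
    rw [lintegral_add_left (by fun_prop)]
    refine (add_le_add (lintegral_levelEnergy_le hφ hFm hF0 hr _)
      (lintegral_levelEnergy_le hφ hGm hG0 hr _)).trans ?_
    rw [← mul_add, ← lintegral_union (measurableSet_lt hGm measurable_const)]
    · gcongr
      exact Measure.restrict_le_self
    · rw [Set.disjoint_left]
      intro x (hx : F x < R / 2) (hx' : G x < R / 2)
      have := hFG x
      linarith

/-- The weighted Hardy inequality with a Dirichlet condition at the left end. -/
theorem lintegral_Iio_rpow_le (hφ : Measurable φ) (hfin : ∫⁻ x, φ x ∂m ≠ ∞)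
    (hr : r.HolderConjugate γ) (hrs : r ≤ s) (hB : B ≠ ∞)
    (h : ∀ x, m (Iio x) ≠ 0 → n (Ioi x) ≤ B ^ s * (m (Iio x) ^ (1 - r)) ^ (s / r)) :
    ∫⁻ x, ENNReal.ofReal ((m.withDensity φ).real (Iio x) ^ s) ∂n ≤
      ((2 * B) ^ r * ∫⁻ x, φ x ^ r ∂m) ^ (s / r) := by
  have hr1 := hr.lt
  have hs0 : 0 < s := by linarith
  have hsr : 0 ≤ s / r := by positivity
  have hρ : IsFiniteMeasure (m.withDensity φ) := isFiniteMeasure_withDensity hfin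
  have hρ' : NullSingletonClass (m.withDensity φ) := nullSingletonClass_withDensity φ
  set ρ := m.withDensity φ with hρdef
  set F : ℝ → ℝ := fun x => ρ.real (Iio x) with hF
  have hFmono : Monotone F := monotone_measureReal_Iio ρ
  have hFm : Measurable F := hFmono.measurable
  have hF0 : ∀ x, 0 ≤ F x := fun x => measureReal_nonneg
  set R := ρ.real univ with hR
  rw [← two_mul_rpow_mul _ _ hr.pos.le]
  refine lintegral_rpow_le_of_level (T := R) (e := levelEnergy m φ F r γ) hFm
    hF0 hr1.le hrs (fun x => measureReal_mono (subset_univ _)) hB ?_ ?_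
  · rintro t ⟨ht0, htR⟩
    have hU : {x | t < F x} = ⋃ a : {a : ℚ // t < F a}, Ioi ((a : ℚ) : ℝ) := by
      ext x
      simp only [mem_ofPred_eq, mem_iUnion, mem_Ioi]
      constructor
      · intro h1
        obtain ⟨a, hax, ha⟩ := exists_rat_lt_measureReal_Iio ht0.le h1
        exact ⟨⟨a, ha⟩, hax⟩
      · rintro ⟨⟨a, ha⟩, hax⟩
        exact ha.trans_le (hFmono (le_of_lt hax))
    have hdir : Directed (· ⊆ ·) (fun a : {a : ℚ // t < F a} => Ioi ((a : ℚ) : ℝ)) :=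
      Antitone.directed_le fun a b hab => Ioi_subset_Ioi (by exact_mod_cast hab)
    rw [hU, hdir.measure_iUnion]
    refine iSup_le ?_
    rintro ⟨a, ha⟩
    refine (h a (measure_ne_zero_of_withDensity_pos ht0.le ha)).trans ?_
    gcongr
    refine measure_rpow_le_levelEnergy hφ hFm (map_measureReal_Iio ρ) hr ht0 htR.le ?_
    intro x hx
    by_contra hcon
    exact absurd (hFmono (not_lt.1 hcon)) (not_le.2 (lt_trans hx ha))
  · refine (lintegral_levelEnergy_le hφ hFm hF0 hr _).trans ?_
    gcongr
    exact Measure.restrict_le_self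

/-- The weighted Hardy inequality with a Dirichlet condition at the right end. -/
theorem lintegral_Ioi_rpow_le (hφ : Measurable φ) (hfin : ∫⁻ x, φ x ∂m ≠ ∞)
    (hr : r.HolderConjugate γ) (hrs : r ≤ s) (hB : B ≠ ∞)
    (h : ∀ x, m (Ioi x) ≠ 0 → n (Iio x) ≤ B ^ s * (m (Ioi x) ^ (1 - r)) ^ (s / r)) :
    ∫⁻ x, ENNReal.ofReal ((m.withDensity φ).real (Ioi x) ^ s) ∂n ≤
      ((2 * B) ^ r * ∫⁻ x, φ x ^ r ∂m) ^ (s / r) := by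
  have hr1 := hr.lt
  have hs0 : 0 < s := by linarith
  have hsr : 0 ≤ s / r := by positivity
  have hρ : IsFiniteMeasure (m.withDensity φ) := isFiniteMeasure_withDensity hfin
  have hρ' : NullSingletonClass (m.withDensity φ) := nullSingletonClass_withDensity φ
  set ρ := m.withDensity φ with hρdef
  set G : ℝ → ℝ := fun x => ρ.real (Ioi x) with hG
  have hGanti : Antitone G := antitone_measureReal_Ioi ρ
  have hGm : Measurable G := hGanti.measurable
  have hG0 : ∀ x, 0 ≤ G x := fun x => measureReal_nonneg
  set R := ρ.real univ with hR
  rw [← two_mul_rpow_mul _ _ hr.pos.le]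
  refine lintegral_rpow_le_of_level (T := R) (e := levelEnergy m φ G r γ) hGm
    hG0 hr1.le hrs (fun x => measureReal_mono (subset_univ _)) hB ?_ ?_
  · rintro t ⟨ht0, htR⟩
    have hU : {x | t < G x} = ⋃ a : {a : ℚ // t < G a}, Iio ((a : ℚ) : ℝ) := by
      ext x
      simp only [mem_ofPred_eq, mem_iUnion, mem_Iio]
      constructor
      · intro h1
        obtain ⟨a, hax, ha⟩ := exists_rat_lt_measureReal_Ioi ht0.le h1
        exact ⟨⟨a, ha⟩, hax⟩
      · rintro ⟨⟨a, ha⟩, hax⟩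
        exact ha.trans_le (hGanti (le_of_lt hax))
    have hdir : Directed (· ⊆ ·) (fun a : {a : ℚ // t < G a} => Iio ((a : ℚ) : ℝ)) :=
      Monotone.directed_le fun a b hab => Iio_subset_Iio (by exact_mod_cast hab)
    rw [hU, hdir.measure_iUnion]
    refine iSup_le ?_
    rintro ⟨a, ha⟩
    refine (h a (measure_ne_zero_of_withDensity_pos ht0.le ha)).trans ?_
    gcongr
    refine measure_rpow_le_levelEnergy hφ hGm (map_measureReal_Ioi ρ) hr ht0 htR.le ?_
    intro x hx
    by_contra hcon
    exact absurd (hGanti (not_lt.1 hcon)) (not_le.2 (lt_trans hx ha))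
  · refine (lintegral_levelEnergy_le hφ hGm hG0 hr _).trans ?_
    gcongr
    exact Measure.restrict_le_self

end Core

/-! ### Hardy inequalities on compact intervals -/

/-- The measure `σ dx` on `E`. -/
noncomputable def weightMeasure (E : Set ℝ) (σ : ℝ → ℝ) : Measure ℝ :=
  (volume.restrict E).withDensity fun x => ENNReal.ofReal (σ x)

instance (E : Set ℝ) (σ : ℝ → ℝ) : NullSingletonClass (weightMeasure E σ) :=
  ⟨fun x => withDensity_absolutelyContinuous _ _ (measure_singleton x)⟩

instance (E : Set ℝ) (σ : ℝ → ℝ) : SFinite (weightMeasure E σ) := by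
  unfold weightMeasure; infer_instance

theorem measurable_indicator_of_continuousOn {E : Set ℝ} (hE : MeasurableSet E) {σ : ℝ → ℝ}
    (hσ : ContinuousOn σ E) : Measurable (E.indicator σ) := by
  classical
  rw [← Set.piecewise_eq_indicator]
  exact hσ.measurable_piecewise continuousOn_const hE

theorem weightMeasure_indicator {E : Set ℝ} (hE : MeasurableSet E) (σ : ℝ → ℝ) :
    weightMeasure E (E.indicator σ) = weightMeasure E σ := by
  refine withDensity_congr_ae ?_
  filter_upwards [ae_restrict_mem hE] with x hx
  rw [indicator_of_mem hx]

section Interval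

variable {E : Set ℝ} {σ : ℝ → ℝ} {y₁ y₂ : ℝ} {g : ℝ → ℝ}

/-- The derivative of `g` with respect to the measure `σ dx`, on the interval `(y₁, y₂)`. -/
noncomputable def relDeriv (E : Set ℝ) (σ g : ℝ → ℝ) (y₁ y₂ : ℝ) : ℝ → ℝ≥0∞ :=
  (Ioo y₁ y₂).indicator fun x => ENNReal.ofReal (|deriv g x| / E.indicator σ x)

theorem measurable_relDeriv (hE : MeasurableSet E) (hσ : ContinuousOn σ E) :
    Measurable (relDeriv E σ g y₁ y₂) := by
  have h1 := measurable_indicator_of_continuousOn hE hσ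
  have h2 := measurable_deriv g
  exact Measurable.indicator (by fun_prop) measurableSet_Ioo

/-- Dividing |g'| by σ cancels the density of the reference measure, so the abstract pair (m, φ)
represents |g'| dx. The indicator of σ is used because σ is controlled only on E and need not be
measurable on the whole line. -/
theorem withDensity_relDeriv (hE : MeasurableSet E) (hσ : ContinuousOn σ E)
    (hpos : ∀ x ∈ E, 0 < σ x) (hsub : Icc y₁ y₂ ⊆ E) :
    (weightMeasure E σ).withDensity (relDeriv E σ g y₁ y₂) =
      (volume.restrict (Ioo y₁ y₂)).withDensity fun x => ENNReal.ofReal |deriv g x| := by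
  have h1 := measurable_indicator_of_continuousOn hE hσ
  have hsub' : Ioo y₁ y₂ ⊆ E := Ioo_subset_Icc_self.trans hsub
  rw [← weightMeasure_indicator hE σ, weightMeasure,
    ← withDensity_mul _ (by fun_prop) (measurable_relDeriv hE hσ)]
  have : ((fun x => ENNReal.ofReal (E.indicator σ x)) * relDeriv E σ g y₁ y₂) =
      (Ioo y₁ y₂).indicator fun x => ENNReal.ofReal |deriv g x| := by
    ext x
    simp only [Pi.mul_apply, relDeriv, indicator]
    by_cases hx : x ∈ Ioo y₁ y₂
    · have hσx := hpos x (hsub' hx)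
      rw [if_pos hx, if_pos hx, if_pos (hsub' hx), ← ENNReal.ofReal_mul hσx.le,
        mul_div_cancel₀ _ hσx.ne']
    · rw [if_neg hx, if_neg hx, mul_zero]
  rw [this, withDensity_indicator measurableSet_Ioo, Measure.restrict_restrict measurableSet_Ioo,
    inter_eq_left.2 hsub']

/-- The r-energy of `relDeriv` picks up the weight σ^(1-r). With r = p and σ the density of ν̂ this
weight is e^C. -/
theorem lintegral_relDeriv_rpow (hE : MeasurableSet E) (hσ : ContinuousOn σ E)
    (hpos : ∀ x ∈ E, 0 < σ x) (hsub : Icc y₁ y₂ ⊆ E) {r : ℝ} (hr : 0 < r) :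
    ∫⁻ x, relDeriv E σ g y₁ y₂ x ^ r ∂(weightMeasure E σ) =
      ∫⁻ x in Ioo y₁ y₂, ENNReal.ofReal (|deriv g x| ^ r * σ x ^ (1 - r)) := by
  have h1 := measurable_indicator_of_continuousOn hE hσ
  have h2 := measurable_relDeriv (g := g) (y₁ := y₁) (y₂ := y₂) hE hσ
  have hsub' : Ioo y₁ y₂ ⊆ E := Ioo_subset_Icc_self.trans hsub
  rw [← weightMeasure_indicator hE σ, weightMeasure,
    lintegral_withDensity_eq_lintegral_mul _ (by fun_prop) (by fun_prop)]
  have : ((fun x => ENNReal.ofReal (E.indicator σ x)) * fun x => relDeriv E σ g y₁ y₂ x ^ r) =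
      (Ioo y₁ y₂).indicator fun x => ENNReal.ofReal (|deriv g x| ^ r * σ x ^ (1 - r)) := by
    ext x
    simp only [Pi.mul_apply, relDeriv, indicator]
    by_cases hx : x ∈ Ioo y₁ y₂
    · have hσx := hpos x (hsub' hx)
      rw [if_pos hx, if_pos hx, if_pos (hsub' hx),
        ENNReal.ofReal_rpow_of_nonneg (by positivity) hr.le, ← ENNReal.ofReal_mul hσx.le,
        Real.div_rpow (abs_nonneg _) hσx.le, Real.rpow_sub hσx, Real.rpow_one]
      congr 1
      ring
    · rw [if_neg hx, if_neg hx, ENNReal.zero_rpow_of_pos hr, mul_zero]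
  rw [this, lintegral_indicator measurableSet_Ioo, Measure.restrict_restrict measurableSet_Ioo,
    inter_eq_left.2 hsub']

theorem abs_sub_le_integral_abs_deriv {a b : ℝ} (hab : a ≤ b)
    (hg : AbsolutelyContinuousOnInterval g a b) :
    |g b - g a| ≤ ((volume.restrict (Ioo a b)).withDensity
      fun x => ENNReal.ofReal |deriv g x|).real univ := by
  have hi := hg.intervalIntegrable_deriv
  rw [← hg.integral_deriv_eq_sub, measureReal_def, withDensity_apply _ MeasurableSet.univ,
    setLIntegral_univ, restrict_Ioo_eq_restrict_Ioc]
  refine (intervalIntegral.abs_integral_le_integral_abs hab).trans_eq ?_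
  rw [intervalIntegral.integral_of_le hab, integral_eq_lintegral_of_nonneg_ae
    (ae_of_all _ fun _ => abs_nonneg _)]
  exact ((intervalIntegrable_iff_integrableOn_Ioc_of_le hab).1 hi).abs.aestronglyMeasurable

theorem lintegral_abs_deriv_ne_top {a b : ℝ} (hab : a ≤ b)
    (hg : AbsolutelyContinuousOnInterval g a b) :
    ∫⁻ x in Ioo a b, ENNReal.ofReal |deriv g x| ≠ ∞ := by
  have hi := hg.intervalIntegrable_deriv
  rw [restrict_Ioo_eq_restrict_Ioc]
  have := ((intervalIntegrable_iff_integrableOn_Ioc_of_le hab).1 hi).abs.lintegral_lt_top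
  exact this.ne

theorem isFiniteMeasure_relDeriv (hE : MeasurableSet E) (hσ : ContinuousOn σ E)
    (hpos : ∀ x ∈ E, 0 < σ x) (hsub : Icc y₁ y₂ ⊆ E) (h12 : y₁ ≤ y₂)
    (hg : AbsolutelyContinuousOnInterval g y₁ y₂) :
    IsFiniteMeasure ((weightMeasure E σ).withDensity (relDeriv E σ g y₁ y₂)) := by
  rw [withDensity_relDeriv hE hσ hpos hsub]
  exact isFiniteMeasure_withDensity (lintegral_abs_deriv_ne_top h12 hg)

theorem lintegral_relDeriv_ne_top (hE : MeasurableSet E) (hσ : ContinuousOn σ E)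
    (hpos : ∀ x ∈ E, 0 < σ x) (hsub : Icc y₁ y₂ ⊆ E) (h12 : y₁ ≤ y₂)
    (hg : AbsolutelyContinuousOnInterval g y₁ y₂) :
    ∫⁻ x, relDeriv E σ g y₁ y₂ x ∂(weightMeasure E σ) ≠ ∞ := by
  have := isFiniteMeasure_relDeriv hE hσ hpos hsub h12 hg
  have h := measure_lt_top ((weightMeasure E σ).withDensity (relDeriv E σ g y₁ y₂)) univ
  rw [withDensity_apply _ MeasurableSet.univ, setLIntegral_univ] at h
  exact h.ne

theorem abs_sub_left_le (hE : MeasurableSet E) (hσ : ContinuousOn σ E)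
    (hpos : ∀ x ∈ E, 0 < σ x) (hsub : Icc y₁ y₂ ⊆ E)
    (hg : AbsolutelyContinuousOnInterval g y₁ y₂) {x : ℝ} (hx : x ∈ Ioo y₁ y₂) :
    |g x - g y₁| ≤ ((weightMeasure E σ).withDensity (relDeriv E σ g y₁ y₂)).real (Iio x) := by
  have h12 : y₁ ≤ y₂ := (hx.1.trans hx.2).le
  have := isFiniteMeasure_relDeriv hE hσ hpos hsub h12 hg
  have hg' : AbsolutelyContinuousOnInterval g y₁ x := hg.mono (by
    rw [uIcc_of_le hx.1.le, uIcc_of_le h12]; exact Icc_subset_Icc_right hx.2.le)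
  refine (abs_sub_le_integral_abs_deriv hx.1.le hg').trans_eq ?_
  rw [withDensity_relDeriv hE hσ hpos hsub, measureReal_def, measureReal_def,
    withDensity_apply _ MeasurableSet.univ, withDensity_apply _ measurableSet_Iio,
    setLIntegral_univ, Measure.restrict_restrict measurableSet_Iio]
  congr 3
  ext z; simp only [mem_Ioo, mem_inter_iff, mem_Iio]
  constructor
  · rintro ⟨a, b⟩; exact ⟨b, a, b.trans hx.2⟩
  · rintro ⟨a, b, c⟩; exact ⟨b, a⟩

theorem abs_sub_right_le (hE : MeasurableSet E) (hσ : ContinuousOn σ E)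
    (hpos : ∀ x ∈ E, 0 < σ x) (hsub : Icc y₁ y₂ ⊆ E)
    (hg : AbsolutelyContinuousOnInterval g y₁ y₂) {x : ℝ} (hx : x ∈ Ioo y₁ y₂) :
    |g x - g y₂| ≤ ((weightMeasure E σ).withDensity (relDeriv E σ g y₁ y₂)).real (Ioi x) := by
  have h12 : y₁ ≤ y₂ := (hx.1.trans hx.2).le
  have := isFiniteMeasure_relDeriv hE hσ hpos hsub h12 hg
  have hg' : AbsolutelyContinuousOnInterval g x y₂ := hg.mono (by
    rw [uIcc_of_le hx.2.le, uIcc_of_le h12]; exact Icc_subset_Icc_left hx.1.le)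
  rw [abs_sub_comm]
  refine (abs_sub_le_integral_abs_deriv hx.2.le hg').trans_eq ?_
  rw [withDensity_relDeriv hE hσ hpos hsub, measureReal_def, measureReal_def,
    withDensity_apply _ MeasurableSet.univ, withDensity_apply _ measurableSet_Ioi,
    setLIntegral_univ, Measure.restrict_restrict measurableSet_Ioi]
  congr 3
  ext z; simp only [mem_Ioo, mem_inter_iff, mem_Ioi]
  constructor
  · rintro ⟨a, b⟩; exact ⟨a, hx.1.trans a, b⟩
  · rintro ⟨a, b, c⟩; exact ⟨a, c⟩

variable {n : Measure ℝ} {r γ s : ℝ} {B : ℝ≥0∞}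

/-- Vanishing at both ends makes |g| at most the variation of g on either side, hence at most the
minimum in `lintegral_min_rpow_le`. -/
theorem hardy_interval_DD (hE : MeasurableSet E) (hσ : ContinuousOn σ E)
    (hpos : ∀ x ∈ E, 0 < σ x) (hsub : Icc y₁ y₂ ⊆ E) (h12 : y₁ ≤ y₂)
    (hg : AbsolutelyContinuousOnInterval g y₁ y₂) (hg₁ : g y₁ = 0) (hg₂ : g y₂ = 0)
    (hr : r.HolderConjugate γ) (hrs : r ≤ s) (hB : B ≠ ∞)
    (h : ∀ x y, x ≤ y → weightMeasure E σ (Iio x) ≠ 0 → weightMeasure E σ (Ioi y) ≠ 0 →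
      n (Ioo x y) ≤ B ^ s *
        (weightMeasure E σ (Iio x) ^ (1 - r) + weightMeasure E σ (Ioi y) ^ (1 - r)) ^ (s / r)) :
    ∫⁻ x in Ioo y₁ y₂, ENNReal.ofReal (|g x| ^ s) ∂n ≤
      ((2 * B) ^ r * ∫⁻ x in Ioo y₁ y₂, ENNReal.ofReal (|deriv g x| ^ r * σ x ^ (1 - r))) ^
        (s / r) := by
  have := hr.lt
  rw [← lintegral_relDeriv_rpow hE hσ hpos hsub hr.pos]
  refine le_trans ?_ (lintegral_min_rpow_le (measurable_relDeriv hE hσ)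
    (lintegral_relDeriv_ne_top hE hσ hpos hsub h12 hg) hr hrs hB h)
  refine le_trans (setLIntegral_mono' measurableSet_Ioo fun x hx => ?_)
    (setLIntegral_le_lintegral _ _)
  refine ENNReal.ofReal_le_ofReal (Real.rpow_le_rpow (abs_nonneg _) (le_min ?_ ?_) (by linarith))
  · simpa [hg₁] using abs_sub_left_le hE hσ hpos hsub hg hx
  · simpa [hg₂] using abs_sub_right_le hE hσ hpos hsub hg hx

theorem hardy_interval_DN (hE : MeasurableSet E) (hσ : ContinuousOn σ E)
    (hpos : ∀ x ∈ E, 0 < σ x) (hsub : Icc y₁ y₂ ⊆ E) (h12 : y₁ ≤ y₂)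
    (hg : AbsolutelyContinuousOnInterval g y₁ y₂) (hg₁ : g y₁ = 0)
    (hr : r.HolderConjugate γ) (hrs : r ≤ s) (hB : B ≠ ∞)
    (h : ∀ x, weightMeasure E σ (Iio x) ≠ 0 →
      n (Ioi x) ≤ B ^ s * (weightMeasure E σ (Iio x) ^ (1 - r)) ^ (s / r)) :
    ∫⁻ x in Ioo y₁ y₂, ENNReal.ofReal (|g x| ^ s) ∂n ≤
      ((2 * B) ^ r * ∫⁻ x in Ioo y₁ y₂, ENNReal.ofReal (|deriv g x| ^ r * σ x ^ (1 - r))) ^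
        (s / r) := by
  have := hr.lt
  rw [← lintegral_relDeriv_rpow hE hσ hpos hsub hr.pos]
  refine le_trans ?_ (lintegral_Iio_rpow_le (measurable_relDeriv hE hσ)
    (lintegral_relDeriv_ne_top hE hσ hpos hsub h12 hg) hr hrs hB h)
  refine le_trans (setLIntegral_mono' measurableSet_Ioo fun x hx => ?_)
    (setLIntegral_le_lintegral _ _)
  refine ENNReal.ofReal_le_ofReal (Real.rpow_le_rpow (abs_nonneg _) ?_ (by linarith))
  simpa [hg₁] using abs_sub_left_le hE hσ hpos hsub hg hx

theorem hardy_interval_ND (hE : MeasurableSet E) (hσ : ContinuousOn σ E)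
    (hpos : ∀ x ∈ E, 0 < σ x) (hsub : Icc y₁ y₂ ⊆ E) (h12 : y₁ ≤ y₂)
    (hg : AbsolutelyContinuousOnInterval g y₁ y₂) (hg₂ : g y₂ = 0)
    (hr : r.HolderConjugate γ) (hrs : r ≤ s) (hB : B ≠ ∞)
    (h : ∀ x, weightMeasure E σ (Ioi x) ≠ 0 →
      n (Iio x) ≤ B ^ s * (weightMeasure E σ (Ioi x) ^ (1 - r)) ^ (s / r)) :
    ∫⁻ x in Ioo y₁ y₂, ENNReal.ofReal (|g x| ^ s) ∂n ≤
      ((2 * B) ^ r * ∫⁻ x in Ioo y₁ y₂, ENNReal.ofReal (|deriv g x| ^ r * σ x ^ (1 - r))) ^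
        (s / r) := by
  have := hr.lt
  rw [← lintegral_relDeriv_rpow hE hσ hpos hsub hr.pos]
  refine le_trans ?_ (lintegral_Ioi_rpow_le (measurable_relDeriv hE hσ)
    (lintegral_relDeriv_ne_top hE hσ hpos hsub h12 hg) hr hrs hB h)
  refine le_trans (setLIntegral_mono' measurableSet_Ioo fun x hx => ?_)
    (setLIntegral_le_lintegral _ _)
  refine ENNReal.ofReal_le_ofReal (Real.rpow_le_rpow (abs_nonneg _) ?_ (by linarith))
  simpa [hg₂] using abs_sub_right_le hE hσ hpos hsub hg hx

end Interval

/-! ### The interval `E` and locally absolutely continuous functions -/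

namespace Diffusion

variable (D : Diffusion)

theorem theta_mem : D.θ ∈ D.E := ⟨D.left_lt, D.lt_right⟩

theorem isOpen_E : IsOpen D.E :=
  (isOpen_lt continuous_const continuous_coe_real_ereal).inter
    (isOpen_lt continuous_coe_real_ereal continuous_const)

theorem measurableSet_E : MeasurableSet D.E := D.isOpen_E.measurableSet

theorem Icc_subset_E {x y : ℝ} (hx : x ∈ D.E) (hy : y ∈ D.E) : Icc x y ⊆ D.E := fun _ hz =>
  ⟨hx.1.trans_le (EReal.coe_le_coe_iff.2 hz.1), (EReal.coe_le_coe_iff.2 hz.2).trans_lt hy.2⟩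

instance ordConnected_E : OrdConnected D.E := ⟨fun _ hx _ hy => D.Icc_subset_E hx hy⟩

theorem uIcc_subset_E {x y : ℝ} (hx : x ∈ D.E) (hy : y ∈ D.E) : uIcc x y ⊆ D.E :=
  D.ordConnected_E.uIcc_subset hx hy

theorem eventually_leftEnd {P : ℝ → Prop} :
    (∀ᶠ x in D.leftEnd, P x) ↔ ∃ u ∈ D.E, ∀ x ∈ D.E, x < u → P x := by
  rw [leftEnd, eventually_comap]
  constructor
  · intro h
    obtain ⟨u, hu, hu'⟩ := (mem_nhdsGT_iff_exists_Ioo_subset' D.left_lt).1 h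
    obtain ⟨v, hv1, hv2⟩ := EReal.lt_iff_exists_real_btwn.1 (lt_min hu D.left_lt)
    have hvE : v ∈ D.E := ⟨hv1, (hv2.trans_le (min_le_right _ _)).trans D.lt_right⟩
    refine ⟨v, hvE, fun x hx hxv => ?_⟩
    exact hu' ⟨hx.1, (EReal.coe_lt_coe_iff.2 hxv).trans (hv2.trans_le (min_le_left _ _))⟩ x rfl
  · rintro ⟨u, hu, h⟩
    refine (mem_nhdsGT_iff_exists_Ioo_subset' D.left_lt).2 ⟨u, hu.1, ?_⟩
    rintro _ ⟨h1, h2⟩ x rfl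
    exact h x ⟨h1, h2.trans hu.2⟩ (EReal.coe_lt_coe_iff.1 h2)

theorem eventually_rightEnd {P : ℝ → Prop} :
    (∀ᶠ x in D.rightEnd, P x) ↔ ∃ u ∈ D.E, ∀ x ∈ D.E, u < x → P x := by
  rw [rightEnd, eventually_comap]
  constructor
  · intro h
    obtain ⟨u, hu, hu'⟩ := (mem_nhdsLT_iff_exists_Ioo_subset' D.lt_right).1 h
    obtain ⟨v, hv1, hv2⟩ := EReal.lt_iff_exists_real_btwn.1 (max_lt hu D.lt_right)
    have hvE : v ∈ D.E := ⟨D.left_lt.trans ((le_max_right _ _).trans_lt hv1), hv2⟩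
    refine ⟨v, hvE, fun x hx hxv => ?_⟩
    exact hu' ⟨((le_max_left _ _).trans_lt hv1).trans (EReal.coe_lt_coe_iff.2 hxv), hx.2⟩ x rfl
  · rintro ⟨u, hu, h⟩
    refine (mem_nhdsLT_iff_exists_Ioo_subset' D.lt_right).2 ⟨u, hu.2, ?_⟩
    rintro _ ⟨h1, h2⟩ x rfl
    exact h x ⟨hu.1.trans h1, h2⟩ (EReal.coe_lt_coe_iff.1 h1)

/-- A sequence decreasing to the left endpoint. -/
theorem exists_seq_left : ∃ u : ℕ → ℝ, Antitone u ∧ (∀ n, u n ∈ D.E) ∧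
    ∀ x ∈ D.E, ∃ n, u n < x := by
  obtain ⟨u, hu, humem, hlim⟩ := exists_seq_strictAnti_tendsto' D.left_lt
  have hreal : ∀ n, ((u n).toReal : EReal) = u n := fun n => EReal.coe_toReal
    ((humem n).2.trans (EReal.coe_lt_top _)).ne (bot_le.trans_lt (humem n).1).ne'
  refine ⟨fun n => (u n).toReal, fun i j hij => ?_, fun n => ?_, fun x hx => ?_⟩
  · rw [← EReal.coe_le_coe_iff, hreal, hreal]
    exact hu.antitone hij
  · constructor
    · rw [hreal]; exact (humem n).1
    · rw [hreal]; exact (humem n).2.trans D.lt_right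
  · obtain ⟨n, hn⟩ := (hlim.eventually (eventually_lt_nhds hx.1)).exists
    exact ⟨n, by rwa [← EReal.coe_lt_coe_iff, hreal]⟩

/-- A sequence increasing to the right endpoint. -/
theorem exists_seq_right : ∃ u : ℕ → ℝ, Monotone u ∧ (∀ n, u n ∈ D.E) ∧
    ∀ x ∈ D.E, ∃ n, x < u n := by
  obtain ⟨u, hu, humem, hlim⟩ := exists_seq_strictMono_tendsto' D.lt_right
  have hreal : ∀ n, ((u n).toReal : EReal) = u n := fun n => EReal.coe_toReal
    ((humem n).2.trans_le le_top).ne ((EReal.bot_lt_coe _).trans (humem n).1).ne'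
  refine ⟨fun n => (u n).toReal, fun i j hij => ?_, fun n => ?_, fun x hx => ?_⟩
  · rw [← EReal.coe_le_coe_iff, hreal, hreal]
    exact hu.monotone hij
  · constructor
    · rw [hreal]; exact D.left_lt.trans (humem n).1
    · rw [hreal]; exact (humem n).2
  · obtain ⟨n, hn⟩ := (hlim.eventually (eventually_gt_nhds hx.2)).exists
    exact ⟨n, by rwa [← EReal.coe_lt_coe_iff, hreal]⟩

theorem exists_mem_lt {x : ℝ} (hx : x ∈ D.E) : ∃ y ∈ D.E, y < x := by
  obtain ⟨u, -, h, h'⟩ := D.exists_seq_left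
  obtain ⟨n, hn⟩ := h' x hx
  exact ⟨u n, h n, hn⟩

theorem exists_mem_gt {x : ℝ} (hx : x ∈ D.E) : ∃ y ∈ D.E, x < y := by
  obtain ⟨u, -, h, h'⟩ := D.exists_seq_right
  obtain ⟨n, hn⟩ := h' x hx
  exact ⟨u n, h n, hn⟩

theorem tendsto_measure_leftOf (s : Measure ℝ) {u : ℕ → ℝ} (hu : Antitone u)
    (huE : ∀ n, u n ∈ D.E) (hu' : ∀ x ∈ D.E, ∃ n, u n < x) {x : ℝ} (hx : x ∈ D.E) :
    Tendsto (fun n => s (Ioo (u n) x)) atTop (𝓝 (s (D.leftOf x))) := by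
  have : D.leftOf x = ⋃ n, Ioo (u n) x := by
    ext z
    simp only [leftOf, mem_inter_iff, mem_Iio, mem_iUnion, mem_Ioo]
    constructor
    · rintro ⟨h1, h2⟩
      obtain ⟨n, hn⟩ := hu' z h1
      exact ⟨n, hn, h2⟩
    · rintro ⟨n, h1, h2⟩
      exact ⟨D.Icc_subset_E (huE n) hx ⟨h1.le, h2.le⟩, h2⟩
  rw [this]
  exact tendsto_measure_iUnion_atTop fun i j hij => Ioo_subset_Ioo_left (hu hij)

theorem tendsto_measure_rightOf (s : Measure ℝ) {u : ℕ → ℝ} (hu : Monotone u)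
    (huE : ∀ n, u n ∈ D.E) (hu' : ∀ x ∈ D.E, ∃ n, x < u n) {x : ℝ} (hx : x ∈ D.E) :
    Tendsto (fun n => s (Ioo x (u n))) atTop (𝓝 (s (D.rightOf x))) := by
  have : D.rightOf x = ⋃ n, Ioo x (u n) := by
    ext z
    simp only [rightOf, mem_inter_iff, mem_Ioi, mem_iUnion, mem_Ioo]
    constructor
    · rintro ⟨h1, h2⟩
      obtain ⟨n, hn⟩ := hu' z h1
      exact ⟨n, h2, hn⟩
    · rintro ⟨n, h1, h2⟩
      exact ⟨D.Icc_subset_E hx (huE n) ⟨h1.le, h2.le⟩, h1⟩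
  rw [this]
  exact tendsto_measure_iUnion_atTop fun i j hij => Ioo_subset_Ioo_right (hu hij)

/-- Limit z → -M. Powers are continuous on [0,∞] even for negative exponents, so bounds obtained
from ramps with foot z inside E extend to the whole mass left of x, whether finite or not. -/
theorem le_mul_leftOf_rpow {s : Measure ℝ} {X K Y : ℝ≥0∞} (hK : K ≠ ∞) {e x : ℝ} (hx : x ∈ D.E)
    (h : ∀ z ∈ D.E, z < x → X ≤ K * (s (Ioo z x) ^ e + Y)) :
    X ≤ K * (s (D.leftOf x) ^ e + Y) := by
  obtain ⟨u, hu, huE, hu'⟩ := D.exists_seq_left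
  obtain ⟨N, hN⟩ := hu' x hx
  have h1 := ((ENNReal.continuous_rpow_const (y := e)).tendsto _).comp
    (D.tendsto_measure_leftOf s hu huE hu' hx)
  have h2 := ENNReal.Tendsto.const_mul (h1.add_const Y) (Or.inr hK)
  refine ge_of_tendsto h2 ?_
  filter_upwards [eventually_ge_atTop N] with n hn
  exact h _ (huE n) ((hu hn).trans_lt hN)

theorem le_mul_rightOf_rpow {s : Measure ℝ} {X K Y : ℝ≥0∞} (hK : K ≠ ∞) {e x : ℝ} (hx : x ∈ D.E)
    (h : ∀ z ∈ D.E, x < z → X ≤ K * (Y + s (Ioo x z) ^ e)) :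
    X ≤ K * (Y + s (D.rightOf x) ^ e) := by
  obtain ⟨u, hu, huE, hu'⟩ := D.exists_seq_right
  obtain ⟨N, hN⟩ := hu' x hx
  have h1 := ((ENNReal.continuous_rpow_const (y := e)).tendsto _).comp
    (D.tendsto_measure_rightOf s hu huE hu' hx)
  have h2 := ENNReal.Tendsto.const_mul (h1.const_add Y) (Or.inr hK)
  refine ge_of_tendsto h2 ?_
  filter_upwards [eventually_ge_atTop N] with n hn
  exact h _ (huE n) (hN.trans_le (hu hn))

/-! ### Measures on `E` -/

theorem weightMeasure_compl (σ : ℝ → ℝ) : weightMeasure D.E σ D.Eᶜ = 0 :=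
  withDensity_absolutelyContinuous _ _ (by
    rw [Measure.restrict_apply D.measurableSet_E.compl]; simp)

theorem measure_leftOf {m : Measure ℝ} (hm : m D.Eᶜ = 0) (x : ℝ) : m (D.leftOf x) = m (Iio x) := by
  rw [leftOf, inter_comm, measure_inter_conull hm]

theorem measure_rightOf {m : Measure ℝ} (hm : m D.Eᶜ = 0) (x : ℝ) :
    m (D.rightOf x) = m (Ioi x) := by
  rw [rightOf, inter_comm, measure_inter_conull hm]

theorem exists_mem_lt_of_measure_ne_zero {m : Measure ℝ} (hm : m D.Eᶜ = 0) {x : ℝ}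
    (h : m (Iio x) ≠ 0) : ∃ z ∈ D.E, z < x := by
  rw [← D.measure_leftOf hm] at h
  exact nonempty_of_measure_ne_zero h

theorem exists_mem_gt_of_measure_ne_zero {m : Measure ℝ} (hm : m D.Eᶜ = 0) {x : ℝ}
    (h : m (Ioi x) ≠ 0) : ∃ z ∈ D.E, x < z := by
  rw [← D.measure_rightOf hm] at h
  exact nonempty_of_measure_ne_zero h

theorem weightMeasure_ne_zero {σ : ℝ → ℝ} (hσ : ContinuousOn σ D.E)
    (hpos : ∀ x ∈ D.E, 0 < σ x) {A : Set ℝ} (hA : MeasurableSet A) (hAE : A ⊆ D.E)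
    (h : volume A ≠ 0) : weightMeasure D.E σ A ≠ 0 := by
  have h1 := measurable_indicator_of_continuousOn D.measurableSet_E hσ
  rw [← weightMeasure_indicator D.measurableSet_E, weightMeasure, ne_eq,
    withDensity_apply_eq_zero (by fun_prop), Measure.restrict_apply]
  · have : {x | ENNReal.ofReal (D.E.indicator σ x) ≠ 0} ∩ A ∩ D.E = A := by
      ext x
      simp only [mem_inter_iff, mem_ofPred_eq, ne_eq, ENNReal.ofReal_eq_zero, not_le]
      constructor
      · rintro ⟨⟨-, h⟩, -⟩; exact h
      · intro h
        exact ⟨⟨by rw [indicator_of_mem (hAE h)]; exact hpos x (hAE h), h⟩, hAE h⟩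
    rwa [this]
  · refine MeasurableSet.inter ?_ hA
    exact (measurableSet_singleton 0).compl.preimage (by fun_prop)

theorem weightMeasure_Ioo_ne_zero {σ : ℝ → ℝ} (hσ : ContinuousOn σ D.E)
    (hpos : ∀ x ∈ D.E, 0 < σ x) {x y : ℝ} (hx : x ∈ D.E) (hy : y ∈ D.E) (h : x < y) :
    weightMeasure D.E σ (Ioo x y) ≠ 0 :=
  D.weightMeasure_ne_zero hσ hpos measurableSet_Ioo
    (Ioo_subset_Icc_self.trans (D.Icc_subset_E hx hy)) (by simp [h])

/-! ### The function `C` -/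

theorem intervalIntegrable_b_div_a {x y : ℝ} (hx : x ∈ D.E) (hy : y ∈ D.E) :
    IntervalIntegrable (fun t => D.b t / D.a t) volume x y := by
  rw [intervalIntegrable_iff]
  exact (D.locInt_b_div_a.integrableOn_compact_subset (D.uIcc_subset_E hx hy)
    isCompact_uIcc).mono_set uIoc_subset_uIcc

theorem intervalIntegrable_inv_a {x y : ℝ} (hx : x ∈ D.E) (hy : y ∈ D.E) :
    IntervalIntegrable (fun t => 1 / D.a t) volume x y := by
  rw [intervalIntegrable_iff]
  exact (D.locInt_inv_a.integrableOn_compact_subset (D.uIcc_subset_E hx hy)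
    isCompact_uIcc).mono_set uIoc_subset_uIcc

theorem locAC_C : LocAC D.C D.E := by
  intro x hx y hy
  have h1 : AbsolutelyContinuousOnInterval (fun z => ∫ t in x..z, D.b t / D.a t) x y :=
    (D.intervalIntegrable_b_div_a hx hy).absolutelyContinuousOnInterval_intervalIntegral (by simp)
  have h2 : AbsolutelyContinuousOnInterval (fun _ : ℝ => ∫ t in D.θ..x, D.b t / D.a t) x y :=
    ((LipschitzWith.const _).lipschitzOnWith).absolutelyContinuousOnInterval
  refine (absolutelyContinuousOnInterval_iff _ _ _).2 fun ε hε => ?_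
  obtain ⟨δ, hδ, h⟩ := (absolutelyContinuousOnInterval_iff _ _ _).1 (h2.add h1) ε hε
  refine ⟨δ, hδ, fun I hI hI' => ?_⟩
  refine lt_of_eq_of_lt (Finset.sum_congr rfl fun i hi => ?_) (h I hI hI')
  -- Moving the base point of the integral from θ to x changes C by a constant. The identity is
  -- available only on the interval, so the increments are compared inside the ε-δ criterion.
  have key : ∀ z ∈ uIcc x y, D.C z = (fun _ : ℝ => ∫ t in D.θ..x, D.b t / D.a t) z +
      (fun z => ∫ t in x..z, D.b t / D.a t) z := fun z hz =>
    (intervalIntegral.integral_add_adjacent_intervals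
      (D.intervalIntegrable_b_div_a D.theta_mem hx)
      (D.intervalIntegrable_b_div_a hx (D.uIcc_subset_E hx hy hz))).symm
  rw [key _ (hI.1 i hi).1, key _ (hI.1 i hi).2]
  rfl

end Diffusion

variable {D : Diffusion}

theorem ae_of_ae_Icc {P : ℝ → Prop}
    (h : ∀ x ∈ D.E, ∀ y ∈ D.E, ∀ᵐ z, z ∈ uIcc x y → P z) : ∀ᵐ z, z ∈ D.E → P z := by
  obtain ⟨u, -, huE, hu⟩ := D.exists_seq_left
  obtain ⟨v, -, hvE, hv⟩ := D.exists_seq_right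
  have : ∀ᵐ z, ∀ i j, z ∈ uIcc (u i) (v j) → P z :=
    ae_all_iff.2 fun i => ae_all_iff.2 fun j => h _ (huE i) _ (hvE j)
  filter_upwards [this] with z hz hzE
  obtain ⟨i, hi⟩ := hu z hzE
  obtain ⟨j, hj⟩ := hv z hzE
  exact hz i j (Icc_subset_uIcc ⟨hi.le, hj.le⟩)

theorem Diffusion.ae_hasDerivAt_C : ∀ᵐ x, x ∈ D.E → HasDerivAt D.C (D.b x / D.a x) x := by
  obtain ⟨u, -, huE, hu⟩ := D.exists_seq_left
  obtain ⟨v, -, hvE, hv⟩ := D.exists_seq_right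
  have : ∀ᵐ z, ∀ i j, z ∈ uIcc (u i) (v j) → ∀ c ∈ uIcc (u i) (v j),
      HasDerivAt (fun x => ∫ t in c..x, D.b t / D.a t) (D.b z / D.a z) z :=
    ae_all_iff.2 fun i => ae_all_iff.2 fun j =>
      (D.intervalIntegrable_b_div_a (huE i) (hvE j)).ae_hasDerivAt_integral
  filter_upwards [this] with z hz hzE
  obtain ⟨i, hi⟩ := hu z hzE
  obtain ⟨j, hj⟩ := hv z hzE
  obtain ⟨i', hi'⟩ := hu D.θ D.theta_mem
  obtain ⟨j', hj'⟩ := hv D.θ D.theta_mem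
  rcases le_total (u i) (u i') with h | h <;> rcases le_total (v j) (v j') with h' | h'
  · exact hz i j' (Icc_subset_uIcc ⟨hi.le, hj.le.trans h'⟩) D.θ
      (Icc_subset_uIcc ⟨h.trans hi'.le, hj'.le⟩)
  · exact hz i j (Icc_subset_uIcc ⟨hi.le, hj.le⟩) D.θ
      (Icc_subset_uIcc ⟨h.trans hi'.le, hj'.le.trans h'⟩)
  · exact hz i' j' (Icc_subset_uIcc ⟨h.trans hi.le, hj.le.trans h'⟩) D.θ
      (Icc_subset_uIcc ⟨hi'.le, hj'.le⟩)
  · exact hz i' j (Icc_subset_uIcc ⟨h.trans hi.le, hj.le⟩) D.θ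
      (Icc_subset_uIcc ⟨hi'.le, hj'.le.trans h'⟩)

theorem LocAC.continuousOn {f : ℝ → ℝ} (hf : LocAC f D.E) : ContinuousOn f D.E := by
  intro x hx
  obtain ⟨y, hy, hyx⟩ := D.exists_mem_lt hx
  obtain ⟨z, hz, hxz⟩ := D.exists_mem_gt hx
  have := (hf y hy z hz).continuousOn.continuousAt (x := x) (by
    rw [uIcc_of_le (hyx.trans hxz).le]; exact Icc_mem_nhds hyx hxz)
  exact this.continuousWithinAt

theorem LocAC.ae_differentiableAt {f : ℝ → ℝ} (hf : LocAC f D.E) :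
    ∀ᵐ x, x ∈ D.E → DifferentiableAt ℝ f x :=
  ae_of_ae_Icc fun x hx y hy => (hf x hx y hy).ae_differentiableAt

theorem Diffusion.continuousOn_C : ContinuousOn D.C D.E := D.locAC_C.continuousOn

theorem absolutelyContinuousOnInterval_comp {f ψ : ℝ → ℝ} {x y : ℝ} {K : ℝ≥0}
    (hf : AbsolutelyContinuousOnInterval f x y) (hψ : LipschitzOnWith K ψ (f '' uIcc x y)) :
    AbsolutelyContinuousOnInterval (fun z => ψ (f z)) x y := by
  refine (absolutelyContinuousOnInterval_iff _ _ _).2 fun ε hε => ?_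
  obtain ⟨δ, hδ, h⟩ := (absolutelyContinuousOnInterval_iff _ _ _).1 hf (ε / (K + 1))
    (by positivity)
  refine ⟨δ, hδ, fun I hI hI' => ?_⟩
  have h1 := h I hI hI'
  calc ∑ i ∈ Finset.range I.1, dist (ψ (f (I.2 i).1)) (ψ (f (I.2 i).2))
      ≤ ∑ i ∈ Finset.range I.1, K * dist (f (I.2 i).1) (f (I.2 i).2) :=
        Finset.sum_le_sum fun i hi => hψ.dist_le_mul _ (mem_image_of_mem _ (hI.1 i hi).1) _
          (mem_image_of_mem _ (hI.1 i hi).2)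
    _ = K * ∑ i ∈ Finset.range I.1, dist (f (I.2 i).1) (f (I.2 i).2) := by
        rw [Finset.mul_sum]
    _ ≤ K * (ε / (K + 1)) := by gcongr
    _ < ε := by
        rw [mul_div_assoc', div_lt_iff₀ (by positivity)]
        nlinarith

theorem LocAC.comp_contDiff {f ψ : ℝ → ℝ} (hf : LocAC f D.E) (hψ : ContDiff ℝ 1 ψ) :
    LocAC (fun z => ψ (f z)) D.E := by
  intro x hx y hy
  have hc : IsCompact (f '' uIcc x y) := isCompact_uIcc.image_of_continuousOn
    (hf x hx y hy).continuousOn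
  obtain ⟨R, hR⟩ := hc.isBounded.subset_closedBall 0
  obtain ⟨K, hK⟩ := (hψ.contDiffOn (s := Metric.closedBall 0 R)).exists_lipschitzOnWith
    (by decide) (convex_closedBall 0 R) (isCompact_closedBall 0 R)
  exact absolutelyContinuousOnInterval_comp (hf x hx y hy) (hK.mono hR)

/-! ### Truncation -/

theorem abs_clip_sub_le (ε y z : ℝ) : |max (|y| - ε) 0 - max (|z| - ε) 0| ≤ |y - z| := by
  have h1 := abs_max_sub_max_le_abs (|y| - ε) (|z| - ε) 0
  have h2 := abs_abs_sub_abs_le y z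
  have h3 : |y| - ε - (|z| - ε) = |y| - |z| := by ring
  rw [h3] at h1
  exact h1.trans h2

/-- The clipped function (|f| - ε)⁺ vanishes exactly wherever |f| ≤ ε. A limit 0 at a Dirichlet end
thus becomes a true zero at an interior point, while the derivative does not grow in modulus. -/
theorem LocAC.clip {f : ℝ → ℝ} (hf : LocAC f D.E) (ε : ℝ) :
    LocAC (fun x => max (|f x| - ε) 0) D.E := by
  intro x hx y hy
  refine absolutelyContinuousOnInterval_comp (K := 1) (ψ := fun z => max (|z| - ε) 0)
    (hf x hx y hy) ?_
  refine LipschitzOnWith.of_dist_le_mul fun y _ z _ => ?_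
  simpa [Real.dist_eq] using abs_clip_sub_le ε y z

theorem abs_deriv_clip_le {f : ℝ → ℝ} {x : ℝ} (hf : DifferentiableAt ℝ f x) (ε : ℝ) :
    |deriv (fun x => max (|f x| - ε) 0) x| ≤ |deriv f x| := by
  by_cases h : DifferentiableAt ℝ (fun x => max (|f x| - ε) 0) x
  · have h1 := h.hasDerivAt.tendsto_slope.abs
    have h2 := hf.hasDerivAt.tendsto_slope.abs
    refine le_of_tendsto_of_tendsto' h1 h2 fun y => ?_
    rw [slope_def_field, slope_def_field, abs_div, abs_div]
    exact div_le_div_of_nonneg_right (abs_clip_sub_le _ _ _) (abs_nonneg _)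
  · rw [deriv_zero_of_not_differentiableAt h]
    simp

/-- Fatou's lemma along ε = 1/(k+1) and intervals exhausting E. It suffices to bound the integral
over some larger interval, so the ends can be chosen where the boundary conditions are convenient.
-/
theorem lintegral_le_of_clip {n : Measure ℝ} (hn : n D.Eᶜ = 0) {f : ℝ → ℝ}
    (hf : ContinuousOn f D.E) {q : ℝ} (hq : 0 < q) {K : ℝ≥0∞}
    (h : ∀ ε > 0, ∀ z₁ ∈ D.E, ∀ z₂ ∈ D.E, ∃ y₁ y₂, y₁ ≤ z₁ ∧ z₂ ≤ y₂ ∧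
      ∫⁻ x in Ioo y₁ y₂, ENNReal.ofReal (|max (|f x| - ε) 0| ^ q) ∂n ≤ K) :
    ∫⁻ x, ENNReal.ofReal (|f x| ^ q) ∂n ≤ K := by
  obtain ⟨u, hu, huE, hu'⟩ := D.exists_seq_left
  obtain ⟨v, hv, hvE, hv'⟩ := D.exists_seq_right
  set f₀ := D.E.indicator f with hf₀
  have hf₀m : Measurable f₀ := measurable_indicator_of_continuousOn D.measurableSet_E hf
  have hae : ∀ᵐ x ∂n, x ∈ D.E := mem_ae_iff.2 hn
  set F : ℕ → ℝ → ℝ≥0∞ := fun k => (Ioo (u k) (v k)).indicator fun x =>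
    ENNReal.ofReal (|max (|f₀ x| - 1 / ((k : ℝ) + 1)) 0| ^ q) with hF
  have hFm : ∀ k, Measurable (F k) := fun k =>
    Measurable.indicator (by fun_prop) measurableSet_Ioo
  have hFK : ∀ k, ∫⁻ x, F k x ∂n ≤ K := by
    intro k
    obtain ⟨y₁, y₂, h1, h2, h3⟩ := h (1 / ((k : ℝ) + 1)) (by positivity) _ (huE k) _ (hvE k)
    refine le_trans ?_ h3
    rw [lintegral_indicator measurableSet_Ioo]
    refine le_trans (le_of_eq ?_) (lintegral_mono_set (Ioo_subset_Ioo h1 h2))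
    refine setLIntegral_congr_fun measurableSet_Ioo fun x hx => ?_
    have hxE : x ∈ D.E := D.Icc_subset_E (huE k) (hvE k) (Ioo_subset_Icc_self hx)
    simp only [hf₀, indicator_of_mem hxE]
  have hlim : ∀ᵐ x ∂n, ENNReal.ofReal (|f x| ^ q) ≤ liminf (fun k => F k x) atTop := by
    filter_upwards [hae] with x hx
    obtain ⟨i, hi⟩ := hu' x hx
    obtain ⟨j, hj⟩ := hv' x hx
    have h1 : Tendsto (fun k : ℕ => ENNReal.ofReal (|max (|f₀ x| - 1 / ((k : ℝ) + 1)) 0| ^ q))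
        atTop (𝓝 (ENNReal.ofReal (|f x| ^ q))) := by
      have h2 : Tendsto (fun k : ℕ => |max (|f₀ x| - 1 / ((k : ℝ) + 1)) 0|) atTop
          (𝓝 |max (|f₀ x| - 0) 0|) :=
        ((tendsto_const_nhds.sub tendsto_one_div_add_atTop_nhds_zero_nat).max
          tendsto_const_nhds).abs
      have h3 : |max (|f₀ x| - 0) 0| = |f x| := by
        rw [sub_zero, max_eq_left (abs_nonneg _), abs_abs, hf₀, indicator_of_mem hx]
      rw [h3] at h2
      exact ENNReal.tendsto_ofReal (h2.rpow_const (Or.inr hq.le))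
    refine le_of_eq (Tendsto.liminf_eq (h1.congr' ?_)).symm
    filter_upwards [eventually_ge_atTop (max i j)] with k hk
    have hxk : x ∈ Ioo (u k) (v k) :=
      ⟨(hu ((le_max_left _ _).trans hk)).trans_lt hi, hj.trans_le (hv ((le_max_right _ _).trans hk))⟩
    simp only [hF, indicator_of_mem hxk]
  calc ∫⁻ x, ENNReal.ofReal (|f x| ^ q) ∂n ≤ ∫⁻ x, liminf (fun k => F k x) atTop ∂n :=
        lintegral_mono_ae hlim
    _ ≤ liminf (fun k => ∫⁻ x, F k x ∂n) atTop := lintegral_liminf_le hFm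
    _ ≤ K := by
        refine (liminf_le_liminf (Eventually.of_forall hFK)).trans ?_
        simp

/-! ### Upper bounds for the Hardy-type inequalities with a Dirichlet end -/

theorem lintegral_weightMeasure {E : Set ℝ} {σ : ℝ → ℝ}
    (hσ : AEMeasurable σ (volume.restrict E)) (g : ℝ → ℝ≥0∞) :
    ∫⁻ x, g x ∂(weightMeasure E σ) = ∫⁻ x in E, ENNReal.ofReal (σ x) * g x :=
  lintegral_withDensity_eq_lintegral_mul_non_measurable₀ _ hσ.ennreal_ofReal
    (ae_of_all _ fun _ => ENNReal.ofReal_lt_top) _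

theorem eLpNorm_weightMeasure {E : Set ℝ} {σ : ℝ → ℝ}
    (hσ : AEMeasurable σ (volume.restrict E)) (f : ℝ → ℝ) {p : ℝ} (hp : 0 < p) :
    eLpNorm f (ENNReal.ofReal p) (weightMeasure E σ) =
      (∫⁻ x in E, ENNReal.ofReal (|f x| ^ p * σ x)) ^ (1 / p) := by
  rw [eLpNorm_eq_lintegral_rpow_enorm_toReal (by simpa using hp) ENNReal.ofReal_ne_top,
    ENNReal.toReal_ofReal hp.le, lintegral_weightMeasure hσ]
  congr 1
  refine lintegral_congr fun x => ?_
  rw [Real.enorm_eq_ofReal_abs, ENNReal.ofReal_rpow_of_nonneg (abs_nonneg _) hp.le, mul_comm,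
    ENNReal.ofReal_mul (by positivity)]

theorem setLIntegral_le_normB {𝒢 : Set (ℝ → ℝ≥0)} {μ : Measure ℝ} {g : ℝ → ℝ≥0} (hg : g ∈ 𝒢)
    (f : ℝ → ℝ) : ∫⁻ x, ‖f x‖ₑ * (g x : ℝ≥0∞) ∂μ ≤ normB 𝒢 μ f :=
  le_iSup₂_of_le g hg le_rfl

theorem lintegral_withDensity_coe {μ : Measure ℝ} {g : ℝ → ℝ≥0} (hg : Measurable g)
    (f : ℝ → ℝ≥0∞) :
    ∫⁻ x, f x ∂(μ.withDensity fun x => (g x : ℝ≥0∞)) = ∫⁻ x, f x * (g x : ℝ≥0∞) ∂μ := by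
  rw [lintegral_withDensity_eq_lintegral_mul_non_measurable _ (by fun_prop)
    (ae_of_all _ fun _ => ENNReal.coe_lt_top)]
  simp only [Pi.mul_apply, mul_comm]

theorem withDensity_le_normB {𝒢 : Set (ℝ → ℝ≥0)} {μ : Measure ℝ} {g : ℝ → ℝ≥0} (hg : g ∈ 𝒢)
    {S : Set ℝ} (hS : MeasurableSet S) :
    (μ.withDensity fun x => (g x : ℝ≥0∞)) S ≤ normB 𝒢 μ (S.indicator fun _ => 1) := by
  refine le_trans (le_of_eq ?_) (setLIntegral_le_normB hg _)
  rw [withDensity_apply _ hS, ← lintegral_indicator hS]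
  refine lintegral_congr fun x => ?_
  simp only [indicator]
  split_ifs <;> simp

theorem le_of_mul_rpow_le {p q : ℝ} (hp : 1 < p) (hq : 0 < q) {a N B : ℝ≥0∞} (ha : a ≠ 0)
    (hB : B ≠ ∞) (h : a ^ ((p - 1) / p) * N ^ (1 / q) ≤ B) :
    N ≤ B ^ q * (a ^ (1 - p)) ^ (q / p) := by
  rcases eq_or_ne a ∞ with rfl | ha'
  · rw [ENNReal.top_rpow_of_pos (div_pos (by linarith) (by linarith))] at h
    rcases eq_or_ne N 0 with rfl | hN
    · exact zero_le
    · rw [ENNReal.top_mul (by simp [ENNReal.rpow_eq_zero_iff, hN, hq.le])] at h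
      exact absurd (top_le_iff.1 h) hB
  · have h1 : a ^ ((p - 1) / p) ≠ 0 := by simp [ENNReal.rpow_eq_zero_iff, ha, ha']
    have h2 : a ^ ((p - 1) / p) ≠ ∞ := by simp [ENNReal.rpow_eq_top_iff, ha, ha']
    have h3 : N ^ (1 / q) ≤ B * a ^ (-((p - 1) / p)) := by
      rw [ENNReal.rpow_neg, ← div_eq_mul_inv, ENNReal.le_div_iff_mul_le (Or.inl h1) (Or.inl h2),
        mul_comm]
      exact h
    have h4 := ENNReal.rpow_le_rpow h3 hq.le
    rw [← ENNReal.rpow_mul, one_div_mul_cancel hq.ne', ENNReal.rpow_one,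
      ENNReal.mul_rpow_of_nonneg _ _ hq.le, ← ENNReal.rpow_mul] at h4
    refine h4.trans (le_of_eq ?_)
    rw [← ENNReal.rpow_mul]
    congr 2
    ring

theorem le_of_rpow_div_le {p q : ℝ} (hq : 0 < q) (hp : 0 < p) {S N B : ℝ≥0∞} (hS : S ≠ ∞)
    (hB : B ≠ ∞) (h : N ^ (1 / q) / S ^ (1 / p) ≤ B) : N ≤ B ^ q * S ^ (q / p) := by
  have h1 : N ^ (1 / q) ≤ B * S ^ (1 / p) := by
    rwa [ENNReal.div_le_iff_le_mul (Or.inr hB)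
      (Or.inl (ENNReal.rpow_ne_top_of_nonneg (by positivity) hS))] at h
  have h4 := ENNReal.rpow_le_rpow h1 hq.le
  rw [← ENNReal.rpow_mul, one_div_mul_cancel hq.ne', ENNReal.rpow_one,
    ENNReal.mul_rpow_of_nonneg _ _ hq.le, ← ENNReal.rpow_mul] at h4
  refine h4.trans (le_of_eq ?_)
  congr 2
  ring

namespace Diffusion

variable (D : Diffusion)

/-- The density of `ν̂_p`. -/
noncomputable def scaleDensity (p x : ℝ) : ℝ := Real.exp (-D.C x / (p - 1))

theorem continuousOn_scaleDensity (p : ℝ) : ContinuousOn (D.scaleDensity p) D.E :=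
  Real.continuous_exp.comp_continuousOn (D.continuousOn_C.neg.div_const _)

theorem scaleDensity_pos (p x : ℝ) : 0 < D.scaleDensity p x := Real.exp_pos _

/-- This identity dictates the exponent -C/(p-1) in ν̂: the energy weight σ^(1-p) must be the
density of ν. -/
theorem scaleDensity_rpow {p : ℝ} (hp : 1 < p) (x : ℝ) :
    D.scaleDensity p x ^ (1 - p) = Real.exp (D.C x) := by
  rw [scaleDensity, ← Real.exp_mul]
  congr 1
  have : p - 1 ≠ 0 := by linarith
  field_simp
  ring

theorem nuHat_eq (p : ℝ) : D.nuHat p = weightMeasure D.E (D.scaleDensity p) := rfl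

theorem nu_eq : D.nu = weightMeasure D.E (fun x => Real.exp (D.C x)) := rfl

theorem mu_eq : D.mu = weightMeasure D.E (fun x => Real.exp (D.C x) / D.a x) := rfl

theorem continuousOn_exp_C : ContinuousOn (fun x => Real.exp (D.C x)) D.E :=
  Real.continuous_exp.comp_continuousOn D.continuousOn_C

theorem aemeasurable_exp_C : AEMeasurable (fun x => Real.exp (D.C x)) (volume.restrict D.E) :=
  D.continuousOn_exp_C.aemeasurable D.measurableSet_E

theorem aemeasurable_exp_C_div : AEMeasurable (fun x => Real.exp (D.C x) / D.a x)
    (volume.restrict D.E) := D.aemeasurable_exp_C.div D.measurable_a.aemeasurable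

theorem nuHat_compl (p : ℝ) : D.nuHat p D.Eᶜ = 0 := D.weightMeasure_compl _

theorem mu_compl : D.mu D.Eᶜ = 0 := D.weightMeasure_compl _

theorem eLpNorm_nu (f : ℝ → ℝ) {p : ℝ} (hp : 0 < p) :
    eLpNorm f (ENNReal.ofReal p) D.nu =
      (∫⁻ x in D.E, ENNReal.ofReal (|f x| ^ p * Real.exp (D.C x))) ^ (1 / p) :=
  eLpNorm_weightMeasure D.aemeasurable_exp_C f hp

theorem exists_left_abs_le {f : ℝ → ℝ} (hf : Tendsto f D.leftEnd (𝓝 0)) {ε : ℝ} (hε : 0 < ε)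
    {z : ℝ} (hz : z ∈ D.E) : ∃ y ∈ D.E, y ≤ z ∧ |f y| ≤ ε := by
  obtain ⟨u, hu, h⟩ := D.eventually_leftEnd.1 (hf.eventually (Metric.ball_mem_nhds 0 hε))
  obtain ⟨y, hy, hyu⟩ := D.exists_mem_lt (x := min u z) (by
    rcases min_choice u z with h | h <;> rw [h] <;> assumption)
  refine ⟨y, hy, hyu.le.trans (min_le_right _ _), ?_⟩
  have := h y hy (hyu.trans_le (min_le_left _ _))
  rw [Real.dist_eq, sub_zero] at this
  exact this.le

theorem exists_right_abs_le {f : ℝ → ℝ} (hf : Tendsto f D.rightEnd (𝓝 0)) {ε : ℝ} (hε : 0 < ε)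
    {z : ℝ} (hz : z ∈ D.E) : ∃ y ∈ D.E, z ≤ y ∧ |f y| ≤ ε := by
  obtain ⟨u, hu, h⟩ := D.eventually_rightEnd.1 (hf.eventually (Metric.ball_mem_nhds 0 hε))
  obtain ⟨y, hy, hyu⟩ := D.exists_mem_gt (x := max u z) (by
    rcases max_choice u z with h | h <;> rw [h] <;> assumption)
  refine ⟨y, hy, (le_max_right _ _).trans hyu.le, ?_⟩
  have := h y hy ((le_max_left _ _).trans_lt hyu)
  rw [Real.dist_eq, sub_zero] at this
  exact this.le

variable {D}

/-- Clipping at ε reduces the inequality on E to compact intervals and functions that vanish exactly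
at their Dirichlet ends. At a Neumann end any point serves as the end of the interval. -/
theorem lintegral_rpow_le_of_interval {bc : Boundary} {f : ℝ → ℝ} (hf : D.Admissible bc f)
    {n : Measure ℝ} (hn : n D.Eᶜ = 0) {p q : ℝ} (hp : 0 < p) (hq : 0 < q) {B : ℝ≥0∞}
    (h : ∀ y₁ ∈ D.E, ∀ y₂ ∈ D.E, y₁ ≤ y₂ → ∀ g : ℝ → ℝ, LocAC g D.E →
      (bc.LeftD → g y₁ = 0) → (bc.RightD → g y₂ = 0) →
      ∫⁻ x in Ioo y₁ y₂, ENNReal.ofReal (|g x| ^ q) ∂n ≤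
        (B * ∫⁻ x in Ioo y₁ y₂, ENNReal.ofReal (|deriv g x| ^ p * Real.exp (D.C x))) ^ (q / p)) :
    ∫⁻ x, ENNReal.ofReal (|f x| ^ q) ∂n ≤
      (B * ∫⁻ x in D.E, ENNReal.ofReal (|deriv f x| ^ p * Real.exp (D.C x))) ^ (q / p) := by
  obtain ⟨hAC, hL, hR⟩ := hf
  refine lintegral_le_of_clip hn hAC.continuousOn hq fun ε hε z₁ hz₁ z₂ hz₂ => ?_
  have h1 : ∃ y ∈ D.E, y ≤ min z₁ z₂ ∧ (bc.LeftD → |f y| ≤ ε) := by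
    have hz : min z₁ z₂ ∈ D.E := by rcases min_choice z₁ z₂ with h | h <;> rw [h] <;> assumption
    by_cases hD : bc.LeftD
    · obtain ⟨y, hy, hyz, hfy⟩ := D.exists_left_abs_le (hL hD) hε hz
      exact ⟨y, hy, hyz, fun _ => hfy⟩
    · exact ⟨_, hz, le_rfl, fun h => absurd h hD⟩
  have h2 : ∃ y ∈ D.E, max z₁ z₂ ≤ y ∧ (bc.RightD → |f y| ≤ ε) := by
    have hz : max z₁ z₂ ∈ D.E := by rcases max_choice z₁ z₂ with h | h <;> rw [h] <;> assumption
    by_cases hD : bc.RightD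
    · obtain ⟨y, hy, hyz, hfy⟩ := D.exists_right_abs_le (hR hD) hε hz
      exact ⟨y, hy, hyz, fun _ => hfy⟩
    · exact ⟨_, hz, le_rfl, fun h => absurd h hD⟩
  obtain ⟨y₁, hy₁, hyz₁, hfy₁⟩ := h1
  obtain ⟨y₂, hy₂, hyz₂, hfy₂⟩ := h2
  have h12 : y₁ ≤ y₂ := hyz₁.trans (min_le_max.trans hyz₂)
  refine ⟨y₁, y₂, hyz₁.trans (min_le_left _ _), (le_max_right _ _).trans hyz₂, ?_⟩
  refine (h y₁ hy₁ y₂ hy₂ h12 _ (hAC.clip ε) (fun hD => ?_) (fun hD => ?_)).trans ?_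
  · exact max_eq_right (by linarith [hfy₁ hD])
  · exact max_eq_right (by linarith [hfy₂ hD])
  · refine ENNReal.rpow_le_rpow ?_ (by positivity)
    refine mul_le_mul_right ?_ _
    have hsub : Ioo y₁ y₂ ⊆ D.E := Ioo_subset_Icc_self.trans (D.Icc_subset_E hy₁ hy₂)
    refine le_trans (b := ∫⁻ x in Ioo y₁ y₂,
      ENNReal.ofReal (|deriv f x| ^ p * Real.exp (D.C x))) (lintegral_mono_ae ?_)
      (lintegral_mono_set hsub)
    filter_upwards [ae_restrict_of_ae hAC.ae_differentiableAt, ae_restrict_mem measurableSet_Ioo]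
      with x hx hxm
    refine ENNReal.ofReal_le_ofReal ?_
    exact mul_le_mul_of_nonneg_right (Real.rpow_le_rpow (abs_nonneg _)
      (abs_deriv_clip_le (hx (hsub hxm)) ε) hp.le) (Real.exp_pos _).le

theorem hardyConstB_le_of_lintegral {bc : Boundary} (hbc : bc ≠ Boundary.NN)
    {𝒢 : Set (ℝ → ℝ≥0)} (h𝒢 : ∀ g ∈ 𝒢, Measurable g) {p q : ℝ} (hp : 0 < p) (hq : 0 < q)
    {B : ℝ≥0∞}
    (h : ∀ f, D.Admissible bc f → ∀ g ∈ 𝒢,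
      ∫⁻ x, ENNReal.ofReal (|f x| ^ q) ∂(D.mu.withDensity fun x => (g x : ℝ≥0∞)) ≤
      ((2 * B) ^ p * ∫⁻ x in D.E, ENNReal.ofReal (|deriv f x| ^ p * Real.exp (D.C x))) ^ (q / p)) :
    D.hardyConstB 𝒢 p q bc ≤ 2 * B := by
  refine sInf_le fun f hf => ?_
  have h1 : normB 𝒢 D.mu (fun x => |f x| ^ q) ^ (1 / q) ≤
      2 * B * eLpNorm (deriv f) (ENNReal.ofReal p) D.nu := by
    have h2 : normB 𝒢 D.mu (fun x => |f x| ^ q) ≤ ((2 * B) ^ p *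
        ∫⁻ x in D.E, ENNReal.ofReal (|deriv f x| ^ p * Real.exp (D.C x))) ^ (q / p) := by
      refine iSup₂_le fun g hg => ?_
      refine le_trans (le_of_eq ?_) (h f hf g hg)
      rw [lintegral_withDensity_coe (h𝒢 g hg)]
      refine lintegral_congr fun x => ?_
      rw [Real.enorm_eq_ofReal_abs, abs_of_nonneg (by positivity)]
    refine (ENNReal.rpow_le_rpow h2 (by positivity : 0 ≤ 1 / q)).trans (le_of_eq ?_)
    rw [← ENNReal.rpow_mul, D.eLpNorm_nu _ hp, ENNReal.mul_rpow_of_nonneg _ _ (by positivity),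
      ← ENNReal.rpow_mul]
    have e1 : q / p * (1 / q) = 1 / p := by field_simp
    have e2 : p * (1 / p) = 1 := by field_simp
    rw [e1, e2, ENNReal.rpow_one]
  cases bc
  · exact absurd rfl hbc
  all_goals exact h1

/-- For each g in 𝒢 the measure g μ gives a set S at most ‖1_S‖_𝔹, so it satisfies the isoperimetric
hypothesis with the same B. The energy does not involve g, so the supremum over g is taken at the
end. -/
theorem hardyConstB_le {bc : Boundary} (hbc : bc ≠ Boundary.NN)
    {𝒢 : Set (ℝ → ℝ≥0)} (h𝒢 : ∀ g ∈ 𝒢, Measurable g) {p q : ℝ} (hp : 1 < p) (hpq : p ≤ q) :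
    D.hardyConstB 𝒢 p q bc ≤ 2 * D.hardyIsoB 𝒢 p q bc := by
  have hp0 : 0 < p := by linarith
  have hq0 : 0 < q := by linarith
  have hpc : p.HolderConjugate p.conjExponent := Real.HolderConjugate.conjExponent hp
  rcases eq_or_ne (D.hardyIsoB 𝒢 p q bc) ∞ with htop | hB
  · rw [htop, ENNReal.mul_top (by norm_num)]; exact le_top
  refine hardyConstB_le_of_lintegral hbc h𝒢 hp0 hq0 fun f hf g hg => ?_
  set n := D.mu.withDensity fun x => (g x : ℝ≥0∞) with hn_def
  have hn : n D.Eᶜ = 0 := withDensity_absolutelyContinuous _ _ D.mu_compl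
  have hE := D.measurableSet_E
  have hσ := D.continuousOn_scaleDensity p
  have hpos : ∀ x ∈ D.E, 0 < D.scaleDensity p x := fun x _ => D.scaleDensity_pos p x
  refine lintegral_rpow_le_of_interval hf hn hp0 hq0 fun y₁ hy₁ y₂ hy₂ h12 v hv hv₁ hv₂ => ?_
  have hsub := D.Icc_subset_E hy₁ hy₂
  simp_rw [← D.scaleDensity_rpow hp]
  cases bc
  · exact absurd rfl hbc
  · refine hardy_interval_DD hE hσ hpos hsub h12 (hv _ hy₁ _ hy₂) (hv₁ trivial) (hv₂ trivial)
      hpc hpq hB fun x y hxy hx hy => ?_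
    rw [← nuHat_eq] at hx hy ⊢
    -- The core inequality lets x and y range over all reals. Nonzero scale mass on the left of x
    -- and on the right of y forces both into E, where the supremum defining B is taken.
    obtain ⟨z, hz, hzx⟩ := D.exists_mem_lt_of_measure_ne_zero (D.nuHat_compl p) hx
    obtain ⟨w, hw, hyw⟩ := D.exists_mem_gt_of_measure_ne_zero (D.nuHat_compl p) hy
    have hxE : x ∈ D.E := D.Icc_subset_E hz hw ⟨hzx.le, hxy.trans hyw.le⟩
    have hyE : y ∈ D.E := D.Icc_subset_E hz hw ⟨hzx.le.trans hxy, hyw.le⟩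
    refine (withDensity_le_normB hg measurableSet_Ioo).trans ?_
    refine le_of_rpow_div_le hq0 hp0 ?_ hB ?_
    · simp only [ne_eq, ENNReal.add_eq_top, ENNReal.rpow_eq_top_iff, hx, hy, false_and, false_or]
      rintro (⟨-, h⟩ | ⟨-, h⟩) <;> linarith
    · rw [← D.measure_leftOf (D.nuHat_compl p), ← D.measure_rightOf (D.nuHat_compl p)]
      exact le_iSup₂_of_le x hxE (le_iSup₂_of_le y hyE (le_iSup_of_le hxy le_rfl))
  · refine hardy_interval_DN hE hσ hpos hsub h12 (hv _ hy₁ _ hy₂) (hv₁ trivial)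
      hpc hpq hB fun x hx => ?_
    rw [← nuHat_eq] at hx ⊢
    obtain ⟨z, hz, hzx⟩ := D.exists_mem_lt_of_measure_ne_zero (D.nuHat_compl p) hx
    rw [← D.measure_rightOf hn]
    by_cases hxE : x ∈ D.E
    · refine (withDensity_le_normB hg (hE.inter measurableSet_Ioi)).trans ?_
      refine le_of_mul_rpow_le hp hq0 hx hB ?_
      rw [← D.measure_leftOf (D.nuHat_compl p)]
      exact le_iSup₂_of_le x hxE le_rfl
    · have : D.rightOf x = ∅ := by
        ext w
        simp only [rightOf, mem_inter_iff, mem_Ioi, mem_empty_iff_false, iff_false, not_and]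
        intro hw hxw
        exact hxE (D.Icc_subset_E hz hw ⟨hzx.le, hxw.le⟩)
      rw [this, measure_empty]
      exact zero_le
  · refine hardy_interval_ND hE hσ hpos hsub h12 (hv _ hy₁ _ hy₂) (hv₂ trivial)
      hpc hpq hB fun x hx => ?_
    rw [← nuHat_eq] at hx ⊢
    obtain ⟨z, hz, hzx⟩ := D.exists_mem_gt_of_measure_ne_zero (D.nuHat_compl p) hx
    rw [← D.measure_leftOf hn]
    by_cases hxE : x ∈ D.E
    · refine (withDensity_le_normB hg (hE.inter measurableSet_Iio)).trans ?_
      refine le_of_mul_rpow_le hp hq0 hx hB ?_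
      rw [← D.measure_rightOf (D.nuHat_compl p), mul_comm]
      exact le_iSup₂_of_le x hxE le_rfl
    · have : D.leftOf x = ∅ := by
        ext w
        simp only [leftOf, mem_inter_iff, mem_Iio, mem_empty_iff_false, iff_false, not_and]
        intro hw hxw
        exact hxE (D.Icc_subset_E hw hz ⟨hxw.le, hzx.le⟩)
      rw [this, measure_empty]
      exact zero_le

end Diffusion

/-! ### Test functions and lower bounds -/

/-- The function that is `0` on the left of `x`, `1` on the right of `y`, and grows proportionally
to the measure `σ dx` between them. -/
noncomputable def ramp (σ : ℝ → ℝ) (x y t : ℝ) : ℝ :=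
  (∫ s in x..y, σ s)⁻¹ * ∫ s in x..t, (Ioo x y).indicator σ s

section Ramp

variable {E : Set ℝ} {σ : ℝ → ℝ} {x y : ℝ}

theorem integrable_indicator_Ioo (hσ : ContinuousOn σ E) (hsub : Icc x y ⊆ E) :
    Integrable ((Ioo x y).indicator σ) := by
  rw [integrable_indicator_iff measurableSet_Ioo]
  exact ((hσ.mono hsub).integrableOn_Icc).mono_set Ioo_subset_Icc_self

theorem weightMeasure_Ioo (hσ : ContinuousOn σ E) (hpos : ∀ x ∈ E, 0 < σ x) (hsub : Icc x y ⊆ E)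
    (hxy : x ≤ y) : weightMeasure E σ (Ioo x y) = ENNReal.ofReal (∫ s in x..y, σ s) := by
  have h1 : IntegrableOn σ (Ioo x y) :=
    ((hσ.mono hsub).integrableOn_Icc).mono_set Ioo_subset_Icc_self
  have hsub' : Ioo x y ⊆ E := Ioo_subset_Icc_self.trans hsub
  rw [weightMeasure, withDensity_apply _ measurableSet_Ioo,
    Measure.restrict_restrict measurableSet_Ioo, inter_eq_left.2 hsub',
    intervalIntegral.integral_of_le hxy, integral_Ioc_eq_integral_Ioo,
    ofReal_integral_eq_lintegral_ofReal h1]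
  filter_upwards [ae_restrict_mem measurableSet_Ioo] with z hz
  exact (hpos z (hsub' hz)).le

theorem integral_weight_pos (hσ : ContinuousOn σ E) (hpos : ∀ x ∈ E, 0 < σ x)
    (hsub : Icc x y ⊆ E) (hxy : x < y) : 0 < ∫ s in x..y, σ s := by
  refine intervalIntegral.intervalIntegral_pos_of_pos_on ?_ (fun z hz => hpos z
    (hsub (Ioo_subset_Icc_self hz))) hxy
  exact (hσ.mono (by rwa [uIcc_of_le hxy.le])).intervalIntegrable

theorem ramp_of_le {t : ℝ} (ht : t ≤ x) : ramp σ x y t = 0 := by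
  rw [ramp, intervalIntegral.integral_of_ge ht, setIntegral_congr_fun (g := fun _ => 0)
    measurableSet_Ioc]
  · simp
  · intro s hs
    simp only [indicator, mem_Ioo]
    rw [if_neg (fun h => absurd hs.2 (not_le.2 h.1))]

theorem ramp_of_ge (hσ : ContinuousOn σ E) (hpos : ∀ x ∈ E, 0 < σ x) (hsub : Icc x y ⊆ E)
    (hxy : x < y) {t : ℝ} (ht : y ≤ t) : ramp σ x y t = 1 := by
  have h : ∫ s in x..t, (Ioo x y).indicator σ s = ∫ s in x..y, σ s := by
    have hU : Ioc x t ∩ Ioo x y = Ioo x y := inter_eq_right.2 fun z hz =>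
      ⟨hz.1, hz.2.le.trans ht⟩
    rw [intervalIntegral.integral_of_le (hxy.le.trans ht),
      intervalIntegral.integral_of_le hxy.le, setIntegral_indicator measurableSet_Ioo,
      hU, integral_Ioc_eq_integral_Ioo]
  rw [ramp, h, inv_mul_cancel₀ (integral_weight_pos hσ hpos hsub hxy).ne']

theorem absolutelyContinuousOnInterval_ramp (hσ : ContinuousOn σ E) (hsub : Icc x y ⊆ E)
    (u v : ℝ) : AbsolutelyContinuousOnInterval (ramp σ x y) u v := by
  have hi := integrable_indicator_Ioo hσ hsub
  have h1 : AbsolutelyContinuousOnInterval (fun t => ∫ s in x..t, (Ioo x y).indicator σ s)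
      (min u x) (max v x) ∧ AbsolutelyContinuousOnInterval
      (fun t => ∫ s in x..t, (Ioo x y).indicator σ s) (min v x) (max u x) :=
    ⟨hi.intervalIntegrable.absolutelyContinuousOnInterval_intervalIntegral
      (Icc_subset_uIcc ⟨min_le_right _ _, le_max_right _ _⟩),
    hi.intervalIntegrable.absolutelyContinuousOnInterval_intervalIntegral
      (Icc_subset_uIcc ⟨min_le_right _ _, le_max_right _ _⟩)⟩
  refine AbsolutelyContinuousOnInterval.const_mul _ ?_
  rcases le_total u v with h | h
  · refine h1.1.mono ?_
    rw [uIcc_of_le h]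
    exact (Icc_subset_Icc (min_le_left _ _) (le_max_left _ _)).trans Icc_subset_uIcc
  · refine h1.2.mono ?_
    rw [uIcc_of_ge h]
    exact (Icc_subset_Icc (min_le_left _ _) (le_max_left _ _)).trans Icc_subset_uIcc

theorem ae_hasDerivAt_ramp (hσ : ContinuousOn σ E) (hsub : Icc x y ⊆ E) :
    ∀ᵐ t, HasDerivAt (ramp σ x y) ((∫ s in x..y, σ s)⁻¹ * (Ioo x y).indicator σ t) t := by
  filter_upwards [LocallyIntegrable.ae_hasDerivAt_integral
    (integrable_indicator_Ioo hσ hsub).locallyIntegrable] with t ht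
  exact (ht x).const_mul _

/-- The energy of a ramp. -/
theorem lintegral_indicator_ramp (hσ : ContinuousOn σ E)
    (hpos : ∀ x ∈ E, 0 < σ x) {p : ℝ} {a b : ℝ} (hab : Icc a b ⊆ E) (h : a < b) :
    ∫⁻ t in E, (Ioo a b).indicator (fun t => ENNReal.ofReal
      (|(∫ s in a..b, σ s)⁻¹ * σ t| ^ p * σ t ^ (1 - p))) t =
    weightMeasure E σ (Ioo a b) ^ (1 - p) := by
  have hW := integral_weight_pos hσ hpos hab h
  have hsub' : Ioo a b ⊆ E := Ioo_subset_Icc_self.trans hab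
  have hi : IntegrableOn σ (Ioo a b) :=
    ((hσ.mono hab).integrableOn_Icc).mono_set Ioo_subset_Icc_self
  rw [lintegral_indicator measurableSet_Ioo, Measure.restrict_restrict measurableSet_Ioo,
    inter_eq_left.2 hsub', weightMeasure_Ioo hσ hpos hab h.le,
    ENNReal.ofReal_rpow_of_pos hW]
  set W := ∫ s in a..b, σ s with hWdef
  -- The ramp has slope σ/W, so its energy density is W^(-p) σ, with integral W^(1-p).
  have e : ∀ t ∈ Ioo a b, ENNReal.ofReal (|W⁻¹ * σ t| ^ p * σ t ^ (1 - p)) =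
      ENNReal.ofReal (W⁻¹ ^ p) * ENNReal.ofReal (σ t) := by
    intro t ht
    have hσt := hpos t (hsub' ht)
    rw [abs_of_pos (by positivity), Real.mul_rpow (by positivity) hσt.le, mul_assoc,
      ← Real.rpow_add hσt, add_sub_cancel, Real.rpow_one, ENNReal.ofReal_mul (by positivity)]
  rw [setLIntegral_congr_fun measurableSet_Ioo e,
    lintegral_const_mul' _ _ ENNReal.ofReal_ne_top,
    ← ofReal_integral_eq_lintegral_ofReal hi, ← integral_Ioc_eq_integral_Ioo,
    ← intervalIntegral.integral_of_le h.le, ← hWdef, ← ENNReal.ofReal_mul (by positivity),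
    Real.inv_rpow hW.le, Real.rpow_sub hW, Real.rpow_one]
  · congr 1; field_simp
  · filter_upwards [ae_restrict_mem measurableSet_Ioo] with z hz
    exact (hpos z (hsub' hz)).le

/-- The energy of a difference of two ramps. -/
theorem lintegral_rpow_ramp_add (hE : MeasurableSet E) (hσ : ContinuousOn σ E)
    (hpos : ∀ x ∈ E, 0 < σ x) {p : ℝ} (hp : 1 < p) {x₀ y₀ : ℝ} (hx : Icc x₀ x ⊆ E)
    (hy : Icc y y₀ ⊆ E) (hx₀ : x₀ < x) (hy₀ : y < y₀) (hxy : x ≤ y) :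
    ∫⁻ t in E, ENNReal.ofReal (|(∫ s in x₀..x, σ s)⁻¹ * (Ioo x₀ x).indicator σ t -
      (∫ s in y..y₀, σ s)⁻¹ * (Ioo y y₀).indicator σ t| ^ p * σ t ^ (1 - p)) =
    weightMeasure E σ (Ioo x₀ x) ^ (1 - p) + weightMeasure E σ (Ioo y y₀) ^ (1 - p) := by
  rw [← lintegral_indicator_ramp hσ hpos hx hx₀, ← lintegral_indicator_ramp hσ hpos hy hy₀, ← lintegral_add_left]
  · refine setLIntegral_congr_fun hE fun t ht => ?_
    have hp0 : p ≠ 0 := by linarith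
    simp only [indicator]
    by_cases h1 : t ∈ Ioo x₀ x
    · have h2 : t ∉ Ioo y y₀ := fun h2 => by linarith [h1.2, h2.1]
      simp [h1, h2]
    · by_cases h2 : t ∈ Ioo y y₀
      · simp [h1, h2]
      · simp [h1, h2, Real.zero_rpow hp0]
  · have h1 := measurable_indicator_of_continuousOn hE hσ
    have : ((Ioo x₀ x).indicator fun t => ENNReal.ofReal
        (|(∫ s in x₀..x, σ s)⁻¹ * σ t| ^ p * σ t ^ (1 - p))) =
        ((Ioo x₀ x).indicator fun t => ENNReal.ofReal
        (|(∫ s in x₀..x, σ s)⁻¹ * E.indicator σ t| ^ p * E.indicator σ t ^ (1 - p))) := by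
      refine indicator_congr fun t ht => ?_
      rw [indicator_of_mem (hx (Ioo_subset_Icc_self ht))]
    rw [this]
    exact Measurable.indicator (by fun_prop) measurableSet_Ioo

theorem lintegral_rpow_ramp (hE : MeasurableSet E) (hσ : ContinuousOn σ E)
    (hpos : ∀ x ∈ E, 0 < σ x) {p : ℝ} (hp : 1 < p) (hsub : Icc x y ⊆ E) (hxy : x < y) :
    ∫⁻ t in E, ENNReal.ofReal (|(∫ s in x..y, σ s)⁻¹ * (Ioo x y).indicator σ t| ^ p *
      σ t ^ (1 - p)) = weightMeasure E σ (Ioo x y) ^ (1 - p) := by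
  rw [← lintegral_indicator_ramp hσ hpos hsub hxy]
  refine setLIntegral_congr_fun hE fun t _ => ?_
  have hp0 : p ≠ 0 := by linarith
  simp only [indicator]
  by_cases h1 : t ∈ Ioo x y
  · simp [h1]
  · simp [h1, Real.zero_rpow hp0]

end Ramp

theorem normB_mono {𝒢 : Set (ℝ → ℝ≥0)} {μ : Measure ℝ} {f g : ℝ → ℝ}
    (h : ∀ᵐ x ∂μ, |f x| ≤ |g x|) : normB 𝒢 μ f ≤ normB 𝒢 μ g := by
  refine iSup₂_mono fun w _ => lintegral_mono_ae ?_
  filter_upwards [h] with x hx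
  gcongr
  rw [Real.enorm_eq_ofReal_abs, Real.enorm_eq_ofReal_abs]
  exact ENNReal.ofReal_le_ofReal hx

theorem mul_rpow_le_of_le {p q : ℝ} (hp : 1 < p) (hq : 0 < q) {S N A : ℝ≥0∞} (hS : S ≠ 0)
    (h : N ^ (p / q) ≤ A ^ p * S ^ (1 - p)) :
    S ^ ((p - 1) / p) * N ^ (1 / q) ≤ A := by
  have hp0 : 0 < p := by linarith
  have h1 := ENNReal.rpow_le_rpow h (by positivity : 0 ≤ 1 / p)
  rw [← ENNReal.rpow_mul, ENNReal.mul_rpow_of_nonneg _ _ (by positivity), ← ENNReal.rpow_mul,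
    ← ENNReal.rpow_mul] at h1
  have e1 : p / q * (1 / p) = 1 / q := by field_simp
  have e2 : p * (1 / p) = 1 := by field_simp
  have e3 : (1 - p) * (1 / p) = -((p - 1) / p) := by ring
  rw [e1, e2, e3, ENNReal.rpow_one] at h1
  have hpp : 0 < (p - 1) / p := div_pos (by linarith) hp0
  rcases eq_or_ne S ∞ with rfl | hS'
  · rw [ENNReal.rpow_neg, ENNReal.top_rpow_of_pos hpp, ENNReal.inv_top, mul_zero] at h1
    rw [le_zero_iff.1 h1, mul_zero]
    exact zero_le
  · calc S ^ ((p - 1) / p) * N ^ (1 / q) ≤ S ^ ((p - 1) / p) * (A * S ^ (-((p - 1) / p))) := by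
          gcongr
      _ = A * (S ^ ((p - 1) / p) * S ^ (-((p - 1) / p))) := by ring
      _ = A := by rw [← ENNReal.rpow_add _ _ hS hS', add_neg_cancel, ENNReal.rpow_zero, mul_one]

namespace Diffusion

variable {D : Diffusion}

theorem rpow_le_of_test {A L Q : ℝ≥0∞} {p : ℝ} (hp : 1 < p) {f f' : ℝ → ℝ}
    (hf' : ∀ᵐ t, HasDerivAt f (f' t) t)
    (hQ : ∫⁻ t in D.E, ENNReal.ofReal (|f' t| ^ p * D.scaleDensity p t ^ (1 - p)) = Q)
    (h : L ≤ A * eLpNorm (deriv f) (ENNReal.ofReal p) D.nu) : L ^ p ≤ A ^ p * Q := by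
  have hp0 : 0 < p := by linarith
  have h1 := ENNReal.rpow_le_rpow h hp0.le
  rw [D.eLpNorm_nu _ hp0, ENNReal.mul_rpow_of_nonneg _ _ hp0.le, ← ENNReal.rpow_mul,
    one_div_mul_cancel hp0.ne', ENNReal.rpow_one] at h1
  rw [← hQ]
  refine h1.trans (le_of_eq ?_)
  congr 1
  refine lintegral_congr_ae ?_
  filter_upwards [ae_restrict_of_ae hf'] with t ht
  rw [ht.deriv, D.scaleDensity_rpow hp]

theorem tendsto_leftEnd_of_eq {f : ℝ → ℝ} {u c : ℝ} (hu : u ∈ D.E) (h : ∀ x < u, f x = c) :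
    Tendsto f D.leftEnd (𝓝 c) :=
  tendsto_const_nhds.congr' (D.eventually_leftEnd.2 ⟨u, hu, fun x _ hx => (h x hx).symm⟩)

theorem tendsto_rightEnd_of_eq {f : ℝ → ℝ} {u c : ℝ} (hu : u ∈ D.E) (h : ∀ x, u < x → f x = c) :
    Tendsto f D.rightEnd (𝓝 c) :=
  tendsto_const_nhds.congr' (D.eventually_rightEnd.2 ⟨u, hu, fun x _ hx => (h x hx).symm⟩)

theorem locAC_const (c : ℝ) : LocAC (fun _ => c) D.E := fun _ _ _ _ =>
  ((LipschitzWith.const _).lipschitzOnWith).absolutelyContinuousOnInterval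

-- The test functions are ramps with respect to ν̂: a ramp up from the left (DN), a ramp down to the
-- right (ND), a difference of two ramps equal to 1 on (x, y) (DD), and a ramp from x to y (NN).
-- Where an end is Dirichlet, the outer foot is then sent to that endpoint.
variable (D) in
theorem hardyIsoB_le (𝒢 : Set (ℝ → ℝ≥0)) {p q : ℝ} (hp : 1 < p) (hq : 0 < q) (bc : Boundary) :
    D.hardyIsoB 𝒢 p q bc ≤ D.hardyConstB 𝒢 p q bc := by
  refine le_sInf fun A hA => ?_
  have hp0 : 0 < p := by linarith
  rcases eq_or_ne A ∞ with rfl | hAtop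
  · exact le_top
  have hE := D.measurableSet_E
  have hσ := D.continuousOn_scaleDensity p
  have hpos : ∀ x ∈ D.E, 0 < D.scaleDensity p x := fun x _ => D.scaleDensity_pos p x
  set σ := D.scaleDensity p with hσdef
  have hAp : A ^ p ≠ ∞ := ENNReal.rpow_ne_top_of_nonneg hp0.le hAtop
  have hAC : ∀ {x y : ℝ}, x ∈ D.E → y ∈ D.E → LocAC (ramp σ x y) D.E := fun hx hy u _ v _ =>
    absolutelyContinuousOnInterval_ramp hσ (D.Icc_subset_E hx hy) u v
  have hexp : ∀ N : ℝ≥0∞, (N ^ (1 / q)) ^ p = N ^ (p / q) := fun N => by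
    rw [← ENNReal.rpow_mul]; congr 1; ring
  have hleft : ∀ x ∈ D.E, D.nuHat p (D.leftOf x) ≠ 0 := by
    intro x hx
    obtain ⟨z, hz, hzx⟩ := D.exists_mem_lt hx
    have := D.weightMeasure_Ioo_ne_zero hσ hpos hz hx hzx
    refine fun h0 => this (measure_mono_null ?_ h0)
    exact fun w hw => ⟨D.Icc_subset_E hz hx (Ioo_subset_Icc_self hw), hw.2⟩
  have hright : ∀ x ∈ D.E, D.nuHat p (D.rightOf x) ≠ 0 := by
    intro x hx
    obtain ⟨z, hz, hzx⟩ := D.exists_mem_gt hx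
    have := D.weightMeasure_Ioo_ne_zero hσ hpos hx hz hzx
    refine fun h0 => this (measure_mono_null ?_ h0)
    exact fun w hw => ⟨D.Icc_subset_E hx hz (Ioo_subset_Icc_self hw), hw.1⟩
  cases bc
  · refine iSup₂_le fun x hx => iSup₂_le fun y hy => iSup_le fun hxy => ?_
    have hsub := D.Icc_subset_E hx hy
    set I := ⨅ k : ℝ, normB 𝒢 D.mu (fun t => (D.leftOf x).indicator (fun _ => |k| ^ q) t +
      (D.rightOf y).indicator (fun _ => |1 - k| ^ q) t) with hI
    have h1 : I ^ (1 / q) ≤ A * eLpNorm (deriv (ramp σ x y)) (ENNReal.ofReal p) D.nu := by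
      refine le_trans ?_ (hA _ ⟨hAC hx hy, fun h => h.elim, fun h => h.elim⟩)
      -- The ramp is 0 left of x and 1 right of y, so |ramp - k|^q is |k|^q and |1-k|^q there; the
      -- part between x and y is discarded.
      refine le_iInf fun k => ENNReal.rpow_le_rpow ((iInf_le _ k).trans ?_) (by positivity)
      refine normB_mono (ae_of_all _ fun t => ?_)
      have h0 : (0 : ℝ) ≤ |ramp σ x y t - k| ^ q := by positivity
      by_cases h1 : t ∈ D.leftOf x
      · have h2 : t ∉ D.rightOf y := fun h2 => by
          have a : t < x := h1.2
          have b : y < t := h2.2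
          linarith
        rw [indicator_of_mem h1, indicator_of_notMem h2, ramp_of_le (le_of_lt h1.2)]
        simp
      · by_cases h2 : t ∈ D.rightOf y
        · rw [indicator_of_notMem h1, indicator_of_mem h2,
            ramp_of_ge hσ hpos hsub hxy (le_of_lt h2.2)]
          simp
        · rw [indicator_of_notMem h1, indicator_of_notMem h2]
          simp
    have h2 := rpow_le_of_test hp (ae_hasDerivAt_ramp hσ hsub)
      (lintegral_rpow_ramp hE hσ hpos hp hsub hxy) h1
    rw [hexp] at h2
    exact mul_rpow_le_of_le hp hq (D.weightMeasure_Ioo_ne_zero hσ hpos hx hy hxy) h2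
  · refine iSup₂_le fun x hx => iSup₂_le fun y hy => iSup_le fun hxy => ?_
    set N := normB 𝒢 D.mu ((Ioo x y).indicator fun _ => 1) with hN
    have key : N ^ (p / q) ≤ A ^ p * (D.nuHat p (D.leftOf x) ^ (1 - p) +
        D.nuHat p (D.rightOf y) ^ (1 - p)) := by
      refine D.le_mul_leftOf_rpow hAp hx fun z hz hzx => ?_
      refine D.le_mul_rightOf_rpow hAp hy fun w hw hyw => ?_
      have hzs := D.Icc_subset_E hz hx
      have hws := D.Icc_subset_E hy hw
      have h1 : N ^ (1 / q) ≤ A * eLpNorm (deriv fun t => ramp σ z x t - ramp σ y w t)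
          (ENNReal.ofReal p) D.nu := by
        refine le_trans ?_ (hA _ ⟨fun u hu v hv => (hAC hz hx u hu v hv).sub (hAC hy hw u hu v hv),
          fun _ => tendsto_leftEnd_of_eq hz fun t ht => ?_,
          fun _ => tendsto_rightEnd_of_eq hw fun t ht => ?_⟩)
        · refine ENNReal.rpow_le_rpow (normB_mono (ae_of_all _ fun t => ?_)) (by positivity)
          by_cases ht : t ∈ Ioo x y
          · simp only
            rw [indicator_of_mem ht, ramp_of_ge hσ hpos hzs hzx ht.1.le, ramp_of_le ht.2.le]
            simp
          · rw [indicator_of_notMem ht, abs_zero]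
            positivity
        · rw [ramp_of_le ht.le, ramp_of_le (by linarith), sub_zero]
        · rw [ramp_of_ge hσ hpos hzs hzx (by linarith), ramp_of_ge hσ hpos hws hyw ht.le, sub_self]
      have hd : ∀ᵐ t, HasDerivAt (fun t => ramp σ z x t - ramp σ y w t)
          ((∫ s in z..x, σ s)⁻¹ * (Ioo z x).indicator σ t -
            (∫ s in y..w, σ s)⁻¹ * (Ioo y w).indicator σ t) t := by
        filter_upwards [ae_hasDerivAt_ramp hσ hzs, ae_hasDerivAt_ramp hσ hws] with t h1 h2
        exact h1.sub h2
      have h2 := rpow_le_of_test hp hd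
        (lintegral_rpow_ramp_add hE hσ hpos hp hzs hws hzx hyw hxy) h1
      rwa [hexp] at h2
    refine ENNReal.div_le_of_le_mul ?_
    have h3 := ENNReal.rpow_le_rpow key (by positivity : 0 ≤ 1 / p)
    rw [← ENNReal.rpow_mul, ENNReal.mul_rpow_of_nonneg _ _ (by positivity),
      ← ENNReal.rpow_mul] at h3
    have e1 : p / q * (1 / p) = 1 / q := by field_simp
    have e2 : p * (1 / p) = 1 := by field_simp
    rwa [e1, e2, ENNReal.rpow_one] at h3
  · refine iSup₂_le fun x hx => mul_rpow_le_of_le hp hq (hleft x hx) ?_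
    set N := normB 𝒢 D.mu ((D.rightOf x).indicator fun _ => 1) with hN
    rw [← add_zero (D.nuHat p (D.leftOf x) ^ (1 - p))]
    refine D.le_mul_leftOf_rpow hAp hx fun z hz hzx => ?_
    have hzs := D.Icc_subset_E hz hx
    have h1 : N ^ (1 / q) ≤ A * eLpNorm (deriv (ramp σ z x)) (ENNReal.ofReal p) D.nu := by
      refine le_trans ?_ (hA _ ⟨hAC hz hx, fun _ => tendsto_leftEnd_of_eq hz fun t ht =>
        ramp_of_le ht.le, fun h => h.elim⟩)
      refine ENNReal.rpow_le_rpow (normB_mono (ae_of_all _ fun t => ?_)) (by positivity)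
      by_cases ht : t ∈ D.rightOf x
      · rw [indicator_of_mem ht, ramp_of_ge hσ hpos hzs hzx (le_of_lt ht.2)]
        simp
      · rw [indicator_of_notMem ht, abs_zero]
        positivity
    have h2 := rpow_le_of_test hp (ae_hasDerivAt_ramp hσ hzs)
      (lintegral_rpow_ramp hE hσ hpos hp hzs hzx) h1
    rwa [hexp, ← add_zero (weightMeasure D.E σ (Ioo z x) ^ (1 - p))] at h2
  · refine iSup₂_le fun x hx => ?_
    rw [mul_comm]
    refine mul_rpow_le_of_le hp hq (hright x hx) ?_
    set N := normB 𝒢 D.mu ((D.leftOf x).indicator fun _ => 1) with hN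
    rw [← zero_add (D.nuHat p (D.rightOf x) ^ (1 - p))]
    refine D.le_mul_rightOf_rpow hAp hx fun z hz hzx => ?_
    have hzs := D.Icc_subset_E hx hz
    have h1 : N ^ (1 / q) ≤ A * eLpNorm (deriv fun t => 1 - ramp σ x z t)
        (ENNReal.ofReal p) D.nu := by
      refine le_trans ?_ (hA _ ⟨fun u hu v hv => (locAC_const 1 u hu v hv).sub
        (hAC hx hz u hu v hv), fun h => h.elim, fun _ => tendsto_rightEnd_of_eq hz fun t ht => ?_⟩)
      · refine ENNReal.rpow_le_rpow (normB_mono (ae_of_all _ fun t => ?_)) (by positivity)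
        by_cases ht : t ∈ D.leftOf x
        · simp only
          rw [indicator_of_mem ht, ramp_of_le (le_of_lt ht.2)]
          simp
        · rw [indicator_of_notMem ht, abs_zero]
          positivity
      · rw [ramp_of_ge hσ hpos hzs hzx ht.le, sub_self]
    have hd : ∀ᵐ t, HasDerivAt (fun t => 1 - ramp σ x z t)
        (-((∫ s in x..z, σ s)⁻¹ * (Ioo x z).indicator σ t)) t := by
      filter_upwards [ae_hasDerivAt_ramp hσ hzs] with t h1
      exact h1.const_sub _
    have h2 := rpow_le_of_test (Q := weightMeasure D.E σ (Ioo x z) ^ (1 - p)) hp hd (by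
      simp_rw [abs_neg]
      exact lintegral_rpow_ramp hE hσ hpos hp hzs hzx) h1
    rwa [hexp, ← zero_add (weightMeasure D.E σ (Ioo x z) ^ (1 - p))] at h2

end Diffusion

/-! ### The Neumann case: weighted Lebesgue spaces -/

/-- The minimum over `k` of `|k|^q M₁ + |1-k|^q M₂`. -/
theorem iInf_rpow_mul_add_eq {q : ℝ} (hq : 1 < q) (M₁ M₂ : ℝ≥0∞) :
    ⨅ k : ℝ, (ENNReal.ofReal (|k| ^ q) * M₁ + ENNReal.ofReal (|1 - k| ^ q) * M₂) =
      (M₁ ^ (-(1 / (q - 1))) + M₂ ^ (-(1 / (q - 1)))) ^ (-(q - 1)) := by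
  have hq0 : q ≠ 0 := by linarith
  have hq1 : 0 < q - 1 := by linarith
  have he : -(1 / (q - 1)) < 0 := by have : 0 < 1 / (q - 1) := by positivity
                                     linarith
  have hcancel : -(1 / (q - 1)) * -(q - 1) = 1 := by field_simp
  have hneg : -(q - 1) < 0 := by linarith
  have hle0 : ⨅ k : ℝ, (ENNReal.ofReal (|k| ^ q) * M₁ + ENNReal.ofReal (|1 - k| ^ q) * M₂) ≤ M₂ :=
    (iInf_le _ 0).trans (by simp [Real.zero_rpow hq0])
  have hle1 : ⨅ k : ℝ, (ENNReal.ofReal (|k| ^ q) * M₁ + ENNReal.ofReal (|1 - k| ^ q) * M₂) ≤ M₁ :=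
    (iInf_le _ 1).trans (by simp [Real.zero_rpow hq0])
  have hpos : ∀ k : ℝ, k ≠ 0 → ENNReal.ofReal (|k| ^ q) ≠ 0 := fun k hk => by
    have := abs_pos.2 hk
    simp only [ne_eq, ENNReal.ofReal_eq_zero, not_le]; positivity
  -- If a mass is 0 or ∞, the infimum is attained at k = 0 or k = 1, with 0 · ∞ = 0.
  rcases eq_or_ne M₁ 0 with rfl | h1
  · rw [ENNReal.zero_rpow_of_neg he, top_add, ENNReal.top_rpow_of_neg hneg]
    exact le_zero_iff.1 hle1
  rcases eq_or_ne M₂ 0 with rfl | h2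
  · rw [ENNReal.zero_rpow_of_neg he, add_top, ENNReal.top_rpow_of_neg hneg]
    exact le_zero_iff.1 hle0
  rcases eq_or_ne M₁ ∞ with rfl | h1'
  · rw [ENNReal.top_rpow_of_neg he, zero_add, ← ENNReal.rpow_mul, hcancel, ENNReal.rpow_one]
    refine le_antisymm hle0 (le_iInf fun k => ?_)
    rcases eq_or_ne k 0 with rfl | hk
    · simp
    · rw [ENNReal.mul_top (hpos k hk), top_add]; exact le_top
  rcases eq_or_ne M₂ ∞ with rfl | h2'
  · rw [ENNReal.top_rpow_of_neg he, add_zero, ← ENNReal.rpow_mul, hcancel, ENNReal.rpow_one]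
    refine le_antisymm hle1 (le_iInf fun k => ?_)
    rcases eq_or_ne k 1 with rfl | hk
    · simp
    · rw [ENNReal.mul_top (hpos _ (sub_ne_zero.2 hk.symm)), add_top]; exact le_top
  obtain ⟨a, ha, rfl⟩ : ∃ a : ℝ, 0 < a ∧ ENNReal.ofReal a = M₁ :=
    ⟨M₁.toReal, ENNReal.toReal_pos h1 h1', ENNReal.ofReal_toReal h1'⟩
  obtain ⟨b, hb, rfl⟩ : ∃ b : ℝ, 0 < b ∧ ENNReal.ofReal b = M₂ :=
    ⟨M₂.toReal, ENNReal.toReal_pos h2 h2', ENNReal.ofReal_toReal h2'⟩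
  set e := 1 / (q - 1) with he_def
  have hS : 0 < a ^ (-e) + b ^ (-e) := by positivity
  rw [ENNReal.ofReal_rpow_of_pos ha, ENNReal.ofReal_rpow_of_pos hb,
    ← ENNReal.ofReal_add (by positivity) (by positivity), ENNReal.ofReal_rpow_of_pos hS]
  have hk : ∀ k : ℝ, ENNReal.ofReal (|k| ^ q) * ENNReal.ofReal a +
      ENNReal.ofReal (|1 - k| ^ q) * ENNReal.ofReal b =
      ENNReal.ofReal (|k| ^ q * a + |1 - k| ^ q * b) := fun k => by
    rw [ENNReal.ofReal_add (by positivity) (by positivity), ENNReal.ofReal_mul (by positivity),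
      ENNReal.ofReal_mul (by positivity)]
  simp_rw [hk]
  -- The witness is the critical point of k^q a + (1-k)^q b, where k : (1-k) = a^(-e) : b^(-e) with
  -- e = 1/(q-1).
  refine le_antisymm ((iInf_le _ (a ^ (-e) / (a ^ (-e) + b ^ (-e)))).trans ?_)
    (le_iInf fun k => ENNReal.ofReal_le_ofReal ?_)
  · refine ENNReal.ofReal_le_ofReal (le_of_eq ?_)
    have e1 : 1 - a ^ (-e) / (a ^ (-e) + b ^ (-e)) = b ^ (-e) / (a ^ (-e) + b ^ (-e)) := by
      field_simp; ring
    rw [e1, abs_of_pos (by positivity), abs_of_pos (by positivity),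
      Real.div_rpow (by positivity) (by positivity), Real.div_rpow (by positivity) (by positivity),
      ← Real.rpow_mul ha.le, ← Real.rpow_mul hb.le]
    have e2 : -e * q = -e + -1 := by rw [he_def]; field_simp; ring
    rw [e2, Real.rpow_add ha, Real.rpow_add hb, Real.rpow_neg_one, Real.rpow_neg_one]
    have e3 : -(q - 1) = 1 - q := by ring
    rw [e3, Real.rpow_sub hS, Real.rpow_one]
    field_simp
  -- Lower bound: Hölder's inequality for two terms applied to 1 ≤ |k| + |1-k|, each summand being
  -- written as (|z| c^(1/q)) · c^(-1/q).
  · have hqc : q.HolderConjugate q.conjExponent := Real.HolderConjugate.conjExponent hq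
    have h3 := Real.inner_le_Lp_mul_Lq (Finset.univ : Finset (Fin 2))
      ![|k| * a ^ (1 / q), |1 - k| * b ^ (1 / q)] ![a ^ (-(1 / q)), b ^ (-(1 / q))] hqc
    simp only [Fin.sum_univ_two, Matrix.cons_val_zero, Matrix.cons_val_one] at h3
    have c1 : ∀ z c : ℝ, 0 < c → |z| * c ^ (1 / q) * c ^ (-(1 / q)) = |z| := fun z c hc => by
      rw [mul_assoc, ← Real.rpow_add hc, add_neg_cancel, Real.rpow_zero, mul_one]
    have c2 : ∀ z c : ℝ, 0 < c → |(|z| * c ^ (1 / q))| ^ q = |z| ^ q * c := fun z c hc => by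
      rw [abs_of_nonneg (by positivity), Real.mul_rpow (by positivity) (by positivity),
        ← Real.rpow_mul hc.le, one_div_mul_cancel hq0, Real.rpow_one]
    have c3 : ∀ c : ℝ, 0 < c → |c ^ (-(1 / q))| ^ q.conjExponent = c ^ (-e) := fun c hc => by
      rw [abs_of_pos (by positivity), ← Real.rpow_mul hc.le]
      congr 1
      rw [Real.conjExponent, he_def]; field_simp
    rw [c1 _ _ ha, c1 _ _ hb, c2 _ _ ha, c2 _ _ hb, c3 _ ha, c3 _ hb] at h3
    have h4 : 1 ≤ |k| + |1 - k| := by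
      have := abs_add_le k (1 - k)
      rw [add_sub_cancel, abs_one] at this
      exact this
    have h5 := Real.rpow_le_rpow (by norm_num) (h4.trans h3) (by linarith : 0 ≤ q)
    have e5 : 1 / q.conjExponent * q = q - 1 := by
      rw [Real.conjExponent]; field_simp
    rw [Real.one_rpow, Real.mul_rpow (by positivity) (by positivity),
      ← Real.rpow_mul (by positivity), one_div_mul_cancel hq0, Real.rpow_one,
      ← Real.rpow_mul hS.le, e5] at h5
    rw [Real.rpow_neg hS.le, inv_le_iff_one_le_mul₀ (by positivity)]
    exact h5

/-- The odd power `|t|^(q-1) sign t`. -/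
noncomputable def oddPow (q t : ℝ) : ℝ := max t 0 ^ (q - 1) - max (-t) 0 ^ (q - 1)

section OddPow

variable {q : ℝ}

theorem continuous_oddPow (hq : 1 < q) : Continuous (oddPow q) := by
  have h : 0 ≤ q - 1 := by linarith
  unfold oddPow
  exact ((continuous_id.max continuous_const).rpow_const fun _ => Or.inr h).sub
    ((continuous_neg.max continuous_const).rpow_const fun _ => Or.inr h)

theorem monotone_oddPow (hq : 1 < q) : Monotone (oddPow q) := by
  intro s t hst
  have h : 0 ≤ q - 1 := by linarith
  have h1 := Real.rpow_le_rpow (le_max_right s 0) (max_le_max_right 0 hst) h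
  have h2 := Real.rpow_le_rpow (le_max_right (-t) 0) (max_le_max_right 0 (neg_le_neg hst)) h
  simp only [oddPow]
  linarith

theorem oddPow_of_nonneg (hq : 1 < q) {t : ℝ} (ht : 0 ≤ t) : oddPow q t = t ^ (q - 1) := by
  rw [oddPow, max_eq_left ht, max_eq_right (by linarith), Real.zero_rpow (by linarith), sub_zero]

theorem oddPow_of_nonpos (hq : 1 < q) {t : ℝ} (ht : t ≤ 0) : oddPow q t = -(-t) ^ (q - 1) := by
  rw [oddPow, max_eq_right ht, max_eq_left (by linarith), Real.zero_rpow (by linarith), zero_sub]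

theorem abs_oddPow (hq : 1 < q) (t : ℝ) : |oddPow q t| = |t| ^ (q - 1) := by
  rcases le_total 0 t with ht | ht
  · rw [oddPow_of_nonneg hq ht, abs_of_nonneg ht, abs_of_nonneg (by positivity)]
  · have : 0 ≤ -t := by linarith
    rw [oddPow_of_nonpos hq ht, abs_neg, abs_of_nonpos ht, abs_of_nonneg (by positivity)]

theorem mul_oddPow (hq : 1 < q) (t : ℝ) : t * oddPow q t = |t| ^ q := by
  have h : q = 1 + (q - 1) := by ring
  rcases le_total 0 t with ht | ht
  · rw [oddPow_of_nonneg hq ht, abs_of_nonneg ht]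
    conv_rhs => rw [h]
    rw [Real.rpow_add_of_nonneg ht (by norm_num) (by linarith), Real.rpow_one]
  · have h0 : 0 ≤ -t := by linarith
    rw [oddPow_of_nonpos hq ht, abs_of_nonpos ht]
    conv_rhs => rw [h]
    rw [Real.rpow_add_of_nonneg h0 (by norm_num) (by linarith), Real.rpow_one]
    ring

end OddPow

/-! ### The q-mean and the duality between the Neumann and Dirichlet cases -/

section Mean

variable {x₁ x₂ : ℝ} {m : Measure ℝ}

theorem restrict_Icc_eq (hm : m (Icc x₁ x₂)ᶜ = 0) : m.restrict (Icc x₁ x₂) = m :=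
  Measure.restrict_eq_self_of_ae_mem (mem_ae_iff.2 hm)

theorem abs_setIntegral_le {v : ℝ → ℝ} (S : Set ℝ) (hS : MeasurableSet S) (hv : Integrable v m) :
    |∫ x in S, v x ∂m| ≤ (m.withDensity fun x => ENNReal.ofReal |v x|).real S := by
  rw [measureReal_def, withDensity_apply _ hS]
  have h1 : ∫⁻ x in S, ENNReal.ofReal |v x| ∂m = ∫⁻ x in S, ‖v x‖ₑ ∂m :=
    lintegral_congr fun x => (Real.enorm_eq_ofReal_abs _).symm
  rw [h1, ← Real.norm_eq_abs, ← integral_norm_eq_lintegral_enorm hv.aestronglyMeasurable.restrict]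
  exact norm_integral_le_integral_norm _

variable [IsFiniteMeasure m]

theorem integrable_of_continuous (hm : m (Icc x₁ x₂)ᶜ = 0) {v : ℝ → ℝ} (hv : Continuous v) :
    Integrable v m := by
  rw [← restrict_Icc_eq hm]
  exact hv.integrableOn_Icc

theorem continuous_integral (hm : m (Icc x₁ x₂)ᶜ = 0) {v : ℝ → ℝ → ℝ}
    (hv : Continuous (Function.uncurry v)) : Continuous fun k => ∫ x, v k x ∂m := by
  rw [← restrict_Icc_eq hm]
  exact continuous_parametric_integral_of_continuous hv isCompact_Icc

/-- Existence of the `q`-mean of a function. -/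
theorem exists_integral_oddPow_eq_zero {q : ℝ} (hq : 1 < q) (hm : m (Icc x₁ x₂)ᶜ = 0)
    {u : ℝ → ℝ} (hu : Continuous u) : ∃ k, ∫ x, oddPow q (u x - k) ∂m = 0 := by
  -- With |u| ≤ R on the carrier of m, the integral is nonnegative at k = -R and nonpositive at k =
  -- R; a root exists by continuity in k.
  obtain ⟨R, hR⟩ := isCompact_Icc.exists_bound_of_continuousOn (hu.continuousOn (s := Icc x₁ x₂))
  have hae : ∀ᵐ x ∂m, x ∈ Icc x₁ x₂ := mem_ae_iff.2 hm
  have hc : Continuous fun k => ∫ x, oddPow q (u x - k) ∂m := by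
    refine continuous_integral hm ?_
    have := continuous_oddPow hq
    fun_prop
  have h1 : 0 ≤ ∫ x, oddPow q (u x - -R) ∂m := by
    refine integral_nonneg_of_ae ?_
    filter_upwards [hae] with x hx
    have := (abs_le.1 (hR x hx)).1
    have h0 : 0 ≤ u x - -R := by linarith
    rw [oddPow_of_nonneg hq h0]
    exact Real.rpow_nonneg h0 _
  have h2 : ∫ x, oddPow q (u x - R) ∂m ≤ 0 := by
    refine integral_nonpos_of_ae ?_
    filter_upwards [hae] with x hx
    have := (abs_le.1 (hR x hx)).2
    have h0 : u x - R ≤ 0 := by linarith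
    rw [oddPow_of_nonpos hq h0]
    have : 0 ≤ (-(u x - R)) ^ (q - 1) := Real.rpow_nonneg (by linarith) _
    simpa using this
  exact mem_range_of_exists_le_of_exists_ge hc ⟨R, h2⟩ ⟨-R, h1⟩

variable {E : Set ℝ} {σ f u : ℝ → ℝ} {p q k : ℝ} {B : ℝ≥0∞}

/-- The key identity and estimate: integration by parts against the `q`-mean. -/
theorem lintegral_sub_rpow_le_lintegral_deriv [NullSingletonClass m] (hq : 1 < q)
    (hm : m (Icc x₁ x₂)ᶜ = 0) (h12 : x₁ ≤ x₂) (hf : AbsolutelyContinuousOnInterval f x₁ x₂)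
    (hu : Continuous u) (huf : EqOn u f (Icc x₁ x₂))
    (hk : ∫ x, oddPow q (u x - k) ∂m = 0) :
    ∫⁻ x, ENNReal.ofReal (|u x - k| ^ q) ∂m ≤
      ∫⁻ y in Ioo x₁ x₂, ENNReal.ofReal |deriv f y| * ENNReal.ofReal
        (min ((m.withDensity fun x => ENNReal.ofReal |oddPow q (u x - k)|).real (Iio y))
          ((m.withDensity fun x => ENNReal.ofReal |oddPow q (u x - k)|).real (Ioi y))) := by
  have hψ := continuous_oddPow hq
  set v : ℝ → ℝ := fun x => oddPow q (u x - k) with hv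
  have hvc : Continuous v := by fun_prop
  have hvi : Integrable v m := integrable_of_continuous hm hvc
  have hae : ∀ᵐ x ∂m, x ∈ Icc x₁ x₂ := mem_ae_iff.2 hm
  set d := deriv f with hd
  have hdi : IntegrableOn d (Ioc x₁ x₂) :=
    (intervalIntegrable_iff_integrableOn_Ioc_of_le h12).1 hf.intervalIntegrable_deriv
  set J : ℝ → ℝ → ℝ := fun x y => (Iio y).indicator v x * d y with hJ
  have hJi : Integrable (Function.uncurry J) (m.prod (volume.restrict (Ioc x₁ x₂))) := by
    have h1 : Integrable (fun z : ℝ × ℝ => v z.1 * d z.2)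
      (m.prod (volume.restrict (Ioc x₁ x₂))) := hvi.mul_prod hdi
    have h2 := h1.indicator (measurableSet_lt measurable_fst measurable_snd)
    refine h2.congr (ae_of_all _ fun z => ?_)
    simp only [hJ, Function.uncurry, indicator, mem_ofPred_eq, mem_Iio]
    split_ifs <;> simp
  set Φ : ℝ → ℝ := fun y => ∫ x in Iio y, v x ∂m with hΦ
  have hΦb : ∀ y, |Φ y| ≤ min ((m.withDensity fun x => ENNReal.ofReal |v x|).real (Iio y))
      ((m.withDensity fun x => ENNReal.ofReal |v x|).real (Ioi y)) := by
    intro y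
    refine le_min (abs_setIntegral_le _ measurableSet_Iio hvi) ?_
    -- The choice of k makes the total integral of v zero, so the primitive Φ can be computed from
    -- either side. This gives the doubly Dirichlet bound for Φ.
    have h1 : Φ y = -∫ x in Ioi y, v x ∂m := by
      have h2 := integral_add_compl (measurableSet_Iio (a := y)) hvi
      rw [hk, compl_Iio, integral_Ici_eq_integral_Ioi] at h2
      simp only [hΦ]; linarith
    rw [h1, abs_neg]
    exact abs_setIntegral_le _ measurableSet_Ioi hvi
  -- Here |u-k|^q = (u-k) v, and u(x) is written as u(x₂) minus the integral of f' over (x, x₂). The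
  -- term with the constant u(x₂) - k disappears after integration, because v has integral zero.
  have h1 : ∀ x ∈ Icc x₁ x₂, |u x - k| ^ q = (u x₂ - k) * v x - ∫ y in Ioc x₁ x₂, J x y := by
    intro x hx
    have e1 : ∫ y in Ioc x₁ x₂, J x y = (u x₂ - u x) * v x := by
      have e2 : ∀ y, J x y = (Ioi x).indicator d y * v x := fun y => by
        simp only [hJ, indicator, mem_Iio, mem_Ioi]
        split_ifs <;> ring
      simp_rw [e2]
      rw [integral_mul_const, setIntegral_indicator measurableSet_Ioi]
      have e3 : Ioc x₁ x₂ ∩ Ioi x = Ioc x x₂ := by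
        ext y; simp only [mem_inter_iff, mem_Ioc, mem_Ioi]
        constructor
        · rintro ⟨⟨a, b⟩, c⟩; exact ⟨c, b⟩
        · rintro ⟨a, b⟩; exact ⟨⟨hx.1.trans_lt a, b⟩, a⟩
      have hf' : AbsolutelyContinuousOnInterval f x x₂ := hf.mono (by
        rw [uIcc_of_le hx.2, uIcc_of_le h12]; exact Icc_subset_Icc_left hx.1)
      rw [e3, ← intervalIntegral.integral_of_le hx.2, hf'.integral_deriv_eq_sub, huf hx,
        huf (right_mem_Icc.2 h12)]
    rw [e1, ← mul_oddPow hq]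
    simp only [hv]; ring
  have h2 : ∫ x, |u x - k| ^ q ∂m = -∫ y in Ioc x₁ x₂, d y * Φ y := by
    have e1 : ∫ x, |u x - k| ^ q ∂m = ∫ x, ((u x₂ - k) * v x - ∫ y in Ioc x₁ x₂, J x y) ∂m := by
      refine integral_congr_ae ?_
      filter_upwards [hae] with x hx using h1 x hx
    have e2 : Integrable (fun x => ∫ y in Ioc x₁ x₂, J x y) m := hJi.integral_prod_left
    rw [e1, integral_sub (hvi.const_mul _) e2, integral_const_mul, hk,
      mul_zero, zero_sub, integral_integral_swap hJi]
    congr 1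
    refine integral_congr_ae (ae_of_all _ fun y => ?_)
    simp only [hJ]
    rw [integral_mul_const, integral_indicator measurableSet_Iio, mul_comm]
  have h3 : Integrable (fun x => |u x - k| ^ q) m := by
    refine integrable_of_continuous hm ?_
    exact (continuous_abs.comp (hu.sub continuous_const)).rpow_const
      fun _ => Or.inr (by linarith)
  rw [← ofReal_integral_eq_lintegral_ofReal h3 (ae_of_all _ fun _ => by positivity), h2,
    restrict_Ioo_eq_restrict_Ioc]
  calc ENNReal.ofReal (-∫ y in Ioc x₁ x₂, d y * Φ y)
      ≤ ENNReal.ofReal |∫ y in Ioc x₁ x₂, d y * Φ y| :=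
        ENNReal.ofReal_le_ofReal (neg_le_abs _)
    _ = ‖∫ y in Ioc x₁ x₂, d y * Φ y‖ₑ := (Real.enorm_eq_ofReal_abs _).symm
    _ ≤ ∫⁻ y in Ioc x₁ x₂, ‖d y * Φ y‖ₑ := enorm_integral_le_lintegral_enorm _
    _ ≤ _ := by
        refine lintegral_mono fun y => ?_
        rw [enorm_mul, Real.enorm_eq_ofReal_abs, Real.enorm_eq_ofReal_abs]
        gcongr
        exact hΦb y

/-- The weighted Hardy inequality for functions modulo constants. -/
theorem lintegral_sub_rpow_le [NullSingletonClass m] (hE : MeasurableSet E)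
    (hσ : ContinuousOn σ E) (hpos : ∀ x ∈ E, 0 < σ x) (hsub : Icc x₁ x₂ ⊆ E) (h12 : x₁ ≤ x₂)
    (hm : m (Icc x₁ x₂)ᶜ = 0) (hf : AbsolutelyContinuousOnInterval f x₁ x₂)
    (hu : Continuous u) (huf : EqOn u f (Icc x₁ x₂))
    (hp : 1 < p) (hpq : p ≤ q) (hk : ∫ x, oddPow q (u x - k) ∂m = 0) (hB : B ≠ ∞)
    (h : ∀ x y, x ≤ y → m (Iio x) ≠ 0 → m (Ioi y) ≠ 0 →
      weightMeasure E σ (Ioo x y) ≤ B ^ p.conjExponent *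
        (m (Iio x) ^ (1 - q.conjExponent) + m (Ioi y) ^ (1 - q.conjExponent)) ^
          (p.conjExponent / q.conjExponent)) :
    ∫⁻ x, ENNReal.ofReal (|u x - k| ^ q) ∂m ≤ (2 * B *
      (∫⁻ x in E, ENNReal.ofReal (|deriv f x| ^ p * σ x ^ (1 - p))) ^ (1 / p)) ^ q := by
  have hq : 1 < q := hp.trans_le hpq
  have hp0 : 0 < p := by linarith
  have hq0 : 0 < q := by linarith
  have hpc : p.HolderConjugate p.conjExponent := Real.HolderConjugate.conjExponent hp
  have hqc : q.HolderConjugate q.conjExponent := Real.HolderConjugate.conjExponent hq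
  set p' := p.conjExponent with hp'
  set q' := q.conjExponent with hq'
  have hp'0 : 0 < p' := hpc.symm.pos
  have hq'0 : 0 < q' := hqc.symm.pos
  -- Conjugation reverses the order of the exponents, so the doubly Dirichlet inequality applies
  -- with r = q' and s = p', with m as reference measure and σ dx as target.
  have hqp' : q' ≤ p' := by
    have h1 := hpc.inv_add_inv_eq_one
    have h2 := hqc.inv_add_inv_eq_one
    have h3 : q⁻¹ ≤ p⁻¹ := inv_anti₀ hp0 hpq
    have h4 : p'⁻¹ ≤ q'⁻¹ := by linarith
    exact (inv_le_inv₀ hp'0 hq'0).1 h4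
  have hψ := continuous_oddPow hq
  set v : ℝ → ℝ := fun x => oddPow q (u x - k) with hv
  have hvc : Continuous v := by fun_prop
  have hvi : Integrable v m := integrable_of_continuous hm hvc
  set X := ∫⁻ x, ENNReal.ofReal (|u x - k| ^ q) ∂m with hX
  have hXfin : X ≠ ∞ := by
    have h3 : Integrable (fun x => |u x - k| ^ q) m := by
      refine integrable_of_continuous hm ?_
      exact (continuous_abs.comp (hu.sub continuous_const)).rpow_const
        fun _ => Or.inr (by linarith)
    exact h3.lintegral_lt_top.ne
  set φ : ℝ → ℝ≥0∞ := fun x => ENNReal.ofReal |v x| with hφ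
  have hφm : Measurable φ := by fun_prop
  have hφX : ∫⁻ x, φ x ^ q' ∂m = X := by
    refine lintegral_congr fun x => ?_
    simp only [hφ, hv]
    rw [abs_oddPow hq, ENNReal.ofReal_rpow_of_nonneg (by positivity) hq'0.le,
      ← Real.rpow_mul (abs_nonneg _), hqc.sub_one_mul_conj]
  have hφfin : ∫⁻ x, φ x ∂m ≠ ∞ := hvi.abs.lintegral_lt_top.ne
  set ρ := m.withDensity φ with hρ
  have hρfin : IsFiniteMeasure ρ := isFiniteMeasure_withDensity hφfin
  set H : ℝ → ℝ := fun y => min (ρ.real (Iio y)) (ρ.real (Ioi y)) with hH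
  have hHm : Measurable H :=
    (monotone_measureReal_Iio ρ).measurable.min (antitone_measureReal_Ioi ρ).measurable
  have hH0 : ∀ y, 0 ≤ H y := fun y => le_min measureReal_nonneg measureReal_nonneg
  -- The energy on the right of this inequality is ∫ |v|^(q') dm = X itself, since |v| =
  -- |u-k|^(q-1). Hölder's inequality therefore leads to X ≤ Q · 2B · X^(1/q').
  have hcore := lintegral_min_rpow_le (n := weightMeasure E σ) hφm hφfin hqc.symm hqp' hB h
  rw [hφX] at hcore
  have hrel := measurable_relDeriv (g := f) (y₁ := x₁) (y₂ := x₂) hE hσ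
  have h1 : X ≤ (∫⁻ x in E, ENNReal.ofReal (|deriv f x| ^ p * σ x ^ (1 - p))) ^ (1 / p) *
      (2 * B * X ^ (1 / q')) := by
    calc X ≤ ∫⁻ y in Ioo x₁ x₂, ENNReal.ofReal |deriv f y| * ENNReal.ofReal (H y) :=
          lintegral_sub_rpow_le_lintegral_deriv hq hm h12 hf hu huf hk
      _ = ∫⁻ y, ENNReal.ofReal (H y) ∂((weightMeasure E σ).withDensity
            (relDeriv E σ f x₁ x₂)) := by
          have := measurable_deriv f
          rw [withDensity_relDeriv hE hσ hpos hsub,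
            lintegral_withDensity_eq_lintegral_mul _ (by fun_prop) (by fun_prop)]
          rfl
      _ = ∫⁻ y, (relDeriv E σ f x₁ x₂ * fun y => ENNReal.ofReal (H y)) y ∂weightMeasure E σ :=
          lintegral_withDensity_eq_lintegral_mul _ hrel (by fun_prop)
      _ ≤ (∫⁻ y, relDeriv E σ f x₁ x₂ y ^ p ∂weightMeasure E σ) ^ (1 / p) *
            (∫⁻ y, ENNReal.ofReal (H y) ^ p' ∂weightMeasure E σ) ^ (1 / p') :=
          ENNReal.lintegral_mul_le_Lp_mul_Lq _ hpc hrel.aemeasurable (by fun_prop)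
      _ ≤ _ := by
          refine mul_le_mul' ?_ ?_
          · rw [lintegral_relDeriv_rpow hE hσ hpos hsub hp0]
            exact ENNReal.rpow_le_rpow (lintegral_mono_set (Ioo_subset_Icc_self.trans hsub))
              (by positivity)
          · have e0 : ∀ y, ENNReal.ofReal (H y) ^ p' = ENNReal.ofReal (H y ^ p') := fun y =>
              ENNReal.ofReal_rpow_of_nonneg (hH0 y) hp'0.le
            simp_rw [e0]
            refine (ENNReal.rpow_le_rpow hcore (by positivity)).trans (le_of_eq ?_)
            rw [← ENNReal.rpow_mul]
            have e1 : p' / q' * (1 / p') = 1 / q' := by field_simp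
            rw [e1, ENNReal.mul_rpow_of_nonneg _ _ (by positivity), ← ENNReal.rpow_mul,
              mul_one_div_cancel hq'0.ne', ENNReal.rpow_one]
  set Q := (∫⁻ x in E, ENNReal.ofReal (|deriv f x| ^ p * σ x ^ (1 - p))) ^ (1 / p) with hQ
  rcases eq_or_ne X 0 with hX0 | hX0
  · rw [hX0]; exact zero_le
  -- X is finite and nonzero here, so the factor X^(1/q') can be cancelled, leaving X^(1/q) ≤ 2BQ.
  have h2 : X ^ (1 / q) * X ^ (1 / q') ≤ (2 * B * Q) * X ^ (1 / q') := by
    rw [← ENNReal.rpow_add _ _ hX0 hXfin, one_div, one_div, hqc.inv_add_inv_eq_one,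
      ENNReal.rpow_one, ← one_div]
    calc X ≤ Q * (2 * B * X ^ (1 / q')) := h1
      _ = _ := by ring
  have h3 : X ^ (1 / q) ≤ 2 * B * Q := by
    refine (ENNReal.mul_le_mul_iff_left ?_ ?_).1 h2
    · simp [ENNReal.rpow_eq_zero_iff, hX0, hXfin]
    · simp [ENNReal.rpow_eq_top_iff, hX0, hXfin]
  have h4 := ENNReal.rpow_le_rpow h3 hq0.le
  rwa [← ENNReal.rpow_mul, one_div_mul_cancel hq0.ne', ENNReal.rpow_one] at h4

end Mean

/-! ### A common constant for two measures -/

section Minimax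

variable {D : Diffusion} {𝒢 : Set (ℝ → ℝ≥0)} {p q : ℝ}

/-- The measure `m` is dominated by `𝔹` on all functions that take one value on `(-M, x)` and
another one on `(y, N)`. -/
def SplitBound (D : Diffusion) (𝒢 : Set (ℝ → ℝ≥0)) (q : ℝ) (m : Measure ℝ) : Prop :=
  ∀ k : ℝ, ∀ x ∈ D.E, ∀ y ∈ D.E, x < y →
    ENNReal.ofReal (|k| ^ q) * m (Iio x) + ENNReal.ofReal (|1 - k| ^ q) * m (Ioi y) ≤
      normB 𝒢 D.mu fun t => (D.leftOf x).indicator (fun _ => |k| ^ q) t +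
        (D.rightOf y).indicator (fun _ => |1 - k| ^ q) t

theorem splitBound_of_le {g : ℝ → ℝ≥0} (hg : g ∈ 𝒢) {m : Measure ℝ}
    (hm : m ≤ D.mu.withDensity fun x => (g x : ℝ≥0∞)) : SplitBound D 𝒢 q m := by
  intro k x hx y hy hxy
  refine le_trans ?_ (setLIntegral_le_normB hg _)
  have hE := D.measurableSet_E
  have hn : (D.mu.withDensity fun x => (g x : ℝ≥0∞)) D.Eᶜ = 0 :=
    withDensity_absolutelyContinuous _ _ D.mu_compl
  have hl : MeasurableSet (D.leftOf x) := hE.inter measurableSet_Iio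
  have hr : MeasurableSet (D.rightOf y) := hE.inter measurableSet_Ioi
  have e : ∀ t, ‖(D.leftOf x).indicator (fun _ => |k| ^ q) t +
        (D.rightOf y).indicator (fun _ => |1 - k| ^ q) t‖ₑ * (g t : ℝ≥0∞) =
      (D.leftOf x).indicator (fun t => ENNReal.ofReal (|k| ^ q) * (g t : ℝ≥0∞)) t +
      (D.rightOf y).indicator (fun t => ENNReal.ofReal (|1 - k| ^ q) * (g t : ℝ≥0∞)) t := by
    intro t
    by_cases h1 : t ∈ D.leftOf x <;> by_cases h2 : t ∈ D.rightOf y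
    · exact absurd (h1.2.trans (hxy.trans h2.2)) (lt_irrefl _)
    · rw [indicator_of_mem h1, indicator_of_mem h1, indicator_of_notMem h2,
        indicator_of_notMem h2, add_zero, add_zero, Real.enorm_eq_ofReal (by positivity)]
    · rw [indicator_of_mem h2, indicator_of_mem h2, indicator_of_notMem h1,
        indicator_of_notMem h1, zero_add, zero_add, Real.enorm_eq_ofReal (by positivity)]
    · simp [h1, h2]
  simp_rw [e]
  have h1 := hm (D.leftOf x)
  have h2 := hm (D.rightOf y)
  have hm' : m D.Eᶜ = 0 := le_antisymm ((hm _).trans hn.le) zero_le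
  rw [D.measure_leftOf hm', withDensity_apply _ hl] at h1
  rw [D.measure_rightOf hm', withDensity_apply _ hr] at h2
  calc _ ≤ ENNReal.ofReal (|k| ^ q) * (∫⁻ t in D.leftOf x, (g t : ℝ≥0∞) ∂D.mu) +
        ENNReal.ofReal (|1 - k| ^ q) * (∫⁻ t in D.rightOf y, (g t : ℝ≥0∞) ∂D.mu) := by gcongr
    _ = ∫⁻ t, (D.leftOf x).indicator (fun t => ENNReal.ofReal (|k| ^ q) * (g t : ℝ≥0∞)) t ∂D.mu +
        ∫⁻ t, (D.rightOf y).indicator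
          (fun t => ENNReal.ofReal (|1 - k| ^ q) * (g t : ℝ≥0∞)) t ∂D.mu := by
        rw [lintegral_indicator hl, lintegral_indicator hr,
          lintegral_const_mul' _ _ ENNReal.ofReal_ne_top,
          lintegral_const_mul' _ _ ENNReal.ofReal_ne_top]
    _ ≤ _ := le_lintegral_add _ _

/-- Forming convex hulls costs nothing in the isoperimetric constant. This is what permits a minimax
argument that mixes two measures. -/
theorem SplitBound.convex {m₁ m₂ : Measure ℝ} (h₁ : SplitBound D 𝒢 q m₁)
    (h₂ : SplitBound D 𝒢 q m₂) {s t : ℝ≥0∞} (hst : s + t = 1) :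
    SplitBound D 𝒢 q (s • m₁ + t • m₂) := by
  intro k x hx y hy hxy
  have e1 := h₁ k x hx y hy hxy
  have e2 := h₂ k x hx y hy hxy
  simp only [Measure.add_apply, Measure.smul_apply, smul_eq_mul]
  set S := normB 𝒢 D.mu fun t => (D.leftOf x).indicator (fun _ => |k| ^ q) t +
        (D.rightOf y).indicator (fun _ => |1 - k| ^ q) t
  calc _ = s * (ENNReal.ofReal (|k| ^ q) * m₁ (Iio x) + ENNReal.ofReal (|1 - k| ^ q) * m₁ (Ioi y)) +
        t * (ENNReal.ofReal (|k| ^ q) * m₂ (Iio x) + ENNReal.ofReal (|1 - k| ^ q) * m₂ (Ioi y)) := by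
        ring
    _ ≤ s * S + t * S := by gcongr
    _ = S := by rw [← add_mul, hst, one_mul]

/-- Minimizing the split bound over k, with the explicit minimum of `iInf_rpow_mul_add_eq`, turns B
for 𝔹 into the isoperimetric hypothesis for the single measure m. Rewritten with the conjugate
exponents it is the form needed by `lintegral_sub_rpow_le`. -/
theorem weightMeasure_Ioo_le_of_splitBound (hp : 1 < p) (hq : 1 < q) {m : Measure ℝ}
    [IsFiniteMeasure m] (h : SplitBound D 𝒢 q m) (hB : D.hardyIsoB 𝒢 p q Boundary.NN ≠ ∞)
    {x y : ℝ} (hx : x ∈ D.E) (hy : y ∈ D.E) (hxy : x < y) (hmx : m (Iio x) ≠ 0)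
    (hmy : m (Ioi y) ≠ 0) :
    weightMeasure D.E (D.scaleDensity p) (Ioo x y) ≤
      D.hardyIsoB 𝒢 p q Boundary.NN ^ p.conjExponent *
        (m (Iio x) ^ (1 - q.conjExponent) + m (Ioi y) ^ (1 - q.conjExponent)) ^
          (p.conjExponent / q.conjExponent) := by
  set B := D.hardyIsoB 𝒢 p q Boundary.NN with hBdef
  have hpc : p.HolderConjugate p.conjExponent := Real.HolderConjugate.conjExponent hp
  have hqc : q.HolderConjugate q.conjExponent := Real.HolderConjugate.conjExponent hq
  have hp1 : 0 < p - 1 := by linarith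
  have hq1 : 0 < q - 1 := by linarith
  have hp' : p.conjExponent = p / (p - 1) := rfl
  have hq' : q.conjExponent = q / (q - 1) := rfl
  have e1 : 1 - q.conjExponent = -(1 / (q - 1)) := by rw [hq']; field_simp; ring
  rw [← D.nuHat_eq, e1]
  set T := m (Iio x) ^ (-(1 / (q - 1))) + m (Ioi y) ^ (-(1 / (q - 1))) with hT
  have hTtop : T ≠ ∞ := by
    simp [hT, hmx, hmy]
  have h1 : D.nuHat p (Ioo x y) ^ ((p - 1) / p) * (T ^ (-(q - 1))) ^ (1 / q) ≤ B := by
    refine le_trans ?_ (le_iSup₂_of_le (f := fun x _ => ⨆ y ∈ D.E, ⨆ _ : x < y,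
      D.nuHat p (Ioo x y) ^ ((p - 1) / p) * (⨅ k : ℝ, normB 𝒢 D.mu (fun t =>
          (D.leftOf x).indicator (fun _ => |k| ^ q) t +
          (D.rightOf y).indicator (fun _ => |1 - k| ^ q) t)) ^ (1 / q)) x hx
      (le_iSup₂_of_le y hy (le_iSup_of_le hxy le_rfl)))
    rw [hT, ← iInf_rpow_mul_add_eq hq]
    gcongr with k
    exact h k x hx y hy hxy
  rw [← ENNReal.rpow_mul] at h1
  have h2 : D.nuHat p (Ioo x y) ^ ((p - 1) / p) / T ^ (1 / q.conjExponent) ≤ B := by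
    have : -(q - 1) * (1 / q) = -(1 / q.conjExponent) := by rw [hq']; field_simp
    rwa [this, ENNReal.rpow_neg, ← div_eq_mul_inv] at h1
  have e3 : (p - 1) / p = 1 / p.conjExponent := by rw [hp']; field_simp
  rw [e3] at h2
  exact le_of_rpow_div_le hpc.symm.pos hqc.symm.pos hTtop hB h2

variable {x₁ x₂ : ℝ} {f u : ℝ → ℝ}

theorem lintegral_sub_rpow_le_of_splitBound {m : Measure ℝ} [IsFiniteMeasure m]
    [NullSingletonClass m] (hp : 1 < p) (hpq : p ≤ q) (h₁ : x₁ ∈ D.E) (h₂ : x₂ ∈ D.E)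
    (h12 : x₁ ≤ x₂) (hm : m (Icc x₁ x₂)ᶜ = 0) (hf : LocAC f D.E) (hu : Continuous u)
    (huf : EqOn u f (Icc x₁ x₂)) (h : SplitBound D 𝒢 q m)
    (hB : D.hardyIsoB 𝒢 p q Boundary.NN ≠ ∞) {k : ℝ} (hk : ∫ x, oddPow q (u x - k) ∂m = 0) :
    ∫⁻ x, ENNReal.ofReal (|u x - k| ^ q) ∂m ≤
      (2 * D.hardyIsoB 𝒢 p q Boundary.NN * eLpNorm (deriv f) (ENNReal.ofReal p) D.nu) ^ q := by
  have hsub := D.Icc_subset_E h₁ h₂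
  have := lintegral_sub_rpow_le D.measurableSet_E (D.continuousOn_scaleDensity p)
    (fun x _ => D.scaleDensity_pos p x) hsub h12 hm (hf _ h₁ _ h₂) hu huf hp hpq hk hB ?_
  · simp_rw [D.scaleDensity_rpow hp] at this
    rwa [D.eLpNorm_nu _ (by linarith)]
  · intro x y hxy hx hy
    rcases hxy.eq_or_lt with rfl | hxy
    · simp
    have hx₁ : x₁ < x := by
      by_contra! hc
      have : Iio x ⊆ (Icc x₁ x₂)ᶜ := fun z hz hz' => (hz.trans_le hc).not_ge hz'.1
      exact hx (measure_mono_null this hm)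
    have hy₂ : y < x₂ := by
      by_contra! hc
      have : Ioi y ⊆ (Icc x₁ x₂)ᶜ := fun z hz hz' => (hc.trans_lt hz).not_ge hz'.2
      exact hy (measure_mono_null this hm)
    exact weightMeasure_Ioo_le_of_splitBound hp (hp.trans_le hpq) h hB
      (hsub ⟨hx₁.le, (hxy.trans hy₂).le⟩) (hsub ⟨(hx₁.trans hxy).le, hy₂.le⟩) hxy hx hy

theorem continuous_abs_sub_rpow (hq : 0 < q) (hu : Continuous u) :
    Continuous (Function.uncurry fun k x => |u x - k| ^ q) := by
  have : Continuous fun z : ℝ × ℝ => |u z.2 - z.1| := by fun_prop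
  exact this.rpow_const fun _ => Or.inr hq.le

theorem lintegral_abs_sub_rpow_eq {m : Measure ℝ} [IsFiniteMeasure m] (hq : 0 < q)
    (hm : m (Icc x₁ x₂)ᶜ = 0) (hu : Continuous u) (k : ℝ) :
    ∫⁻ x, ENNReal.ofReal (|u x - k| ^ q) ∂m = ENNReal.ofReal (∫ x, |u x - k| ^ q ∂m) := by
  have h : Continuous fun x => |u x - k| ^ q := (continuous_abs_sub_rpow hq hu).comp
    (by fun_prop : Continuous fun x : ℝ => (k, x))
  rw [ofReal_integral_eq_lintegral_ofReal (integrable_of_continuous hm h)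
    (ae_of_all _ fun _ => by positivity)]

theorem isClosed_sublevel {m : Measure ℝ} [IsFiniteMeasure m] (hq : 0 < q) (hm : m (Icc x₁ x₂)ᶜ = 0)
    (hu : Continuous u) (c : ℝ≥0∞) :
    IsClosed {k | ∫⁻ x, ENNReal.ofReal (|u x - k| ^ q) ∂m ≤ c} := by
  simp_rw [lintegral_abs_sub_rpow_eq hq hm hu]
  exact isClosed_le (ENNReal.continuous_ofReal.comp
    (continuous_integral hm (continuous_abs_sub_rpow hq hu))) continuous_const

/-- For two measures, a common constant `k`. -/
theorem exists_common_of_le {m₁ m₂ : Measure ℝ} [IsFiniteMeasure m₁] [IsFiniteMeasure m₂]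
    [NullSingletonClass m₁] [NullSingletonClass m₂] (hp : 1 < p) (hpq : p ≤ q)
    (h₁ : x₁ ∈ D.E) (h₂ : x₂ ∈ D.E) (h12 : x₁ ≤ x₂) (hm₁ : m₁ (Icc x₁ x₂)ᶜ = 0)
    (hm₂ : m₂ (Icc x₁ x₂)ᶜ = 0) (hf : LocAC f D.E) (hu : Continuous u)
    (huf : EqOn u f (Icc x₁ x₂)) (hs₁ : SplitBound D 𝒢 q m₁) (hs₂ : SplitBound D 𝒢 q m₂)
    (hB : D.hardyIsoB 𝒢 p q Boundary.NN ≠ ∞) {c : ℝ≥0∞}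
    (hc : c = (2 * D.hardyIsoB 𝒢 p q Boundary.NN *
      eLpNorm (deriv f) (ENNReal.ofReal p) D.nu) ^ q)
    {k₁ k₂ : ℝ} (hk : k₁ ≤ k₂) (hk₁ : ∫ x, oddPow q (u x - k₁) ∂m₁ = 0)
    (hk₂ : ∫ x, oddPow q (u x - k₂) ∂m₂ = 0) :
    ∃ k, ∫⁻ x, ENNReal.ofReal (|u x - k| ^ q) ∂m₁ ≤ c ∧
      ∫⁻ x, ENNReal.ofReal (|u x - k| ^ q) ∂m₂ ≤ c := by
  have hq : 1 < q := hp.trans_le hpq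
  have hq0 : 0 < q := by linarith
  have hψ := continuous_oddPow hq
  -- Every k between the two q-means is the q-mean of some convex combination of m₁ and m₂. The
  -- bound c for the combination is a bound for a weighted average, so at least one of the two
  -- integrals at k is at most c.
  have key : Icc k₁ k₂ ⊆ {k | ∫⁻ x, ENNReal.ofReal (|u x - k| ^ q) ∂m₁ ≤ c} ∪
      {k | ∫⁻ x, ENNReal.ofReal (|u x - k| ^ q) ∂m₂ ≤ c} := by
    intro k hkm
    have hi : ∀ m : Measure ℝ, IsFiniteMeasure m → m (Icc x₁ x₂)ᶜ = 0 → ∀ k,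
        Integrable (fun x => oddPow q (u x - k)) m := fun m _ hm k =>
      integrable_of_continuous hm (by fun_prop)
    set G₁ := ∫ x, oddPow q (u x - k) ∂m₁ with hG₁
    set G₂ := ∫ x, oddPow q (u x - k) ∂m₂ with hG₂
    have hG₁0 : G₁ ≤ 0 := by
      rw [← hk₁]
      exact integral_mono (hi _ inferInstance hm₁ _) (hi _ inferInstance hm₁ _)
        fun x => monotone_oddPow hq (by linarith [hkm.1])
    have hG₂0 : 0 ≤ G₂ := by
      rw [← hk₂]
      exact integral_mono (hi _ inferInstance hm₂ _) (hi _ inferInstance hm₂ _)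
        fun x => monotone_oddPow hq (by linarith [hkm.2])
    -- By monotonicity G₁ ≤ 0 ≤ G₂, so the weights can be chosen to balance them; when G₁ = G₂ both
    -- are zero and any weights do.
    obtain ⟨s, t, hs, ht, hst, hG⟩ : ∃ s t : ℝ, 0 ≤ s ∧ 0 ≤ t ∧ s + t = 1 ∧
        s * G₁ + t * G₂ = 0 := by
      rcases (sub_nonneg.2 (hG₁0.trans hG₂0)).eq_or_lt with h0 | h0
      · exact ⟨1, 0, by norm_num, le_rfl, by norm_num, by linarith⟩
      · refine ⟨G₂ / (G₂ - G₁), -G₁ / (G₂ - G₁), by positivity,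
          div_nonneg (by linarith) h0.le, ?_, ?_⟩ <;> field_simp <;> ring
    have hst' : ENNReal.ofReal s + ENNReal.ofReal t = 1 := by
      rw [← ENNReal.ofReal_add hs ht, hst, ENNReal.ofReal_one]
    set m := ENNReal.ofReal s • m₁ + ENNReal.ofReal t • m₂ with hmdef
    have : IsFiniteMeasure (ENNReal.ofReal s • m₁) := Measure.smul_finite _ ENNReal.ofReal_ne_top
    have : IsFiniteMeasure (ENNReal.ofReal t • m₂) := Measure.smul_finite _ ENNReal.ofReal_ne_top
    have : IsFiniteMeasure m := inferInstanceAs (IsFiniteMeasure (_ + _))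
    have : NullSingletonClass m := ⟨fun x => by simp [hmdef]⟩
    have hm : m (Icc x₁ x₂)ᶜ = 0 := by simp [hmdef, hm₁, hm₂]
    have hroot : ∫ x, oddPow q (u x - k) ∂m = 0 := by
      rw [hmdef, integral_add_measure
        ((hi _ inferInstance hm₁ _).smul_measure ENNReal.ofReal_ne_top)
        ((hi _ inferInstance hm₂ _).smul_measure ENNReal.ofReal_ne_top),
        integral_smul_measure, integral_smul_measure, ENNReal.toReal_ofReal hs,
        ENNReal.toReal_ofReal ht]
      exact hG
    have hle := lintegral_sub_rpow_le_of_splitBound hp hpq h₁ h₂ h12 hm hf hu huf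
      (hs₁.convex hs₂ hst') hB hroot
    rw [← hc, hmdef, lintegral_add_measure, lintegral_smul_measure, lintegral_smul_measure] at hle
    by_contra! hcon
    simp only [mem_union, mem_ofPred_eq, not_or, not_le] at hcon
    have hlt : c < ENNReal.ofReal s * (∫⁻ x, ENNReal.ofReal (|u x - k| ^ q) ∂m₁) +
        ENNReal.ofReal t * (∫⁻ x, ENNReal.ofReal (|u x - k| ^ q) ∂m₂) := by
      have hmin := lt_min hcon.1 hcon.2
      refine hmin.trans_le ?_
      calc _ = (ENNReal.ofReal s + ENNReal.ofReal t) * min _ _ := by rw [hst', one_mul]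
        _ = ENNReal.ofReal s * min _ _ + ENNReal.ofReal t * min _ _ := add_mul _ _ _
        _ ≤ _ := add_le_add (mul_le_mul_right (min_le_left _ _) _)
            (mul_le_mul_right (min_le_right _ _) _)
    exact absurd hle hlt.not_ge
  -- Two closed sets cover the connected interval [k₁, k₂], and each contains the q-mean of its own
  -- measure, so they meet.
  obtain ⟨k, -, ha, hb⟩ := isPreconnected_closed_iff.1 (isPreconnected_Icc (a := k₁) (b := k₂))
    _ _ (isClosed_sublevel hq0 hm₁ hu c) (isClosed_sublevel hq0 hm₂ hu c) key
    ⟨k₁, left_mem_Icc.2 hk, by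
      have := lintegral_sub_rpow_le_of_splitBound hp hpq h₁ h₂ h12 hm₁ hf hu huf hs₁ hB hk₁
      rwa [← hc] at this⟩
    ⟨k₂, right_mem_Icc.2 hk, by
      have := lintegral_sub_rpow_le_of_splitBound hp hpq h₁ h₂ h12 hm₂ hf hu huf hs₂ hB hk₂
      rwa [← hc] at this⟩
  exact ⟨k, ha, hb⟩

theorem exists_common {m₁ m₂ : Measure ℝ} [IsFiniteMeasure m₁] [IsFiniteMeasure m₂]
    [NullSingletonClass m₁] [NullSingletonClass m₂] (hp : 1 < p) (hpq : p ≤ q)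
    (h₁ : x₁ ∈ D.E) (h₂ : x₂ ∈ D.E) (h12 : x₁ ≤ x₂) (hm₁ : m₁ (Icc x₁ x₂)ᶜ = 0)
    (hm₂ : m₂ (Icc x₁ x₂)ᶜ = 0) (hf : LocAC f D.E) (hs₁ : SplitBound D 𝒢 q m₁)
    (hs₂ : SplitBound D 𝒢 q m₂) (hB : D.hardyIsoB 𝒢 p q Boundary.NN ≠ ∞) {c : ℝ≥0∞}
    (hc : c = (2 * D.hardyIsoB 𝒢 p q Boundary.NN *
      eLpNorm (deriv f) (ENNReal.ofReal p) D.nu) ^ q) :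
    ∃ k, ∫⁻ x, ENNReal.ofReal (|f x - k| ^ q) ∂m₁ ≤ c ∧
      ∫⁻ x, ENNReal.ofReal (|f x - k| ^ q) ∂m₂ ≤ c := by
  have hq : 1 < q := hp.trans_le hpq
  set u : ℝ → ℝ := IccExtend h12 (domRestrict (Icc x₁ x₂) f) with hu_def
  have hu : Continuous u :=
    ((hf.continuousOn.mono (D.Icc_subset_E h₁ h₂)).domRestrict).Icc_extend'
  have huf : EqOn u f (Icc x₁ x₂) := fun x hx => by
    rw [hu_def, IccExtend_of_mem h12 _ hx]; rfl
  have hcongr : ∀ m : Measure ℝ, m (Icc x₁ x₂)ᶜ = 0 → ∀ k,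
      ∫⁻ x, ENNReal.ofReal (|f x - k| ^ q) ∂m = ∫⁻ x, ENNReal.ofReal (|u x - k| ^ q) ∂m := by
    intro m hm k
    refine lintegral_congr_ae ?_
    filter_upwards [mem_ae_iff.2 hm] with x hx
    rw [huf hx]
  simp_rw [hcongr m₁ hm₁, hcongr m₂ hm₂]
  obtain ⟨k₁, hk₁⟩ := exists_integral_oddPow_eq_zero hq hm₁ hu
  obtain ⟨k₂, hk₂⟩ := exists_integral_oddPow_eq_zero hq hm₂ hu
  rcases le_total k₁ k₂ with hk | hk
  · exact exists_common_of_le hp hpq h₁ h₂ h12 hm₁ hm₂ hf hu huf hs₁ hs₂ hB hc hk hk₁ hk₂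
  · obtain ⟨k, ha, hb⟩ :=
      exists_common_of_le hp hpq h₁ h₂ h12 hm₂ hm₁ hf hu huf hs₂ hs₁ hB hc hk hk₂ hk₁
    exact ⟨k, hb, ha⟩

end Minimax
-- One constant for the whole family: Helly's theorem
section Sublevel

variable {D : Diffusion} {𝒢 : Set (ℝ → ℝ≥0)} {p q : ℝ} {x₁ x₂ : ℝ} {f u : ℝ → ℝ} {m : Measure ℝ}

theorem convex_sublevel (hq : 1 ≤ q) (hu : Continuous u) (c : ℝ≥0∞) :
    Convex ℝ {k | ∫⁻ x, ENNReal.ofReal (|u x - k| ^ q) ∂m ≤ c} := by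
  intro k hk l hl s t hs ht hst
  have hpt : ∀ x, ENNReal.ofReal (|u x - (s * k + t * l)| ^ q) ≤
      ENNReal.ofReal s * ENNReal.ofReal (|u x - k| ^ q) +
        ENNReal.ofReal t * ENNReal.ofReal (|u x - l| ^ q) := by
    intro x
    rw [← ENNReal.ofReal_mul hs, ← ENNReal.ofReal_mul ht,
      ← ENNReal.ofReal_add (by positivity) (by positivity)]
    refine ENNReal.ofReal_le_ofReal ?_
    have h1 : |u x - (s * k + t * l)| ≤ s * |u x - k| + t * |u x - l| := by
      have : u x - (s * k + t * l) = s * (u x - k) + t * (u x - l) := by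
        linear_combination - (u x) * hst
      rw [this]
      refine (abs_add_le _ _).trans (le_of_eq ?_)
      rw [abs_mul, abs_mul, abs_of_nonneg hs, abs_of_nonneg ht]
    refine (Real.rpow_le_rpow (abs_nonneg _) h1 (by linarith)).trans ?_
    exact (convexOn_rpow hq).2 (abs_nonneg (u x - k)) (abs_nonneg (u x - l)) hs ht hst
  have hmeas : ∀ k, Measurable fun x => ENNReal.ofReal (|u x - k| ^ q) := fun k => by
    have := hu.measurable
    fun_prop
  simp only [mem_ofPred_eq, smul_eq_mul] at hk hl ⊢
  calc _ ≤ ∫⁻ x, (ENNReal.ofReal s * ENNReal.ofReal (|u x - k| ^ q) +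
        ENNReal.ofReal t * ENNReal.ofReal (|u x - l| ^ q)) ∂m := lintegral_mono hpt
    _ = ENNReal.ofReal s * (∫⁻ x, ENNReal.ofReal (|u x - k| ^ q) ∂m) +
        ENNReal.ofReal t * (∫⁻ x, ENNReal.ofReal (|u x - l| ^ q) ∂m) := by
        rw [lintegral_add_left ((hmeas k).const_mul _), lintegral_const_mul _ (hmeas k),
          lintegral_const_mul _ (hmeas l)]
    _ ≤ ENNReal.ofReal s * c + ENNReal.ofReal t * c :=
        add_le_add (mul_le_mul_right hk _) (mul_le_mul_right hl _)
    _ = c := by rw [← add_mul, ← ENNReal.ofReal_add hs ht, hst, ENNReal.ofReal_one, one_mul]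

/-- If |u| ≤ R on the carrier of m and |k| > 2R, then |u-k| ≥ |k|/2 there, so the integral grows
like |k|^q times the nonzero mass of m. -/
theorem isBounded_sublevel [IsFiniteMeasure m] (hq : 0 < q) (hm : m (Icc x₁ x₂)ᶜ = 0)
    (hm0 : m ≠ 0) (hu : Continuous u) {c : ℝ≥0∞} (hc : c ≠ ∞) :
    Bornology.IsBounded {k | ∫⁻ x, ENNReal.ofReal (|u x - k| ^ q) ∂m ≤ c} := by
  obtain ⟨R, hR⟩ := isCompact_Icc.exists_bound_of_continuousOn (hu.continuousOn (s := Icc x₁ x₂))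
  have hmu : m univ ≠ 0 := by rwa [Ne, Measure.measure_univ_eq_zero]
  set T := (c / m univ).toReal with hT
  refine (Metric.isBounded_closedBall (x := (0 : ℝ)) (r := max (2 * R) (2 * T ^ (1 / q)))).subset ?_
  intro k hk
  rw [mem_closedBall_zero_iff, Real.norm_eq_abs]
  by_contra! hcon
  obtain ⟨h1, h2⟩ := max_lt_iff.1 hcon
  have h3 : ENNReal.ofReal ((|k| / 2) ^ q) * m univ ≤ c := by
    refine le_trans ?_ hk
    rw [← lintegral_const]
    refine lintegral_mono_ae ?_
    filter_upwards [mem_ae_iff.2 hm] with x hx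
    refine ENNReal.ofReal_le_ofReal (Real.rpow_le_rpow (by positivity) ?_ hq.le)
    have := hR x hx
    rw [Real.norm_eq_abs] at this
    have h4 := abs_sub_abs_le_abs_sub k (u x)
    rw [abs_sub_comm] at h4
    linarith
  have h4 : ENNReal.ofReal ((|k| / 2) ^ q) ≤ c / m univ :=
    (ENNReal.le_div_iff_mul_le (Or.inl hmu) (Or.inl (measure_ne_top _ _))).2 h3
  have h5 : (|k| / 2) ^ q ≤ T :=
    (ENNReal.ofReal_le_iff_le_toReal (ENNReal.div_ne_top hc hmu)).1 h4
  have h6 : |k| / 2 ≤ T ^ (1 / q) := by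
    have := Real.rpow_le_rpow (by positivity) h5 (by positivity : 0 ≤ 1 / q)
    rwa [← Real.rpow_mul (by positivity), mul_one_div_cancel hq.ne', Real.rpow_one] at this
  linarith

theorem mu_Icc_ne_top (hx : x₁ ∈ D.E) (hy : x₂ ∈ D.E) : D.mu (Icc x₁ x₂) ≠ ∞ := by
  rcases lt_or_ge x₂ x₁ with h | h
  · simp [Icc_eq_empty_of_lt h]
  have hsub := D.Icc_subset_E hx hy
  have h1 : IntegrableOn (fun t => Real.exp (D.C t) * (1 / D.a t)) (Icc x₁ x₂) := by
    refine IntegrableOn.continuousOn_mul (D.continuousOn_exp_C.mono hsub) ?_ isCompact_Icc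
    exact (intervalIntegrable_iff_integrableOn_Icc_of_le h).1 (D.intervalIntegrable_inv_a hx hy)
  have h2 : D.mu (Icc x₁ x₂) =
      ∫⁻ t in Icc x₁ x₂, ENNReal.ofReal (Real.exp (D.C t) / D.a t) := by
    rw [Diffusion.mu, withDensity_apply _ measurableSet_Icc,
      Measure.restrict_restrict measurableSet_Icc, inter_eq_left.2 hsub]
  rw [h2]
  refine ((lintegral_mono fun t => ?_).trans_lt h1.2).ne
  rw [← mul_one_div]
  exact Real.ofReal_le_enorm _

/-- The restriction of `g μ` to a compact interval and a sublevel set of `g`. -/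
noncomputable def truncMeasure (D : Diffusion) (g : ℝ → ℝ≥0) (x₁ x₂ : ℝ) (n : ℕ) : Measure ℝ :=
  (D.mu.withDensity fun x => (g x : ℝ≥0∞)).restrict (Icc x₁ x₂ ∩ {x | g x ≤ n})

theorem measurableSet_trunc {g : ℝ → ℝ≥0} (hg : Measurable g) (n : ℕ) :
    MeasurableSet (Icc x₁ x₂ ∩ {x | g x ≤ n}) :=
  measurableSet_Icc.inter (measurableSet_le hg measurable_const)

theorem isFiniteMeasure_truncMeasure {g : ℝ → ℝ≥0} (hg : Measurable g) (hx : x₁ ∈ D.E)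
    (hy : x₂ ∈ D.E) (n : ℕ) : IsFiniteMeasure (truncMeasure D g x₁ x₂ n) := by
  refine ⟨?_⟩
  rw [truncMeasure, Measure.restrict_apply_univ, withDensity_apply _ (measurableSet_trunc hg n)]
  calc _ ≤ ∫⁻ _ in Icc x₁ x₂ ∩ {x | g x ≤ n}, (n : ℝ≥0∞) ∂D.mu := by
        refine setLIntegral_mono measurable_const fun t ht => ?_
        have := ht.2
        exact_mod_cast this
    _ = n * D.mu (Icc x₁ x₂ ∩ {x | g x ≤ n}) := setLIntegral_const _ _
    _ < ∞ := ENNReal.mul_lt_top (by simp)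
        ((measure_mono inter_subset_left).trans_lt (mu_Icc_ne_top hx hy).lt_top)

instance (D : Diffusion) : NullSingletonClass D.mu := by
  rw [D.mu_eq]; infer_instance

theorem nullSingletonClass_truncMeasure (g : ℝ → ℝ≥0) (n : ℕ) :
    NullSingletonClass (truncMeasure D g x₁ x₂ n) := by
  have := nullSingletonClass_withDensity (m := D.mu) fun x => (g x : ℝ≥0∞)
  rw [truncMeasure]; infer_instance

theorem truncMeasure_compl {g : ℝ → ℝ≥0} {y₁ y₂ : ℝ} (h : Icc x₁ x₂ ⊆ Icc y₁ y₂) (n : ℕ) :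
    truncMeasure D g x₁ x₂ n (Icc y₁ y₂)ᶜ = 0 := by
  rw [truncMeasure, Measure.restrict_apply measurableSet_Icc.compl]
  refine measure_mono_null (t := ∅) (fun x hx => hx.1 (h hx.2.1)) measure_empty

/-- This exchanges the supremum over g with the infimum over k. Truncating g μ in space and height
gives finite measures with compact carrier, for which the admissible k form compact convex subsets
of the line; any two of them meet by `exists_common`. -/
theorem exists_normB_sub_le (h𝒢 : ∀ g ∈ 𝒢, Measurable g) (hp : 1 < p) (hpq : p ≤ q)
    (hf : LocAC f D.E) (hB : D.hardyIsoB 𝒢 p q Boundary.NN ≠ ∞) {c : ℝ≥0∞}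
    (hc : c = (2 * D.hardyIsoB 𝒢 p q Boundary.NN *
      eLpNorm (deriv f) (ENNReal.ofReal p) D.nu) ^ q) (hctop : c ≠ ∞) :
    ∃ k, normB 𝒢 D.mu (fun x => |f x - k| ^ q) ≤ c := by
  have hq : 1 < q := hp.trans_le hpq
  classical
  have hq0 : 0 < q := by linarith
  obtain ⟨v, hv, hvE, hv'⟩ := D.exists_seq_left
  obtain ⟨w, hw, hwE, hw'⟩ := D.exists_seq_right
  have hmono : ∀ {i j : ℕ}, i ≤ j → Icc (v i) (w i) ⊆ Icc (v j) (w j) := fun h =>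
    Icc_subset_Icc (hv h) (hw h)
  -- Zero truncations are left out: their sublevel set is the whole line, which is not compact, and
  -- they impose no condition on k.
  set ι := {z : (ℝ → ℝ≥0) × ℕ // z.1 ∈ 𝒢 ∧ truncMeasure D z.1 (v z.2) (w z.2) z.2 ≠ 0}
  let m : ι → Measure ℝ := fun z => truncMeasure D z.1.1 (v z.1.2) (w z.1.2) z.1.2
  have hfin : ∀ z, IsFiniteMeasure (m z) := fun z =>
    isFiniteMeasure_truncMeasure (h𝒢 _ z.2.1) (hvE _) (hwE _) _
  have hns : ∀ z, NullSingletonClass (m z) := fun z => nullSingletonClass_truncMeasure _ _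
  have hcompl : ∀ z, m z (Icc (v z.1.2) (w z.1.2))ᶜ = 0 := fun z =>
    truncMeasure_compl subset_rfl _
  have hne : ∀ z : ι, v z.1.2 ≤ w z.1.2 := by
    intro z
    by_contra! hcon
    refine z.2.2 (Measure.measure_univ_eq_zero.1 ?_)
    have := hcompl z
    rwa [Icc_eq_empty_of_lt hcon, compl_empty] at this
  have hsplit : ∀ z, SplitBound D 𝒢 q (m z) := fun z =>
    splitBound_of_le z.2.1 Measure.restrict_le_self
  set X : ι → Set ℝ := fun z => {k | ∫⁻ x, ENNReal.ofReal (|f x - k| ^ q) ∂(m z) ≤ c} with hX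
  have hXu : ∀ z, ∃ u : ℝ → ℝ, Continuous u ∧
      X z = {k | ∫⁻ x, ENNReal.ofReal (|u x - k| ^ q) ∂(m z) ≤ c} := by
    intro z
    refine ⟨IccExtend (hne z) (domRestrict (Icc _ _) f),
      ((hf.continuousOn.mono (D.Icc_subset_E (hvE _) (hwE _))).domRestrict).Icc_extend', ?_⟩
    ext k
    simp only [hX, mem_ofPred_eq]
    rw [lintegral_congr_ae]
    filter_upwards [mem_ae_iff.2 (hcompl z)] with x hx
    rw [IccExtend_of_mem (hne z) _ hx]; rfl
  have hconv : ∀ z, Convex ℝ (X z) := fun z => by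
    obtain ⟨u, hu, h⟩ := hXu z
    rw [h]; exact convex_sublevel hq.le hu c
  have hcomp : ∀ z, IsCompact (X z) := fun z => by
    obtain ⟨u, hu, h⟩ := hXu z
    rw [h]
    exact Metric.isCompact_of_isClosed_isBounded (isClosed_sublevel hq0 (hcompl z) hu c)
      (isBounded_sublevel hq0 (hcompl z) z.2.2 hu hctop)
  have hpair : ∀ z₁ z₂, ∃ k, k ∈ X z₁ ∧ k ∈ X z₂ := by
    intro z₁ z₂
    set N := max z₁.1.2 z₂.1.2
    have hN₁ := hmono (le_max_left z₁.1.2 z₂.1.2)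
    have hN₂ := hmono (le_max_right z₁.1.2 z₂.1.2)
    have hvw : v N ≤ w N := by
      have := hN₁ (left_mem_Icc.2 (hne z₁))
      exact this.1.trans this.2
    exact exists_common hp hpq (hvE N) (hwE N) hvw (truncMeasure_compl hN₁ _)
      (truncMeasure_compl hN₂ _) hf (hsplit z₁) (hsplit z₂) hB hc
  obtain ⟨k, hk⟩ : (⋂ z, X z).Nonempty := by
    -- In dimension one Helly's theorem requires only subfamilies with at most two members.
    refine Convex.helly_theorem_compact' (𝕜 := ℝ) hconv hcomp fun I hI => ?_
    rw [Module.finrank_self] at hI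
    rcases Nat.lt_or_ge I.card 2 with h1 | h1
    · rcases I.eq_empty_or_nonempty with rfl | hI'
      · simp
      · obtain ⟨z, rfl⟩ := Finset.card_eq_one.1 (show I.card = 1 by
          have := hI'.card_pos; omega)
        obtain ⟨k, hk, -⟩ := hpair z z
        exact ⟨k, by simpa using hk⟩
    · obtain ⟨z₁, z₂, -, rfl⟩ := Finset.card_eq_two.1 (le_antisymm hI h1)
      obtain ⟨k, hk₁, hk₂⟩ := hpair z₁ z₂
      exact ⟨k, by simpa using ⟨hk₁, hk₂⟩⟩
  refine ⟨k, iSup₂_le fun g hg => ?_⟩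
  have hgm := h𝒢 g hg
  have hall : ∀ n, ∫⁻ x, ENNReal.ofReal (|f x - k| ^ q) ∂(truncMeasure D g (v n) (w n) n) ≤ c := by
    intro n
    by_cases h0 : truncMeasure D g (v n) (w n) n = 0
    · rw [h0, lintegral_zero_measure]; exact zero_le
    · exact mem_iInter.1 hk ⟨(g, n), hg, h0⟩
  set n := D.mu.withDensity fun x => (g x : ℝ≥0∞) with hn_def
  have hn : n D.Eᶜ = 0 := withDensity_absolutelyContinuous _ _ D.mu_compl
  have e : ∫⁻ x, ‖|f x - k| ^ q‖ₑ * (g x : ℝ≥0∞) ∂D.mu =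
      ∫⁻ x, ENNReal.ofReal (|f x - k| ^ q) ∂n := by
    rw [hn_def, lintegral_withDensity_coe hgm]
    refine lintegral_congr fun x => ?_
    rw [Real.enorm_eq_ofReal (by positivity)]
  set S : ℕ → Set ℝ := fun j => Icc (v j) (w j) ∩ {x | g x ≤ j} with hS
  have hSmono : Monotone S := fun i j hij =>
    inter_subset_inter (hmono hij) fun x (hx : g x ≤ i) => (hx.trans (by exact_mod_cast hij) : g x ≤ j)
  have hSE : D.E ⊆ ⋃ j, S j := by
    intro x hx
    obtain ⟨i, hi⟩ := hv' x hx
    obtain ⟨j, hj⟩ := hw' x hx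
    obtain ⟨l, hl⟩ := exists_nat_ge (g x)
    refine mem_iUnion.2 ⟨max l (max i j), ⟨?_, ?_⟩, ?_⟩
    · exact (hv ((le_max_left i j).trans (le_max_right l _))).trans hi.le
    · exact hj.le.trans (hw ((le_max_right i j).trans (le_max_right l _)))
    · exact hl.trans (by exact_mod_cast le_max_left l _)
  have hrestr : n.restrict (⋃ j, S j) = n :=
    Measure.restrict_eq_self_of_ae_mem (mem_ae_iff.2
      (measure_mono_null (compl_subset_compl.2 hSE) hn))
  -- The truncation sets increase and cover E, so the uniform bound for the truncations passes to g
  -- μ itself.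
  rw [e, ← hrestr, setLIntegral_iUnion_of_directed _ hSmono.directed_le]
  exact iSup_le hall

theorem hardyConstB_NN_le (h𝒢 : ∀ g ∈ 𝒢, Measurable g) (hp : 1 < p) (hpq : p ≤ q) :
    D.hardyConstB 𝒢 p q Boundary.NN ≤ 2 * D.hardyIsoB 𝒢 p q Boundary.NN := by
  have hq : 1 < q := hp.trans_le hpq
  have hq0 : 0 < q := by linarith
  rcases eq_or_ne (D.hardyIsoB 𝒢 p q Boundary.NN) ∞ with htop | hB
  · rw [htop, ENNReal.mul_top (by norm_num)]; exact le_top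
  refine sInf_le fun f hf => ?_
  set A := 2 * D.hardyIsoB 𝒢 p q Boundary.NN * eLpNorm (deriv f) (ENNReal.ofReal p) D.nu with hA
  rcases eq_or_ne A ∞ with hAtop | hAtop
  · rw [hAtop]; exact le_top
  obtain ⟨k, hk⟩ := exists_normB_sub_le h𝒢 hp hpq hf.1 hB rfl
    (ENNReal.rpow_ne_top_of_nonneg hq0.le hAtop)
  refine (iInf_le _ k).trans ?_
  refine (ENNReal.rpow_le_rpow hk (by positivity : 0 ≤ 1 / q)).trans (le_of_eq ?_)
  rw [← ENNReal.rpow_mul, mul_one_div_cancel hq0.ne', ENNReal.rpow_one]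

end Sublevel

/-! ### The case 𝔹 = L¹(μ) -/

section Lebesgue

variable {D : Diffusion} {p q : ℝ}

theorem normB_one (μ : Measure ℝ) (f : ℝ → ℝ) : normB {1} μ f = ∫⁻ x, ‖f x‖ₑ ∂μ := by
  simp [normB]

theorem normB_one_abs_rpow_rpow (hq : 0 < q) (μ : Measure ℝ) (f : ℝ → ℝ) :
    normB {1} μ (fun x => |f x| ^ q) ^ (1 / q) = eLpNorm f (ENNReal.ofReal q) μ := by
  rw [normB_one, eLpNorm_eq_lintegral_rpow_enorm_toReal (by simpa using hq) ENNReal.ofReal_ne_top,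
    ENNReal.toReal_ofReal hq.le]
  congr 1
  refine lintegral_congr fun x => ?_
  rw [Real.enorm_eq_ofReal (by positivity), Real.enorm_eq_ofReal_abs,
    ENNReal.ofReal_rpow_of_nonneg (abs_nonneg _) hq.le]

theorem hardyLHSB_one (hq : 0 < q) (bc : Boundary) (f : ℝ → ℝ) :
    D.hardyLHSB {1} q bc f = D.hardyLHS q bc f := by
  cases bc
  · exact iInf_congr fun k => normB_one_abs_rpow_rpow hq _ fun x => f x - k
  all_goals exact normB_one_abs_rpow_rpow hq _ f

theorem hardyConstB_one (hq : 0 < q) (bc : Boundary) :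
    D.hardyConstB {1} p q bc = D.hardyConst p q bc := by
  simp_rw [Diffusion.hardyConstB, Diffusion.hardyConst, hardyLHSB_one hq]

theorem normB_one_indicator {S : Set ℝ} (hS : MeasurableSet S) (μ : Measure ℝ) :
    normB {1} μ (S.indicator fun _ => 1) = μ S := by
  rw [normB_one]
  simp_rw [enorm_indicator_eq_indicator_enorm]
  rw [lintegral_indicator hS]
  simp

theorem normB_one_split {x y : ℝ} (hxy : x < y) (k l : ℝ) :
    normB {1} D.mu (fun t => (D.leftOf x).indicator (fun _ => |k| ^ q) t +
        (D.rightOf y).indicator (fun _ => |l| ^ q) t) =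
      ENNReal.ofReal (|k| ^ q) * D.mu (D.leftOf x) +
        ENNReal.ofReal (|l| ^ q) * D.mu (D.rightOf y) := by
  have hl : MeasurableSet (D.leftOf x) := D.measurableSet_E.inter measurableSet_Iio
  have hr : MeasurableSet (D.rightOf y) := D.measurableSet_E.inter measurableSet_Ioi
  rw [normB_one, ← lintegral_indicator_const hl, ← lintegral_indicator_const hr,
    ← lintegral_add_left (measurable_const.indicator hl)]
  refine lintegral_congr fun t => ?_
  by_cases h1 : t ∈ D.leftOf x <;> by_cases h2 : t ∈ D.rightOf y
  · exact absurd (h1.2.trans (hxy.trans h2.2)) (lt_irrefl _)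
  · simp only [h1, h2, indicator_of_mem, indicator_of_notMem, not_false_iff, add_zero]
    exact Real.enorm_eq_ofReal (by positivity)
  · simp only [h1, h2, indicator_of_mem, indicator_of_notMem, not_false_iff, zero_add]
    exact Real.enorm_eq_ofReal (by positivity)
  · simp [h1, h2]

theorem hardyIsoB_one (hq : 1 < q) (bc : Boundary) :
    D.hardyIsoB {1} p q bc = D.hardyIso p q bc := by
  have hl : ∀ x, MeasurableSet (D.leftOf x) := fun x => D.measurableSet_E.inter measurableSet_Iio
  have hr : ∀ x, MeasurableSet (D.rightOf x) := fun x => D.measurableSet_E.inter measurableSet_Ioi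
  cases bc
  · refine iSup_congr fun x => iSup_congr fun _ => iSup_congr fun y => iSup_congr fun _ =>
      iSup_congr fun hxy => ?_
    simp_rw [normB_one_split hxy]
    rw [iInf_rpow_mul_add_eq hq, ENNReal.div_eq_inv_mul, mul_comm, ← ENNReal.rpow_neg,
      ← ENNReal.rpow_mul]
    congr 2
    ring
  · simp only [Diffusion.hardyIsoB, Diffusion.hardyIso, normB_one_indicator measurableSet_Ioo]
  · simp only [Diffusion.hardyIsoB, Diffusion.hardyIso, normB_one_indicator (hr _)]
  · simp only [Diffusion.hardyIsoB, Diffusion.hardyIso, normB_one_indicator (hl _)]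

theorem hardyConstB_le_two_mul {𝒢 : Set (ℝ → ℝ≥0)} (h𝒢 : ∀ g ∈ 𝒢, Measurable g) (hp : 1 < p)
    (hpq : p ≤ q) (bc : Boundary) : D.hardyConstB 𝒢 p q bc ≤ 2 * D.hardyIsoB 𝒢 p q bc := by
  by_cases hbc : bc = Boundary.NN
  · subst hbc; exact hardyConstB_NN_le h𝒢 hp hpq
  · exact Diffusion.hardyConstB_le hbc h𝒢 hp hpq

theorem hardyIso_le (hp : 1 < p) (hpq : p ≤ q) (bc : Boundary) :
    D.hardyIso p q bc ≤ D.hardyConst p q bc := by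
  have hq : 1 < q := hp.trans_le hpq
  rw [← hardyIsoB_one hq, ← hardyConstB_one (by linarith)]
  exact D.hardyIsoB_le _ hp (by linarith) bc

theorem hardyConst_le (hp : 1 < p) (hpq : p ≤ q) (bc : Boundary) :
    D.hardyConst p q bc ≤ 2 * D.hardyIso p q bc := by
  have hq : 1 < q := hp.trans_le hpq
  rw [← hardyIsoB_one hq, ← hardyConstB_one (by linarith)]
  exact hardyConstB_le_two_mul (by rintro g rfl; exact measurable_const) hp hpq bc

end Lebesgue
/-! ### Harmonic functions and the ground state transform -/

section Harmonic

variable {D : Diffusion}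

theorem locAC_of_hasDerivAt {φ φ' : ℝ → ℝ} (h : ∀ x ∈ D.E, HasDerivAt φ (φ' x) x)
    (hc : ContinuousOn φ' D.E) : LocAC φ D.E := by
  intro x hx y hy
  have hsub := D.uIcc_subset_E hx hy
  obtain ⟨R, hR⟩ := isCompact_uIcc.exists_bound_of_continuousOn (hc.mono hsub)
  have hR' : ∀ z ∈ uIcc x y, ‖φ' z‖₊ ≤ R.toNNReal := fun z hz => by
    rw [← NNReal.coe_le_coe, coe_nnnorm]
    exact (hR z hz).trans (Real.le_coe_toNNReal R)
  exact ((convex_uIcc x y).lipschitzOnWith_of_nnnorm_hasDerivWithin_le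
    (fun z hz => (h z (hsub hz)).hasDerivWithinAt) hR').absolutelyContinuousOnInterval

theorem LocAC.mul {f g : ℝ → ℝ} (hf : LocAC f D.E) (hg : LocAC g D.E) :
    LocAC (fun x => f x * g x) D.E :=
  fun x hx y hy => (hf x hx y hy).mul (hg x hx y hy)

namespace Diffusion

variable (D)

/-- The flux `e^C h'`. -/
noncomputable def flux (h : ℝ → ℝ) (x : ℝ) : ℝ := Real.exp (D.C x) * deriv h x

/-- The density `e^C f'^2 + c f^2 e^C / a` of the energy. -/
noncomputable def energyDensity (c f : ℝ → ℝ) (x : ℝ) : ℝ :=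
  deriv f x ^ 2 * Real.exp (D.C x) + c x * f x ^ 2 * (Real.exp (D.C x) / D.a x)

variable {D}

theorem a_pos' {x : ℝ} (hx : x ∈ D.E) : 0 < D.a x := D.a_pos x hx.1 hx.2

theorem energyDensity_nonneg {c f : ℝ → ℝ} (hc : ∀ x ∈ D.E, 0 ≤ c x) {x : ℝ} (hx : x ∈ D.E) :
    0 ≤ D.energyDensity c f x := by
  have := a_pos' hx
  have := hc x hx
  unfold energyDensity
  positivity

end Diffusion

open Diffusion

variable {c h : ℝ → ℝ}

theorem Diffusion.IsHarmonic.hasDerivAt (hh : D.IsHarmonic c h) {x : ℝ} (hx : x ∈ D.E) :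
    HasDerivAt h (deriv h x) x :=
  (hh.1.differentiableAt (D.isOpen_E.mem_nhds hx)).hasDerivAt

theorem Diffusion.IsHarmonic.locAC (hh : D.IsHarmonic c h) : LocAC h D.E :=
  locAC_of_hasDerivAt (fun _ hx => hh.hasDerivAt hx) hh.2.1.continuousOn

theorem Diffusion.IsHarmonic.locAC_inv (hh : D.IsHarmonic c h) (hpos : ∀ x ∈ D.E, 0 < h x) :
    LocAC (fun x => (h x)⁻¹) D.E := by
  refine locAC_of_hasDerivAt (fun x hx => (hh.hasDerivAt hx).fun_inv (hpos x hx).ne') ?_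
  exact hh.2.1.continuousOn.neg.div (hh.locAC.continuousOn.pow 2)
    fun x hx => (pow_pos (hpos x hx) 2).ne'

theorem Diffusion.IsHarmonic.locAC_flux (hh : D.IsHarmonic c h) : LocAC (D.flux h) D.E :=
  (LocAC.comp_contDiff D.locAC_C Real.contDiff_exp).mul hh.2.1

theorem Diffusion.IsHarmonic.ae_hasDerivAt_flux (hh : D.IsHarmonic c h) :
    ∀ᵐ x, x ∈ D.E → HasDerivAt (D.flux h) (c x * h x * (Real.exp (D.C x) / D.a x)) x := by
  filter_upwards [D.ae_hasDerivAt_C, hh.2.1.ae_differentiableAt,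
    (ae_restrict_iff' D.measurableSet_E).1 hh.2.2] with x h1 h2 h3 hx
  have h4 := ((h1 hx).exp).mul (h2 hx).hasDerivAt
  have h5 := h3 hx
  have ha := (a_pos' hx).ne'
  unfold Lc at h5
  refine HasDerivAt.congr_deriv (f := D.flux h) h4 ?_
  field_simp
  linear_combination h5

/-- In divergence form L^c h = 0 reads (e^C h')' = c h e^C / a, and the right side is nonnegative.
-/
theorem Diffusion.IsHarmonic.monotoneOn_flux (hh : D.IsHarmonic c h) (hc : ∀ x ∈ D.E, 0 ≤ c x)
    (hpos : ∀ x ∈ D.E, 0 < h x) : MonotoneOn (D.flux h) D.E := by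
  intro x hx y hy hxy
  have h1 := (hh.locAC_flux x hx y hy).integral_deriv_eq_sub
  have h2 : 0 ≤ ∫ t in x..y, deriv (D.flux h) t := by
    refine intervalIntegral.integral_nonneg_of_ae_restrict hxy ?_
    filter_upwards [ae_restrict_of_ae hh.ae_hasDerivAt_flux, ae_restrict_mem measurableSet_Icc]
      with t ht htm
    have htE := D.Icc_subset_E hx hy htm
    rw [(ht htE).deriv]
    have := a_pos' htE
    have := hc t htE
    have := hpos t htE
    simp only [Pi.zero_apply]
    positivity
  linarith

theorem flux_nonneg (hm : MonotoneOn (D.flux h) D.E) (hl : Tendsto (D.flux h) D.leftEnd (𝓝 0))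
    {x : ℝ} (hx : x ∈ D.E) : 0 ≤ D.flux h x := by
  by_contra! hneg
  obtain ⟨u, hu, hu'⟩ := D.eventually_leftEnd.1 (hl.eventually (lt_mem_nhds hneg))
  have hz : min u x ∈ D.E := by rcases min_choice u x with h | h <;> rw [h] <;> assumption
  obtain ⟨y, hy, hyz⟩ := D.exists_mem_lt hz
  exact absurd (hm hy hx (hyz.le.trans (min_le_right _ _)))
    (hu' y hy (hyz.trans_le (min_le_left _ _))).not_ge

theorem flux_nonpos (hm : MonotoneOn (D.flux h) D.E) (hr : Tendsto (D.flux h) D.rightEnd (𝓝 0))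
    {x : ℝ} (hx : x ∈ D.E) : D.flux h x ≤ 0 := by
  by_contra! hneg
  obtain ⟨u, hu, hu'⟩ := D.eventually_rightEnd.1 (hr.eventually (gt_mem_nhds hneg))
  have hz : max u x ∈ D.E := by rcases max_choice u x with h | h <;> rw [h] <;> assumption
  obtain ⟨y, hy, hyz⟩ := D.exists_mem_gt hz
  exact absurd (hm hx hy ((le_max_right _ _).trans hyz.le))
    (hu' y hy ((le_max_left _ _).trans_lt hyz)).not_ge

/-- If `G + W' = A` with `G, A ≥ 0`, then `∫ G ≤ ∫ A + W(y₁) - W(y₂)`. -/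
theorem lintegral_le_add_ofReal_sub {A G W : ℝ → ℝ} {y₁ y₂ : ℝ} (h12 : y₁ ≤ y₂)
    (hW : AbsolutelyContinuousOnInterval W y₁ y₂)
    (hA : ∀ᵐ x ∂(volume.restrict (Ioo y₁ y₂)), 0 ≤ A x)
    (hG : ∀ᵐ x ∂(volume.restrict (Ioo y₁ y₂)), 0 ≤ G x)
    (h : ∀ᵐ x ∂(volume.restrict (Ioo y₁ y₂)), A x = G x + deriv W x) :
    ∫⁻ x in Ioo y₁ y₂, ENNReal.ofReal (G x) ≤
      (∫⁻ x in Ioo y₁ y₂, ENNReal.ofReal (A x)) + ENNReal.ofReal (W y₁ - W y₂) := by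
  have hi : IntegrableOn (deriv W) (Ioo y₁ y₂) := by
    rw [← integrableOn_Ioc_iff_integrableOn_Ioo]
    exact (intervalIntegrable_iff_integrableOn_Ioc_of_le h12).1 hW.intervalIntegrable_deriv
  have hm := measurable_deriv W
  set p := ∫⁻ x in Ioo y₁ y₂, ENNReal.ofReal (deriv W x) with hp
  set n := ∫⁻ x in Ioo y₁ y₂, ENNReal.ofReal (-deriv W x) with hn
  have hpf : p ≠ ∞ := hi.lintegral_lt_top.ne
  have hnf : n ≠ ∞ := hi.neg.lintegral_lt_top.ne
  have e1 : p.toReal - n.toReal = W y₂ - W y₁ := by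
    rw [← hW.integral_deriv_eq_sub, intervalIntegral.integral_of_le h12,
      ← restrict_Ioo_eq_restrict_Ioc, integral_eq_lintegral_pos_part_sub_lintegral_neg_part hi]
  have e2 : n ≤ p + ENNReal.ofReal (W y₁ - W y₂) := by
    rw [← ENNReal.ofReal_toReal hnf, ← ENNReal.ofReal_toReal hpf]
    refine le_trans (ENNReal.ofReal_le_ofReal ?_) ENNReal.ofReal_add_le
    linarith
  -- The integrals of A and G may be infinite, so A = G + W' is rearranged as G + (W')⁺ = A + (W')⁻;
  -- only the two parts of W' need be measurable and integrable.
  have e3 : (∫⁻ x in Ioo y₁ y₂, ENNReal.ofReal (G x)) + p =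
      (∫⁻ x in Ioo y₁ y₂, ENNReal.ofReal (A x)) + n := by
    rw [hp, hn, ← lintegral_add_right _ (by fun_prop), ← lintegral_add_right _ (by fun_prop)]
    refine lintegral_congr_ae ?_
    filter_upwards [hA, hG, h] with x h1 h2 h3
    rcases le_total 0 (deriv W x) with h4 | h4
    · rw [ENNReal.ofReal_of_nonpos (by linarith : -deriv W x ≤ 0), add_zero, h3,
        ENNReal.ofReal_add h2 h4]
    · rw [ENNReal.ofReal_of_nonpos h4, add_zero, ← ENNReal.ofReal_add h1 (by linarith), h3]
      congr 1; ring
  refine (ENNReal.add_le_add_iff_right hpf).1 ?_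
  rw [e3]
  refine (add_le_add_right e2 _).trans (le_of_eq ?_)
  ring

/-- The boundary term of the ground state transform. -/
noncomputable def boundaryTerm (D : Diffusion) (h g : ℝ → ℝ) (x : ℝ) : ℝ :=
  g x ^ 2 * (h x * D.flux h x)

theorem locAC_boundaryTerm (hh : D.IsHarmonic c h) {g : ℝ → ℝ} (hg : LocAC g D.E) :
    LocAC (boundaryTerm D h g) D.E :=
  (LocAC.comp_contDiff hg (ψ := fun z => z ^ 2) (by fun_prop)).mul (hh.locAC.mul hh.locAC_flux)

/-- Ground state identity. Expanding (h g)'^2 e^C and replacing c h e^C/a by the derivative of the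
flux, all terms except g'^2 h^2 e^C combine into the derivative of g^2 h e^C h'. -/
theorem ae_energyDensity_eq (hh : D.IsHarmonic c h) {g : ℝ → ℝ} (hg : LocAC g D.E) :
    ∀ᵐ x, x ∈ D.E → D.energyDensity c (fun t => h t * g t) x =
      deriv g x ^ 2 * (h x ^ 2 * Real.exp (D.C x)) + deriv (boundaryTerm D h g) x := by
  filter_upwards [hh.ae_hasDerivAt_flux, hg.ae_differentiableAt] with x h1 h2 hx
  have hg' := (h2 hx).hasDerivAt
  have hh' := hh.hasDerivAt hx
  have e1 := (hh'.mul hg').deriv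
  have e2 := ((hg'.pow 2).mul (hh'.mul (h1 hx))).deriv
  have e3 : deriv (boundaryTerm D h g) x = _ := e2
  have e4 : deriv (fun t => h t * g t) x = _ := e1
  rw [e3, Diffusion.energyDensity, e4]
  simp only [Diffusion.flux, Pi.pow_apply, Pi.mul_apply]
  push_cast
  ring

variable {y₁ y₂ : ℝ}

theorem lintegral_transform_le (hh : D.IsHarmonic c h) (hc : ∀ x ∈ D.E, 0 ≤ c x)
    {g : ℝ → ℝ} (hg : LocAC g D.E) (h₁ : y₁ ∈ D.E) (h₂ : y₂ ∈ D.E) (h12 : y₁ ≤ y₂) :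
    ∫⁻ x in Ioo y₁ y₂, ENNReal.ofReal (deriv g x ^ 2 * (h x ^ 2 * Real.exp (D.C x))) ≤
      (∫⁻ x in Ioo y₁ y₂, ENNReal.ofReal (D.energyDensity c (fun t => h t * g t) x)) +
        ENNReal.ofReal (boundaryTerm D h g y₁ - boundaryTerm D h g y₂) := by
  have hsub : Ioo y₁ y₂ ⊆ D.E := Ioo_subset_Icc_self.trans (D.Icc_subset_E h₁ h₂)
  refine lintegral_le_add_ofReal_sub h12 (locAC_boundaryTerm hh hg _ h₁ _ h₂) ?_
    (ae_of_all _ fun _ => by positivity) ?_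
  · filter_upwards [ae_restrict_mem measurableSet_Ioo] with x hx
    exact energyDensity_nonneg hc (hsub hx)
  · filter_upwards [ae_restrict_mem measurableSet_Ioo,
      ae_restrict_of_ae (ae_energyDensity_eq hh hg)] with x hx h1 using h1 (hsub hx)

theorem lintegral_energy_le (hh : D.IsHarmonic c h) (hc : ∀ x ∈ D.E, 0 ≤ c x)
    {g : ℝ → ℝ} (hg : LocAC g D.E) (h₁ : y₁ ∈ D.E) (h₂ : y₂ ∈ D.E) (h12 : y₁ ≤ y₂) :
    ∫⁻ x in Ioo y₁ y₂, ENNReal.ofReal (D.energyDensity c (fun t => h t * g t) x) ≤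
      (∫⁻ x in Ioo y₁ y₂, ENNReal.ofReal (deriv g x ^ 2 * (h x ^ 2 * Real.exp (D.C x)))) +
        ENNReal.ofReal (boundaryTerm D h g y₂ - boundaryTerm D h g y₁) := by
  have hsub : Ioo y₁ y₂ ⊆ D.E := Ioo_subset_Icc_self.trans (D.Icc_subset_E h₁ h₂)
  have := lintegral_le_add_ofReal_sub (A := fun x => deriv g x ^ 2 * (h x ^ 2 * Real.exp (D.C x)))
    (G := fun x => D.energyDensity c (fun t => h t * g t) x)
    (W := fun x => -boundaryTerm D h g x) h12
    (locAC_boundaryTerm hh hg _ h₁ _ h₂).neg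
    (ae_of_all _ fun _ => by positivity) ?_ ?_
  · convert this using 3
    ring
  · filter_upwards [ae_restrict_mem measurableSet_Ioo] with x hx
    exact energyDensity_nonneg hc (hsub hx)
  · filter_upwards [ae_restrict_mem measurableSet_Ioo,
      ae_restrict_of_ae (ae_energyDensity_eq hh hg)] with x hx h1
    have h2 : deriv (fun x => -boundaryTerm D h g x) x = -deriv (boundaryTerm D h g) x :=
      deriv.fun_neg
    rw [h1 (hsub hx), h2]
    ring

theorem lintegral_Ioo_le_of_exhaust {F : ℝ → ℝ≥0∞} {K : ℝ≥0∞}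
    (hK : ∀ z₁ ∈ D.E, ∀ z₂ ∈ D.E, ∃ y₁ y₂, y₁ ≤ z₁ ∧ z₂ ≤ y₂ ∧ ∫⁻ x in Ioo y₁ y₂, F x ≤ K) :
    ∫⁻ x in D.E, F x ≤ K := by
  obtain ⟨v, hv, hvE, hv'⟩ := D.exists_seq_left
  obtain ⟨w, hw, hwE, hw'⟩ := D.exists_seq_right
  have hmono : Monotone fun j => Ioo (v j) (w j) := fun i j hij => Ioo_subset_Ioo (hv hij) (hw hij)
  have hE : D.E = ⋃ j, Ioo (v j) (w j) := by
    refine subset_antisymm (fun x hx => ?_) (iUnion_subset fun j =>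
      Ioo_subset_Icc_self.trans (D.Icc_subset_E (hvE j) (hwE j)))
    obtain ⟨i, hi⟩ := hv' x hx
    obtain ⟨j, hj⟩ := hw' x hx
    exact mem_iUnion.2 ⟨max i j, (hv (le_max_left _ _)).trans_lt hi,
      hj.trans_le (hw (le_max_right _ _))⟩
  rw [hE, setLIntegral_iUnion_of_directed _ hmono.directed_le]
  refine iSup_le fun j => ?_
  obtain ⟨y₁, y₂, h1, h2, h3⟩ := hK _ (hvE j) _ (hwE j)
  exact (lintegral_mono_set (Ioo_subset_Ioo h1 h2)).trans h3

/-- The energy of a test function `h g`, where `g` is constant near the endpoints. -/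
theorem lintegral_energy_test_le (hh : D.IsHarmonic c h) (hc : ∀ x ∈ D.E, 0 ≤ c x)
    (hpos : ∀ x ∈ D.E, 0 < h x) {bc : Boundary} (hneu : D.IsNeumann bc h) {g : ℝ → ℝ}
    (hg : LocAC g D.E) (hl : bc.LeftD → ∃ u ∈ D.E, ∀ x < u, g x = 0)
    (hr : bc.RightD → ∃ u ∈ D.E, ∀ x, u < x → g x = 0) :
    ∫⁻ x in D.E, ENNReal.ofReal (D.energyDensity c (fun t => h t * g t) x) ≤
      ∫⁻ x in D.E, ENNReal.ofReal (deriv g x ^ 2 * (h x ^ 2 * Real.exp (D.C x))) := by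
  have hm := hh.monotoneOn_flux hc hpos
  -- The boundary terms can be dropped: at a Dirichlet end g vanishes, and at a Neumann end the
  -- monotone flux is nonnegative (left) or nonpositive (right), which is the favourable sign.
  refine lintegral_Ioo_le_of_exhaust fun z₁ hz₁ z₂ hz₂ => ?_
  have h1 : ∃ y ∈ D.E, y ≤ min z₁ z₂ ∧ 0 ≤ boundaryTerm D h g y := by
    have hz : min z₁ z₂ ∈ D.E := by rcases min_choice z₁ z₂ with h | h <;> rw [h] <;> assumption
    by_cases hD : bc.LeftD
    · obtain ⟨u, hu, hu'⟩ := hl hD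
      have hz' : min u (min z₁ z₂) ∈ D.E := by
        rcases min_choice u (min z₁ z₂) with h | h <;> rw [h] <;> assumption
      obtain ⟨y, hy, hyz⟩ := D.exists_mem_lt hz'
      refine ⟨y, hy, hyz.le.trans (min_le_right _ _), ?_⟩
      rw [boundaryTerm, hu' y (hyz.trans_le (min_le_left _ _))]
      simp
    · refine ⟨_, hz, le_rfl, ?_⟩
      have := flux_nonneg hm (hneu.1 hD) hz
      have := hpos _ hz
      unfold boundaryTerm
      positivity
  have h2 : ∃ y ∈ D.E, max z₁ z₂ ≤ y ∧ boundaryTerm D h g y ≤ 0 := by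
    have hz : max z₁ z₂ ∈ D.E := by rcases max_choice z₁ z₂ with h | h <;> rw [h] <;> assumption
    by_cases hD : bc.RightD
    · obtain ⟨u, hu, hu'⟩ := hr hD
      have hz' : max u (max z₁ z₂) ∈ D.E := by
        rcases max_choice u (max z₁ z₂) with h | h <;> rw [h] <;> assumption
      obtain ⟨y, hy, hyz⟩ := D.exists_mem_gt hz'
      refine ⟨y, hy, (le_max_right _ _).trans hyz.le, ?_⟩
      rw [boundaryTerm, hu' y ((le_max_left _ _).trans_lt hyz)]
      simp
    · refine ⟨_, hz, le_rfl, ?_⟩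
      have h3 := flux_nonpos hm (hneu.2 hD) hz
      have h4 := hpos _ hz
      exact mul_nonpos_of_nonneg_of_nonpos (sq_nonneg _) (mul_nonpos_of_nonneg_of_nonpos h4.le h3)
  obtain ⟨y₁, hy₁, hyz₁, hb₁⟩ := h1
  obtain ⟨y₂, hy₂, hyz₂, hb₂⟩ := h2
  have h12 : y₁ ≤ y₂ := hyz₁.trans (min_le_max.trans hyz₂)
  refine ⟨y₁, y₂, hyz₁.trans (min_le_left _ _), (le_max_right _ _).trans hyz₂, ?_⟩
  refine (lintegral_energy_le hh hc hg hy₁ hy₂ h12).trans ?_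
  rw [ENNReal.ofReal_of_nonpos (by linarith), add_zero]
  exact lintegral_mono_set (Ioo_subset_Icc_self.trans (D.Icc_subset_E hy₁ hy₂))

/-- A lower bound for the energy on an interval by the increment of the flux. -/
theorem ofReal_flux_sub_le (hh : D.IsHarmonic c h) (hc : ∀ x ∈ D.E, 0 ≤ c x)
    (hpos : ∀ x ∈ D.E, 0 < h x) {f : ℝ → ℝ} {w y δ : ℝ} (hδ : 0 ≤ δ) (hw : w ∈ D.E)
    (hy : y ∈ D.E) (hwy : w ≤ y) (hf : ∀ t ∈ Ioo w y, δ * h t ≤ f t ^ 2) :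
    ENNReal.ofReal (δ * (D.flux h y - D.flux h w)) ≤
      ∫⁻ x in Ioo w y, ENNReal.ofReal (D.energyDensity c f x) := by
  have hsub : Ioo w y ⊆ D.E := Ioo_subset_Icc_self.trans (D.Icc_subset_E hw hy)
  have hAC := hh.locAC_flux w hw y hy
  have hi : IntegrableOn (deriv (D.flux h)) (Ioo w y) := by
    rw [← integrableOn_Ioc_iff_integrableOn_Ioo]
    exact (intervalIntegrable_iff_integrableOn_Ioc_of_le hwy).1 hAC.intervalIntegrable_deriv
  -- The term f'^2 e^C is discarded, and f^2 ≥ δ h makes the killing term at least δ times the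
  -- derivative c h e^C/a of the flux.
  have hbound : ∀ᵐ t ∂(volume.restrict (Ioo w y)), 0 ≤ δ * deriv (D.flux h) t ∧
      δ * deriv (D.flux h) t ≤ D.energyDensity c f t := by
    filter_upwards [ae_restrict_mem measurableSet_Ioo, ae_restrict_of_ae hh.ae_hasDerivAt_flux]
      with t ht h1
    have htE := hsub ht
    rw [(h1 htE).deriv]
    have ha := a_pos' htE
    have hct := hc t htE
    have hht := hpos t htE
    refine ⟨by positivity, ?_⟩
    have h4 : 0 ≤ c t * (Real.exp (D.C t) / D.a t) := by positivity
    have h5 : 0 ≤ deriv f t ^ 2 * Real.exp (D.C t) := by positivity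
    have h6 := mul_le_mul_of_nonneg_left (hf t ht) h4
    unfold Diffusion.energyDensity
    linarith
  calc ENNReal.ofReal (δ * (D.flux h y - D.flux h w))
      = ENNReal.ofReal (∫ t in Ioo w y, δ * deriv (D.flux h) t) := by
        rw [integral_const_mul, restrict_Ioo_eq_restrict_Ioc,
          ← intervalIntegral.integral_of_le hwy, hAC.integral_deriv_eq_sub]
    _ = ∫⁻ t in Ioo w y, ENNReal.ofReal (δ * deriv (D.flux h) t) :=
        ofReal_integral_eq_lintegral_ofReal (hi.const_mul _) (hbound.mono fun t ht => ht.1)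
    _ ≤ _ := lintegral_mono_ae (hbound.mono fun t ht => ENNReal.ofReal_le_ofReal ht.2)

/-- At a right Neumann endpoint, the boundary term is small along a sequence. -/
theorem exists_right_boundary_le (hh : D.IsHarmonic c h) (hc : ∀ x ∈ D.E, 0 ≤ c x)
    (hpos : ∀ x ∈ D.E, 0 < h x) (hr : Tendsto (D.flux h) D.rightEnd (𝓝 0)) {f : ℝ → ℝ}
    (hf : ∫⁻ x in D.E, ENNReal.ofReal (D.energyDensity c f x) ≠ ∞) {δ : ℝ} (hδ : 0 < δ) {z : ℝ}
    (hz : z ∈ D.E) : ∃ y ∈ D.E, z ≤ y ∧ f y ^ 2 * (-D.flux h y) ≤ δ * h y := by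
  have hm := hh.monotoneOn_flux hc hpos
  by_contra! hcon
  have hPneg : ∀ t ∈ D.E, z ≤ t → D.flux h t < 0 := fun t ht hzt => by
    have h1 := hcon t ht hzt
    have h2 := mul_pos hδ (hpos t ht)
    by_contra! h3
    linarith [mul_nonpos_of_nonneg_of_nonpos (sq_nonneg (f t)) (neg_nonpos.2 h3)]
  set ρ := (volume.restrict D.E).withDensity fun x => ENNReal.ofReal (D.energyDensity c f x)
  have hρ : IsFiniteMeasure ρ := isFiniteMeasure_withDensity hf
  -- If the claim fails, then f^2 > δ h / (-flux) from z onward. On (w, y) the flux is at least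
  -- flux(w), so f^2 ≥ (δ / (-flux(w))) h. Taking y where the flux has risen to more than flux(w)/2,
  -- the energy on (w, y) is at least δ/2.
  have key : ∀ w ∈ D.E, z ≤ w → ∃ y ∈ D.E, w < y ∧ ENNReal.ofReal (δ / 2) ≤ ρ (Ioo w y) := by
    intro w hw hzw
    have hPw := hPneg w hw hzw
    have hd : 0 < -D.flux h w := by linarith
    obtain ⟨u, hu, hu'⟩ := D.eventually_rightEnd.1
      (hr.eventually (lt_mem_nhds (by linarith : D.flux h w / 2 < 0)))
    have hz' : max u w ∈ D.E := by rcases max_choice u w with h | h <;> rw [h] <;> assumption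
    obtain ⟨y, hy, hyz⟩ := D.exists_mem_gt hz'
    have hwy : w < y := (le_max_right _ _).trans_lt hyz
    have hPy := hu' y hy ((le_max_left _ _).trans_lt hyz)
    have hsub : Ioo w y ⊆ D.E := Ioo_subset_Icc_self.trans (D.Icc_subset_E hw hy)
    refine ⟨y, hy, hwy, ?_⟩
    rw [withDensity_apply _ measurableSet_Ioo, Measure.restrict_restrict measurableSet_Ioo,
      inter_eq_left.2 hsub]
    refine le_trans (ENNReal.ofReal_le_ofReal ?_) (ofReal_flux_sub_le hh hc hpos
      (δ := δ / (-D.flux h w)) (by positivity) hw hy hwy.le fun t ht => ?_)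
    · rw [div_mul_eq_mul_div, le_div_iff₀ hd]
      nlinarith
    · have htE := hsub ht
      have hP1 := hm hw htE ht.1.le
      have h2 := hcon t htE (hzw.trans ht.1.le)
      rw [div_mul_eq_mul_div, div_le_iff₀ hd]
      nlinarith [sq_nonneg (f t)]
  obtain ⟨v, hv, hvE, hv'⟩ := D.exists_seq_right
  have hlim := D.tendsto_measure_rightOf ρ hv hvE hv' hz
  have hδ' : (0 : ℝ≥0∞) < ENNReal.ofReal (δ / 2) := by simpa using hδ
  -- The energy is finite, so eventually less than δ/2 of it lies beyond v n; this contradicts `key`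
  -- applied at w = v n.
  have hev : ∀ᶠ n in atTop, ρ (D.rightOf z) < ρ (Ioo z (v n)) + ENNReal.ofReal (δ / 2) := by
    refine (hlim.add_const _).eventually (lt_mem_nhds ?_)
    exact ENNReal.lt_add_right (measure_ne_top _ _) hδ'.ne'
  obtain ⟨N, hN⟩ := hv' z hz
  obtain ⟨n, hn, hnN⟩ := (hev.and (eventually_ge_atTop N)).exists
  have hzn : z < v n := hN.trans_le (hv hnN)
  obtain ⟨y, hy, hvy, hle⟩ := key _ (hvE n) hzn.le
  refine absurd hn (not_lt.2 ?_)
  calc _ ≤ ρ (Ioo z (v n)) + ρ (Ioo (v n) y) := add_le_add_right hle _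
    _ = ρ (Ioo z (v n) ∪ Ioo (v n) y) := (measure_union (by
        rw [Set.disjoint_left]; exact fun t h1 h2 => lt_asymm h1.2 h2.1) measurableSet_Ioo).symm
    _ ≤ ρ (D.rightOf z) := measure_mono (union_subset
        (fun t ht => ⟨D.Icc_subset_E hz (hvE n) (Ioo_subset_Icc_self ht), ht.1⟩)
        (fun t ht => ⟨D.Icc_subset_E (hvE n) hy (Ioo_subset_Icc_self ht), hzn.trans ht.1⟩))

/-- At a left Neumann endpoint, the boundary term is small along a sequence. -/
theorem exists_left_boundary_le (hh : D.IsHarmonic c h) (hc : ∀ x ∈ D.E, 0 ≤ c x)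
    (hpos : ∀ x ∈ D.E, 0 < h x) (hl : Tendsto (D.flux h) D.leftEnd (𝓝 0)) {f : ℝ → ℝ}
    (hf : ∫⁻ x in D.E, ENNReal.ofReal (D.energyDensity c f x) ≠ ∞) {δ : ℝ} (hδ : 0 < δ) {z : ℝ}
    (hz : z ∈ D.E) : ∃ y ∈ D.E, y ≤ z ∧ f y ^ 2 * D.flux h y ≤ δ * h y := by
  have hm := hh.monotoneOn_flux hc hpos
  by_contra! hcon
  have hPpos : ∀ t ∈ D.E, t ≤ z → 0 < D.flux h t := fun t ht hzt => by
    have h1 := hcon t ht hzt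
    have h2 := mul_pos hδ (hpos t ht)
    by_contra! h3
    linarith [mul_nonpos_of_nonneg_of_nonpos (sq_nonneg (f t)) h3]
  set ρ := (volume.restrict D.E).withDensity fun x => ENNReal.ofReal (D.energyDensity c f x)
  have hρ : IsFiniteMeasure ρ := isFiniteMeasure_withDensity hf
  -- Mirror image of the right end: the flux is positive and falls to less than half of its value at
  -- w when y approaches -M.
  have key : ∀ w ∈ D.E, w ≤ z → ∃ y ∈ D.E, y < w ∧ ENNReal.ofReal (δ / 2) ≤ ρ (Ioo y w) := by
    intro w hw hzw
    have hd := hPpos w hw hzw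
    obtain ⟨u, hu, hu'⟩ := D.eventually_leftEnd.1
      (hl.eventually (gt_mem_nhds (by linarith : 0 < D.flux h w / 2)))
    have hz' : min u w ∈ D.E := by rcases min_choice u w with h | h <;> rw [h] <;> assumption
    obtain ⟨y, hy, hyz⟩ := D.exists_mem_lt hz'
    have hwy : y < w := hyz.trans_le (min_le_right _ _)
    have hPy := hu' y hy (hyz.trans_le (min_le_left _ _))
    have hsub : Ioo y w ⊆ D.E := Ioo_subset_Icc_self.trans (D.Icc_subset_E hy hw)
    refine ⟨y, hy, hwy, ?_⟩
    rw [withDensity_apply _ measurableSet_Ioo, Measure.restrict_restrict measurableSet_Ioo,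
      inter_eq_left.2 hsub]
    refine le_trans (ENNReal.ofReal_le_ofReal ?_) (ofReal_flux_sub_le hh hc hpos
      (δ := δ / D.flux h w) (by positivity) hy hw hwy.le fun t ht => ?_)
    · rw [div_mul_eq_mul_div, le_div_iff₀ hd]
      nlinarith
    · have htE := hsub ht
      have hP1 := hm htE hw ht.2.le
      have h2 := hcon t htE (ht.2.le.trans hzw)
      rw [div_mul_eq_mul_div, div_le_iff₀ hd]
      nlinarith [sq_nonneg (f t)]
  obtain ⟨v, hv, hvE, hv'⟩ := D.exists_seq_left
  have hlim := D.tendsto_measure_leftOf ρ hv hvE hv' hz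
  have hδ' : (0 : ℝ≥0∞) < ENNReal.ofReal (δ / 2) := by simpa using hδ
  have hev : ∀ᶠ n in atTop, ρ (D.leftOf z) < ρ (Ioo (v n) z) + ENNReal.ofReal (δ / 2) := by
    refine (hlim.add_const _).eventually (lt_mem_nhds ?_)
    exact ENNReal.lt_add_right (measure_ne_top _ _) hδ'.ne'
  obtain ⟨N, hN⟩ := hv' z hz
  obtain ⟨n, hn, hnN⟩ := (hev.and (eventually_ge_atTop N)).exists
  have hzn : v n < z := (hv hnN).trans_lt hN
  obtain ⟨y, hy, hvy, hle⟩ := key _ (hvE n) hzn.le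
  refine absurd hn (not_lt.2 ?_)
  calc _ ≤ ρ (Ioo (v n) z) + ρ (Ioo y (v n)) := add_le_add_right hle _
    _ = ρ (Ioo (v n) z ∪ Ioo y (v n)) := (measure_union (by
        rw [Set.disjoint_left]; exact fun t h1 h2 => lt_asymm h1.1 h2.2) measurableSet_Ioo).symm
    _ ≤ ρ (D.leftOf z) := measure_mono (union_subset
        (fun t ht => ⟨D.Icc_subset_E (hvE n) hz (Ioo_subset_Icc_self ht), ht.2⟩)
        (fun t ht => ⟨D.Icc_subset_E hy (hvE n) (Ioo_subset_Icc_self ht), ht.2.trans hzn⟩))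

end Harmonic
/-! ### Poincaré-type inequalities -/

section Poincare

variable {D : Diffusion} {n : Measure ℝ} {σ g : ℝ → ℝ} {y₁ y₂ : ℝ}

/-- The Hardy inequality with exponents `p = q = 2` in terms of `κ`. -/
theorem hardy_interval_kappa {bc : Boundary} (hbc : bc ≠ Boundary.NN) (hn : n D.Eᶜ = 0)
    (hσ : ContinuousOn σ D.E) (hpos : ∀ x ∈ D.E, 0 < σ x)
    (hκ : D.kappa n (weightMeasure D.E σ) bc ≠ ∞) (hy₁ : y₁ ∈ D.E) (hy₂ : y₂ ∈ D.E)
    (h12 : y₁ ≤ y₂) (hg : LocAC g D.E) (hg₁ : bc.LeftD → g y₁ = 0) (hg₂ : bc.RightD → g y₂ = 0) :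
    ∫⁻ x in Ioo y₁ y₂, ENNReal.ofReal (|g x| ^ (2 : ℝ)) ∂n ≤
      4 * D.kappa n (weightMeasure D.E σ) bc *
        ∫⁻ x in Ioo y₁ y₂, ENNReal.ofReal (|deriv g x| ^ (2 : ℝ) * σ x ^ (1 - 2 : ℝ)) := by
  set κ := D.kappa n (weightMeasure D.E σ) bc with hκdef
  set s := weightMeasure D.E σ with hs
  have hsE : s D.Eᶜ = 0 := D.weightMeasure_compl σ
  -- For exponents 2 the Hardy constant is the square root of κ, so (2B)^2 = 4κ is the factor in the
  -- Poincaré bound.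
  set B := κ ^ (1 / 2 : ℝ) with hB
  have hBtop : B ≠ ∞ := ENNReal.rpow_ne_top_of_nonneg (by norm_num) hκ
  have hB2 : B ^ (2 : ℝ) = κ := by
    rw [hB, ← ENNReal.rpow_mul]; norm_num
  have h2B : (2 * B) ^ (2 : ℝ) = 4 * κ := by
    rw [ENNReal.mul_rpow_of_nonneg _ _ (by norm_num), hB2, ENNReal.rpow_two]; norm_num
  have hE := D.measurableSet_E
  have hsub := D.Icc_subset_E hy₁ hy₂
  have hc : (2 : ℝ).HolderConjugate 2 := Real.HolderConjugate.two_two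
  have e1 : (1 - 2 : ℝ) = -1 := by norm_num
  have e2 : (2 / 2 : ℝ) = 1 := by norm_num
  have hgi := hg _ hy₁ _ hy₂
  have hmain : ∫⁻ x in Ioo y₁ y₂, ENNReal.ofReal (|g x| ^ (2 : ℝ)) ∂n ≤
      ((2 * B) ^ (2 : ℝ) * ∫⁻ x in Ioo y₁ y₂,
        ENNReal.ofReal (|deriv g x| ^ (2 : ℝ) * σ x ^ (1 - 2 : ℝ))) ^ (2 / 2 : ℝ) := by
    cases bc
    · exact absurd rfl hbc
    · refine hardy_interval_DD hE hσ hpos hsub h12 hgi (hg₁ trivial) (hg₂ trivial) hc le_rfl hBtop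
        fun x y hxy hx hy => ?_
      rw [← hs] at hx hy ⊢
      obtain ⟨z, hz, hzx⟩ := D.exists_mem_lt_of_measure_ne_zero hsE hx
      obtain ⟨w, hw, hyw⟩ := D.exists_mem_gt_of_measure_ne_zero hsE hy
      have hxE : x ∈ D.E := D.Icc_subset_E hz hw ⟨hzx.le, hxy.trans hyw.le⟩
      have hyE : y ∈ D.E := D.Icc_subset_E hz hw ⟨hzx.le.trans hxy, hyw.le⟩
      rw [hB2, e1, e2, ENNReal.rpow_one, ENNReal.rpow_neg_one, ENNReal.rpow_neg_one]
      have h0 : (s (Iio x))⁻¹ + (s (Ioi y))⁻¹ ≠ ∞ := by simp [hx, hy]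
      have h1 : n (Ioo x y) / ((s (Iio x))⁻¹ + (s (Ioi y))⁻¹) ≤ κ := by
        rw [← D.measure_leftOf hsE, ← D.measure_rightOf hsE]
        exact le_iSup₂_of_le x hxE (le_iSup₂_of_le y hyE (le_iSup_of_le hxy le_rfl))
      exact (ENNReal.div_le_iff_le_mul (Or.inr hκ) (Or.inl h0)).1 h1
    · refine hardy_interval_DN hE hσ hpos hsub h12 hgi (hg₁ trivial) hc le_rfl hBtop
        fun x hx => ?_
      rw [← hs] at hx ⊢
      obtain ⟨z, hz, hzx⟩ := D.exists_mem_lt_of_measure_ne_zero hsE hx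
      rw [hB2, e1, e2, ENNReal.rpow_one, ENNReal.rpow_neg_one, ← D.measure_rightOf hn]
      by_cases hxE : x ∈ D.E
      · have h1 : n (D.rightOf x) / (s (Iio x))⁻¹ ≤ κ := by
          rw [← D.measure_leftOf hsE, div_eq_mul_inv, inv_inv, mul_comm]
          exact le_iSup₂_of_le x hxE le_rfl
        exact (ENNReal.div_le_iff_le_mul (Or.inr hκ) (Or.inl (ENNReal.inv_ne_top.2 hx))).1 h1
      · have : D.rightOf x = ∅ := by
          ext w
          simp only [Diffusion.rightOf, mem_inter_iff, mem_Ioi, mem_empty_iff_false, iff_false,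
            not_and]
          intro hw hxw
          exact hxE (D.Icc_subset_E hz hw ⟨hzx.le, hxw.le⟩)
        rw [this, measure_empty]
        exact zero_le
    · refine hardy_interval_ND hE hσ hpos hsub h12 hgi (hg₂ trivial) hc le_rfl hBtop
        fun x hx => ?_
      rw [← hs] at hx ⊢
      obtain ⟨z, hz, hzx⟩ := D.exists_mem_gt_of_measure_ne_zero hsE hx
      rw [hB2, e1, e2, ENNReal.rpow_one, ENNReal.rpow_neg_one, ← D.measure_leftOf hn]
      by_cases hxE : x ∈ D.E
      · have h1 : n (D.leftOf x) / (s (Ioi x))⁻¹ ≤ κ := by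
          rw [← D.measure_rightOf hsE, div_eq_mul_inv, inv_inv]
          exact le_iSup₂_of_le x hxE le_rfl
        exact (ENNReal.div_le_iff_le_mul (Or.inr hκ) (Or.inl (ENNReal.inv_ne_top.2 hx))).1 h1
      · have : D.leftOf x = ∅ := by
          ext w
          simp only [Diffusion.leftOf, mem_inter_iff, mem_Iio, mem_empty_iff_false, iff_false,
            not_and]
          intro hw hxw
          exact hxE (D.Icc_subset_E hw hz ⟨hxw.le, hzx.le⟩)
        rw [this, measure_empty]
        exact zero_le
  rwa [e2, ENNReal.rpow_one, h2B] at hmain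

open Diffusion

/-- The density of `ν̂_c`. -/
noncomputable def groundDensity (D : Diffusion) (h : ℝ → ℝ) (x : ℝ) : ℝ :=
  Real.exp (-D.C x / (2 - 1)) * (h x ^ 2)⁻¹

variable {c h f : ℝ → ℝ} {bc : Boundary}

theorem groundDensity_pos (hpos : ∀ x ∈ D.E, 0 < h x) {x : ℝ} (hx : x ∈ D.E) :
    0 < groundDensity D h x := by
  have := hpos x hx
  unfold groundDensity
  positivity

/-- The weight of g' in the transformed energy is h^2 e^C, so ν̂_c plays for g the role that ν̂
plays for f. -/
theorem groundDensity_rpow (x : ℝ) :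
    groundDensity D h x ^ (1 - 2 : ℝ) = h x ^ 2 * Real.exp (D.C x) := by
  have e1 : (1 - 2 : ℝ) = -1 := by norm_num
  have e2 : -D.C x / (2 - 1) = -D.C x := by norm_num
  rw [e1, Real.rpow_neg_one, groundDensity, e2, mul_inv, inv_inv, ← Real.exp_neg, neg_neg, mul_comm]

theorem continuousOn_groundDensity (hpos : ∀ x ∈ D.E, 0 < h x) (hc : ContinuousOn h D.E) :
    ContinuousOn (groundDensity D h) D.E :=
  (D.continuousOn_scaleDensity 2).mul ((hc.pow 2).inv₀ fun x hx => (pow_pos (hpos x hx) 2).ne')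

theorem nuHatC_eq (hpos : ∀ x ∈ D.E, 0 < h x) (hc : ContinuousOn h D.E) :
    D.nuHatC h = weightMeasure D.E (groundDensity D h) := by
  have hE := D.measurableSet_E
  have h1 : AEMeasurable (D.scaleDensity 2) (volume.restrict D.E) :=
    (D.continuousOn_scaleDensity 2).aemeasurable hE
  have h2 : AEMeasurable (fun x => (h x ^ 2)⁻¹) (volume.restrict D.E) :=
    ((hc.pow 2).inv₀ fun x hx => (pow_pos (hpos x hx) 2).ne').aemeasurable hE
  rw [nuHatC, nuHat_eq, weightMeasure, weightMeasure,
    ← withDensity_mul₀ h1.ennreal_ofReal h2.ennreal_ofReal]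
  congr 1
  ext x
  simp only [Pi.mul_apply, groundDensity]
  rw [← ENNReal.ofReal_mul (D.scaleDensity_pos 2 x).le, scaleDensity]

theorem aemeasurable_mu (hc : ContinuousOn h D.E) : AEMeasurable h D.mu := by
  rw [mu]
  exact (hc.aemeasurable D.measurableSet_E).mono_ac (withDensity_absolutelyContinuous _ _)

theorem lintegral_muC (hc : ContinuousOn h D.E) (F : ℝ → ℝ≥0∞) :
    ∫⁻ x, F x ∂(D.muC h) = ∫⁻ x, ENNReal.ofReal (h x ^ 2) * F x ∂D.mu := by
  rw [muC, lintegral_withDensity_eq_lintegral_mul_non_measurable₀ _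
    ((aemeasurable_mu hc).pow_const 2).ennreal_ofReal (ae_of_all _ fun _ => ENNReal.ofReal_lt_top)]
  rfl

theorem setLIntegral_muC (hc : ContinuousOn h D.E) {S : Set ℝ} (hS : MeasurableSet S)
    (F : ℝ → ℝ≥0∞) :
    ∫⁻ x in S, F x ∂(D.muC h) = ∫⁻ x in S, ENNReal.ofReal (h x ^ 2) * F x ∂D.mu := by
  rw [muC, restrict_withDensity hS, lintegral_withDensity_eq_lintegral_mul_non_measurable₀ _
    ((aemeasurable_mu hc).pow_const 2).ennreal_ofReal.restrict
    (ae_of_all _ fun _ => ENNReal.ofReal_lt_top)]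
  rfl

theorem muC_compl : D.muC h D.Eᶜ = 0 := withDensity_absolutelyContinuous _ _ D.mu_compl

theorem eLpNorm_two_sq (μ : Measure ℝ) (f : ℝ → ℝ) :
    eLpNorm f 2 μ ^ 2 = ∫⁻ x, ENNReal.ofReal (|f x| ^ (2 : ℝ)) ∂μ := by
  rw [eLpNorm_eq_lintegral_rpow_enorm_toReal (by norm_num) (by norm_num), ← ENNReal.rpow_two,
    ← ENNReal.rpow_mul]
  simp only [ENNReal.toReal_ofNat]
  rw [one_div_mul_cancel (by norm_num), ENNReal.rpow_one]
  refine lintegral_congr fun x => ?_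
  rw [Real.enorm_eq_ofReal_abs, ENNReal.ofReal_rpow_of_nonneg (abs_nonneg _) (by norm_num)]

theorem eLpNorm_energy (hc : ∀ x ∈ D.E, 0 ≤ c x) (f : ℝ → ℝ) :
    eLpNorm (deriv f) 2 D.nu ^ 2 + eLpNorm (fun x => √(c x) * f x) 2 D.mu ^ 2 =
      ∫⁻ x in D.E, ENNReal.ofReal (D.energyDensity c f x) := by
  rw [eLpNorm_two_sq, eLpNorm_two_sq, nu_eq, mu_eq, lintegral_weightMeasure D.aemeasurable_exp_C,
    lintegral_weightMeasure D.aemeasurable_exp_C_div, ← lintegral_add_left']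
  · refine setLIntegral_congr_fun D.measurableSet_E fun x hx => ?_
    have h1 := hc x hx
    have h2 := a_pos' hx
    simp only [Real.rpow_two, sq_abs, mul_pow, Real.sq_sqrt h1]
    rw [← ENNReal.ofReal_mul (by positivity), ← ENNReal.ofReal_mul (by positivity),
      ← ENNReal.ofReal_add (by positivity) (by positivity), energyDensity]
    congr 1; ring
  · have := measurable_deriv f
    exact D.aemeasurable_exp_C.ennreal_ofReal.mul (by fun_prop)

theorem energyDensity_clip_le (hc : ∀ x ∈ D.E, 0 ≤ c x) {x : ℝ} (hx : x ∈ D.E)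
    (hf : DifferentiableAt ℝ f x) {ε : ℝ} (hε : 0 ≤ ε) :
    D.energyDensity c (fun x => max (|f x| - ε) 0) x ≤ D.energyDensity c f x := by
  have h1 := sq_le_sq.2 (abs_deriv_clip_le hf ε)
  have h2 : max (|f x| - ε) 0 ^ 2 ≤ f x ^ 2 := by
    rw [← sq_abs (f x)]
    exact pow_le_pow_left₀ (le_max_right _ _) (max_le (by linarith) (abs_nonneg _)) 2
  have := hc x hx
  have := a_pos' hx
  unfold energyDensity
  gcongr

/-- The upper bound with killing, for functions of finite energy. -/
theorem lintegral_sq_le_energy (hbc : bc ≠ Boundary.NN) (hh : D.IsHarmonic c h)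
    (hc : ∀ x ∈ D.E, 0 ≤ c x) (hpos : ∀ x ∈ D.E, 0 < h x) (hneu : D.IsNeumann bc h)
    (hκ : D.kappa (D.muC h) (D.nuHatC h) bc ≠ ∞) (hf : D.Admissible bc f)
    (hfin : ∫⁻ x in D.E, ENNReal.ofReal (D.energyDensity c f x) ≠ ∞) :
    ∫⁻ x, ENNReal.ofReal (|f x| ^ (2 : ℝ)) ∂D.mu ≤ 4 * D.kappa (D.muC h) (D.nuHatC h) bc *
      ∫⁻ x in D.E, ENNReal.ofReal (D.energyDensity c f x) := by
  have hcont := hh.locAC.continuousOn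
  have hm := hh.monotoneOn_flux hc hpos
  rw [nuHatC_eq hpos hcont] at hκ ⊢
  set κ := D.kappa (D.muC h) (weightMeasure D.E (groundDensity D h)) bc with hκdef
  set En := ∫⁻ x in D.E, ENNReal.ofReal (D.energyDensity c f x) with hEn
  obtain ⟨hAC, hL, hR⟩ := hf
  have h4κ : 4 * κ ≠ ∞ := ENNReal.mul_ne_top (by norm_num) hκ
  -- Each Neumann end costs at most δ in the boundary term; the loss δ + δ disappears in the limit δ
  -- → 0.
  have key : ∀ δ : ℝ, 0 < δ → ∫⁻ x, ENNReal.ofReal (|f x| ^ (2 : ℝ)) ∂D.mu ≤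
      4 * κ * (En + ENNReal.ofReal (δ + δ)) := by
    intro δ hδ
    refine lintegral_le_of_clip D.mu_compl hAC.continuousOn (by norm_num)
      fun ε hε z₁ hz₁ z₂ hz₂ => ?_
    set f₀ : ℝ → ℝ := fun x => max (|f x| - ε) 0 with hf₀
    have hf₀AC : LocAC f₀ D.E := hAC.clip ε
    have hf₀le : ∀ x, f₀ x ^ 2 ≤ f x ^ 2 := fun x => by
      rw [← sq_abs (f x)]
      exact pow_le_pow_left₀ (le_max_right _ _) (max_le (by linarith) (abs_nonneg _)) 2
    -- Clipping precedes the division by h: near a Dirichlet end f/h need not be small, but f₀/h is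
    -- exactly zero at the chosen point.
    set g : ℝ → ℝ := fun x => f₀ x * (h x)⁻¹ with hg_def
    have hg : LocAC g D.E := hf₀AC.mul (hh.locAC_inv hpos)
    have hhg : ∀ x ∈ D.E, h x * g x = f₀ x := fun x hx => by
      have := (hpos x hx).ne'
      simp only [hg_def]; field_simp
    have hbdry : ∀ x ∈ D.E, boundaryTerm D h g x * h x = f₀ x ^ 2 * D.flux h x := fun x hx => by
      rw [← hhg x hx, boundaryTerm]; ring
    have h1 : ∃ y ∈ D.E, y ≤ min z₁ z₂ ∧ (bc.LeftD → g y = 0) ∧ boundaryTerm D h g y ≤ δ := by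
      have hz : min z₁ z₂ ∈ D.E := by
        rcases min_choice z₁ z₂ with h | h <;> rw [h] <;> assumption
      by_cases hD : bc.LeftD
      · obtain ⟨y, hy, hyz, hfy⟩ := D.exists_left_abs_le (hL hD) hε hz
        have h0 : g y = 0 := by
          simp only [hg_def, hf₀]; rw [max_eq_right (by linarith), zero_mul]
        exact ⟨y, hy, hyz, fun _ => h0, by rw [boundaryTerm, h0]; simpa using hδ.le⟩
      · obtain ⟨y, hy, hyz, hfy⟩ := exists_left_boundary_le hh hc hpos (hneu.1 hD) hfin hδ hz
        refine ⟨y, hy, hyz, fun h => absurd h hD, ?_⟩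
        refine le_of_mul_le_mul_right ?_ (hpos y hy)
        rw [hbdry y hy]
        exact (mul_le_mul_of_nonneg_right (hf₀le y) (flux_nonneg hm (hneu.1 hD) hy)).trans hfy
    have h2 : ∃ y ∈ D.E, max z₁ z₂ ≤ y ∧ (bc.RightD → g y = 0) ∧ -boundaryTerm D h g y ≤ δ := by
      have hz : max z₁ z₂ ∈ D.E := by
        rcases max_choice z₁ z₂ with h | h <;> rw [h] <;> assumption
      by_cases hD : bc.RightD
      · obtain ⟨y, hy, hyz, hfy⟩ := D.exists_right_abs_le (hR hD) hε hz
        have h0 : g y = 0 := by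
          simp only [hg_def, hf₀]; rw [max_eq_right (by linarith), zero_mul]
        exact ⟨y, hy, hyz, fun _ => h0, by rw [boundaryTerm, h0]; simpa using hδ.le⟩
      · obtain ⟨y, hy, hyz, hfy⟩ := exists_right_boundary_le hh hc hpos (hneu.2 hD) hfin hδ hz
        refine ⟨y, hy, hyz, fun h => absurd h hD, ?_⟩
        refine le_of_mul_le_mul_right ?_ (hpos y hy)
        rw [neg_mul, hbdry y hy, ← mul_neg]
        have := flux_nonpos hm (hneu.2 hD) hy
        exact (mul_le_mul_of_nonneg_right (hf₀le y) (by linarith)).trans hfy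
    obtain ⟨y₁, hy₁, hyz₁, hg₁, hb₁⟩ := h1
    obtain ⟨y₂, hy₂, hyz₂, hg₂, hb₂⟩ := h2
    have h12 : y₁ ≤ y₂ := hyz₁.trans (min_le_max.trans hyz₂)
    have hsub : Ioo y₁ y₂ ⊆ D.E := Ioo_subset_Icc_self.trans (D.Icc_subset_E hy₁ hy₂)
    refine ⟨y₁, y₂, hyz₁.trans (min_le_left _ _), (le_max_right _ _).trans hyz₂, ?_⟩
    have h3 := hardy_interval_kappa hbc muC_compl (continuousOn_groundDensity hpos hcont)
      (fun x hx => groundDensity_pos hpos hx) hκ hy₁ hy₂ h12 hg hg₁ hg₂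
    rw [setLIntegral_muC hcont measurableSet_Ioo] at h3
    calc ∫⁻ x in Ioo y₁ y₂, ENNReal.ofReal (|f₀ x| ^ (2 : ℝ)) ∂D.mu
        = ∫⁻ x in Ioo y₁ y₂, ENNReal.ofReal (h x ^ 2) * ENNReal.ofReal (|g x| ^ (2 : ℝ)) ∂D.mu := by
          refine setLIntegral_congr_fun measurableSet_Ioo fun x hx => ?_
          simp only [Real.rpow_two, sq_abs]
          rw [← ENNReal.ofReal_mul (by positivity), ← mul_pow, hhg x (hsub hx)]
      _ ≤ _ := h3
      _ ≤ 4 * κ * (En + ENNReal.ofReal (δ + δ)) := by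
          refine mul_le_mul_right ?_ _
          have h5 := lintegral_transform_le hh hc hg hy₁ hy₂ h12
          simp only [Real.rpow_two, sq_abs, groundDensity_rpow]
          refine h5.trans (add_le_add ?_ (ENNReal.ofReal_le_ofReal (by linarith)))
          refine le_trans (lintegral_mono_ae ?_) (lintegral_mono_set hsub)
          filter_upwards [ae_restrict_mem measurableSet_Ioo,
            ae_restrict_of_ae hAC.ae_differentiableAt] with x hx hdx
          refine ENNReal.ofReal_le_ofReal ?_
          have hxE := hsub hx
          have e1 : (fun t => h t * g t) =ᶠ[𝓝 x] f₀ := by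
            filter_upwards [D.isOpen_E.mem_nhds hxE] with t ht using hhg t ht
          have e2 : D.energyDensity c (fun t => h t * g t) x = D.energyDensity c f₀ x := by
            rw [energyDensity, energyDensity, e1.deriv_eq, hhg x hxE]
          rw [e2]
          exact energyDensity_clip_le hc hxE (hdx hxE) hε.le
  have hlim : Tendsto (fun k : ℕ => 4 * κ * (En + ENNReal.ofReal
      (1 / ((k : ℝ) + 1) + 1 / ((k : ℝ) + 1)))) atTop (𝓝 (4 * κ * (En + ENNReal.ofReal (0 + 0)))) :=
    ENNReal.Tendsto.const_mul ((ENNReal.tendsto_ofReal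
      (tendsto_one_div_add_atTop_nhds_zero_nat.add tendsto_one_div_add_atTop_nhds_zero_nat)).const_add
        En) (Or.inr h4κ)
  rw [add_zero, ENNReal.ofReal_zero, add_zero] at hlim
  exact ge_of_tendsto' hlim fun k => key _ (by positivity)

theorem inv_mul_le_of_le_mul {a b K : ℝ≥0∞} (h : a ≤ K * b) : K⁻¹ * a ≤ b := by
  rcases eq_or_ne K 0 with rfl | h0
  · rw [zero_mul, nonpos_iff_eq_zero] at h
    simp [h]
  rcases eq_or_ne K ∞ with rfl | h1
  · simp
  calc K⁻¹ * a ≤ K⁻¹ * (K * b) := mul_le_mul_right h _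
    _ = b := by rw [← mul_assoc, ENNReal.inv_mul_cancel h0 h1, one_mul]

theorem div_le_inv_of_mul_le {lam m T : ℝ≥0∞} (h : lam * m ≤ T) : m / T ≤ lam⁻¹ := by
  rcases eq_or_ne lam 0 with rfl | h0
  · simp
  rcases eq_or_ne lam ∞ with rfl | h1
  · rcases eq_or_ne m 0 with rfl | hm
    · simp
    · rw [ENNReal.top_mul hm, top_le_iff] at h
      simp [h]
  refine ENNReal.div_le_of_le_mul ?_
  calc m = lam⁻¹ * (lam * m) := by rw [← mul_assoc, ENNReal.inv_mul_cancel h0 h1, one_mul]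
    _ ≤ lam⁻¹ * T := mul_le_mul_right h _

theorem poincareConst_inv_le (hbc : bc ≠ Boundary.NN) (hh : D.IsHarmonic c h)
    (hc : ∀ x ∈ D.E, 0 ≤ c x) (hpos : ∀ x ∈ D.E, 0 < h x) (hneu : D.IsNeumann bc h) :
    (D.poincareConst c bc)⁻¹ ≤ 4 * D.kappa (D.muC h) (D.nuHatC h) bc := by
  rcases eq_or_ne (D.kappa (D.muC h) (D.nuHatC h) bc) ∞ with htop | hκ
  · rw [htop, ENNReal.mul_top (by norm_num)]; exact le_top
  rw [ENNReal.inv_le_iff_inv_le]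
  refine le_sSup fun f hf _ => ?_
  rw [eLpNorm_energy hc, eLpNorm_two_sq]
  by_cases hfin : ∫⁻ x in D.E, ENNReal.ofReal (D.energyDensity c f x) = ∞
  · rw [hfin]; exact le_top
  · exact inv_mul_le_of_le_mul (lintegral_sq_le_energy hbc hh hc hpos hneu hκ hf hfin)

/-- The test function is h R. Since R = 1 on S, its squared norm is at least μ_c(S), and by
`lintegral_energy_test_le` its energy with killing is at most the energy of R with respect to h^2
e^C. -/
theorem mul_muC_le_of_test (hbc : bc ≠ Boundary.NN) (hh : D.IsHarmonic c h)
    (hc : ∀ x ∈ D.E, 0 ≤ c x) (hpos : ∀ x ∈ D.E, 0 < h x) (hneu : D.IsNeumann bc h) {lam : ℝ≥0∞}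
    (hlam : ∀ f : ℝ → ℝ, D.Admissible bc f → D.MeanZero bc f → lam * eLpNorm f 2 D.mu ^ 2 ≤
      eLpNorm (deriv f) 2 D.nu ^ 2 + eLpNorm (fun x => √(c x) * f x) 2 D.mu ^ 2)
    {R R' : ℝ → ℝ} (hR : LocAC R D.E) (hR' : ∀ᵐ t, HasDerivAt R (R' t) t)
    (hl : bc.LeftD → ∃ u ∈ D.E, ∀ x < u, R x = 0)
    (hr : bc.RightD → ∃ u ∈ D.E, ∀ x, u < x → R x = 0) {S : Set ℝ} (hS : MeasurableSet S)
    (hRS : ∀ t ∈ S, R t = 1) :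
    lam * D.muC h S ≤ ∫⁻ t in D.E, ENNReal.ofReal
      (|R' t| ^ (2 : ℝ) * groundDensity D h t ^ (1 - 2 : ℝ)) := by
  have hcont := hh.locAC.continuousOn
  have hmz : D.MeanZero bc fun t => h t * R t := by
    cases bc
    · exact absurd rfl hbc
    all_goals trivial
  have h1 := hlam (fun t => h t * R t) ⟨hh.locAC.mul hR, fun hD => ?_, fun hD => ?_⟩ hmz
  · rw [eLpNorm_energy hc, eLpNorm_two_sq] at h1
    have h2 : D.muC h S ≤ ∫⁻ t, ENNReal.ofReal (|h t * R t| ^ (2 : ℝ)) ∂D.mu := by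
      rw [← lintegral_indicator_one hS, lintegral_muC hcont]
      refine lintegral_mono fun t => ?_
      by_cases ht : t ∈ S
      · simp [ht, hRS t ht]
      · simp [ht]
    refine (mul_le_mul_right h2 _).trans (h1.trans
      ((lintegral_energy_test_le hh hc hpos hneu hR hl hr).trans (le_of_eq ?_)))
    refine lintegral_congr_ae (ae_restrict_of_ae ?_)
    filter_upwards [hR'] with t ht
    rw [ht.deriv, groundDensity_rpow, Real.rpow_two, sq_abs]
  · obtain ⟨u, hu, hu'⟩ := hl hD
    exact tendsto_leftEnd_of_eq hu fun t ht => by rw [hu' t ht, mul_zero]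
  · obtain ⟨u, hu, hu'⟩ := hr hD
    exact tendsto_rightEnd_of_eq hu fun t ht => by rw [hu' t ht, mul_zero]

/-- The ramps are now taken with respect to ν̂_c, so that the energy of R is an inverse mass of
ν̂_c. The outer foot tends to the Dirichlet endpoint as in `hardyIsoB_le`. -/
theorem kappa_le_poincareConst_inv (hbc : bc ≠ Boundary.NN) (hh : D.IsHarmonic c h)
    (hc : ∀ x ∈ D.E, 0 ≤ c x) (hpos : ∀ x ∈ D.E, 0 < h x) (hneu : D.IsNeumann bc h) :
    D.kappa (D.muC h) (D.nuHatC h) bc ≤ (D.poincareConst c bc)⁻¹ := by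
  have hcont := hh.locAC.continuousOn
  rw [poincareConst, ENNReal.inv_sSup]
  refine le_iInf₂ fun lam hlam => ?_
  have hE := D.measurableSet_E
  have hσ := continuousOn_groundDensity hpos hcont
  have hσpos : ∀ x ∈ D.E, 0 < groundDensity D h x := fun x hx => groundDensity_pos hpos hx
  rw [nuHatC_eq hpos hcont]
  set σ := groundDensity D h with hσdef
  set s := weightMeasure D.E σ with hs
  have hAC : ∀ {x y : ℝ}, x ∈ D.E → y ∈ D.E → LocAC (ramp σ x y) D.E := fun hx hy u _ v _ =>
    absolutelyContinuousOnInterval_ramp hσ (D.Icc_subset_E hx hy) u v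
  have test := fun {R R' : ℝ → ℝ} => mul_muC_le_of_test (R := R) (R' := R') hbc hh hc hpos hneu hlam
  cases bc
  · exact absurd rfl hbc
  · refine iSup₂_le fun x hx => iSup₂_le fun y hy => iSup_le fun hxy => ?_
    refine div_le_inv_of_mul_le ?_
    rw [← ENNReal.rpow_neg_one, ← ENNReal.rpow_neg_one, ← one_mul (_ + _)]
    refine D.le_mul_leftOf_rpow ENNReal.one_ne_top hx fun z hz hzx => ?_
    refine D.le_mul_rightOf_rpow ENNReal.one_ne_top hy fun w hw hyw => ?_
    have hzs := D.Icc_subset_E hz hx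
    have hws := D.Icc_subset_E hy hw
    have hd : ∀ᵐ t, HasDerivAt (fun t => ramp σ z x t - ramp σ y w t)
        ((∫ s in z..x, σ s)⁻¹ * (Ioo z x).indicator σ t -
          (∫ s in y..w, σ s)⁻¹ * (Ioo y w).indicator σ t) t := by
      filter_upwards [ae_hasDerivAt_ramp hσ hzs, ae_hasDerivAt_ramp hσ hws] with t h1 h2
      exact h1.sub h2
    have h1 := test (R := fun t => ramp σ z x t - ramp σ y w t)
      (fun u hu v hv => (hAC hz hx u hu v hv).sub (hAC hy hw u hu v hv)) hd
      (fun _ => ⟨z, hz, fun t ht => ?_⟩) (fun _ => ⟨w, hw, fun t ht => ?_⟩)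
      (measurableSet_Ioo (a := x) (b := y)) (fun t ht => ?_)
    · rw [lintegral_rpow_ramp_add hE hσ hσpos (by norm_num) hzs hws hzx hyw hxy] at h1
      have e : (1 - 2 : ℝ) = -1 := by norm_num
      rwa [e, ← one_mul (_ + _)] at h1
    · rw [ramp_of_le ht.le, ramp_of_le (by linarith), sub_zero]
    · rw [ramp_of_ge hσ hσpos hzs hzx (by linarith), ramp_of_ge hσ hσpos hws hyw ht.le, sub_self]
    · rw [ramp_of_ge hσ hσpos hzs hzx ht.1.le, ramp_of_le ht.2.le, sub_zero]
  · refine iSup₂_le fun x hx => ?_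
    have h0 : s (D.leftOf x) * D.muC h (D.rightOf x) =
        D.muC h (D.rightOf x) / (s (D.leftOf x))⁻¹ := by
      rw [div_eq_mul_inv, inv_inv, mul_comm]
    rw [h0]
    refine div_le_inv_of_mul_le ?_
    have h2 : lam * D.muC h (D.rightOf x) ≤ 1 * (s (D.leftOf x) ^ (-1 : ℝ) + 0) := by
      refine D.le_mul_leftOf_rpow ENNReal.one_ne_top hx fun z hz hzx => ?_
      have hzs := D.Icc_subset_E hz hx
      have h1 := test (hAC hz hx) (ae_hasDerivAt_ramp hσ hzs)
        (fun _ => ⟨z, hz, fun t ht => ramp_of_le ht.le⟩) (fun h => h.elim)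
        (hE.inter (measurableSet_Ioi (a := x)))
        (fun t ht => ramp_of_ge hσ hσpos hzs hzx (le_of_lt ht.2))
      rw [lintegral_rpow_ramp hE hσ hσpos (by norm_num) hzs hzx] at h1
      have e : (1 - 2 : ℝ) = -1 := by norm_num
      rwa [e, ← one_mul (_ ^ _), ← add_zero (_ ^ _)] at h1
    rwa [one_mul, add_zero, ENNReal.rpow_neg_one] at h2
  · refine iSup₂_le fun x hx => ?_
    have h0 : D.muC h (D.leftOf x) * s (D.rightOf x) =
        D.muC h (D.leftOf x) / (s (D.rightOf x))⁻¹ := by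
      rw [div_eq_mul_inv, inv_inv]
    rw [h0]
    refine div_le_inv_of_mul_le ?_
    have h2 : lam * D.muC h (D.leftOf x) ≤ 1 * (0 + s (D.rightOf x) ^ (-1 : ℝ)) := by
      refine D.le_mul_rightOf_rpow ENNReal.one_ne_top hx fun z hz hzx => ?_
      have hzs := D.Icc_subset_E hx hz
      have hd : ∀ᵐ t, HasDerivAt (fun t => 1 - ramp σ x z t)
          (-((∫ s in x..z, σ s)⁻¹ * (Ioo x z).indicator σ t)) t := by
        filter_upwards [ae_hasDerivAt_ramp hσ hzs] with t h1
        exact h1.const_sub 1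
      have h1 := test (R := fun t => 1 - ramp σ x z t)
        (fun u hu v hv => (locAC_const 1 u hu v hv).sub (hAC hx hz u hu v hv)) hd
        (fun h => h.elim) (fun _ => ⟨z, hz, fun t ht => ?_⟩)
        (hE.inter (measurableSet_Iio (a := x))) (fun t ht => ?_)
      · simp_rw [abs_neg] at h1
        rw [lintegral_rpow_ramp hE hσ hσpos (by norm_num) hzs hzx] at h1
        have e : (1 - 2 : ℝ) = -1 := by norm_num
        rwa [e, ← one_mul (_ ^ _), ← zero_add (_ ^ _)] at h1
      · rw [ramp_of_ge hσ hσpos hzs hzx ht.le, sub_self]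
      · rw [ramp_of_le (le_of_lt ht.2), sub_zero]
    rwa [one_mul, zero_add, ENNReal.rpow_neg_one] at h2

end Poincare
-- The Neumann-Neumann Poincaré inequality and the final assembly
section NeumannNeumann

open Diffusion

variable {D : Diffusion} {c h f : ℝ → ℝ}

theorem isFiniteMeasure_mu (hD : D.mu D.E < ∞) : IsFiniteMeasure D.mu := by
  refine ⟨?_⟩
  rw [← union_compl_self D.E]
  refine (measure_union_le _ _).trans_lt ?_
  rwa [D.mu_compl, add_zero]

/-- The mean is the best constant in quadratic approximation. Square integrability of f is not
presupposed: either the right side is infinite, or it follows from that of f - k, since μ is finite.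
-/
theorem lintegral_sq_le_lintegral_sub_sq {μ : Measure ℝ} [IsFiniteMeasure μ]
    (hf : Integrable f μ) (hf0 : ∫ x, f x ∂μ = 0) (k : ℝ) :
    ∫⁻ x, ENNReal.ofReal (|f x| ^ (2 : ℝ)) ∂μ ≤ ∫⁻ x, ENNReal.ofReal (|f x - k| ^ (2 : ℝ)) ∂μ := by
  simp_rw [Real.rpow_two, sq_abs]
  by_cases htop : ∫⁻ x, ENNReal.ofReal ((f x - k) ^ 2) ∂μ = ∞
  · rw [htop]; exact le_top
  have h1 : Integrable (fun x => (f x - k) ^ 2) μ := by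
    refine ⟨(hf.aestronglyMeasurable.sub aestronglyMeasurable_const).pow 2, ?_⟩
    rw [hasFiniteIntegral_iff_ofReal (ae_of_all _ fun x => by positivity)]
    exact lt_top_iff_ne_top.2 htop
  have h2 : Integrable (fun x => 2 * k * f x - k ^ 2) μ :=
    (hf.const_mul _).sub (integrable_const _)
  have e : (fun x => f x ^ 2) = fun x => (f x - k) ^ 2 + (2 * k * f x - k ^ 2) := by
    ext x; ring
  have h3 : Integrable (fun x => f x ^ 2) μ := by rw [e]; exact h1.add h2
  rw [← ofReal_integral_eq_lintegral_ofReal h1 (ae_of_all _ fun x => by positivity),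
    ← ofReal_integral_eq_lintegral_ofReal h3 (ae_of_all _ fun x => by positivity)]
  refine ENNReal.ofReal_le_ofReal ?_
  rw [e, integral_add h1 h2, integral_sub (hf.const_mul _) (integrable_const _),
    integral_const_mul, hf0, integral_const, smul_eq_mul]
  have : 0 ≤ μ.real univ * k ^ 2 := by positivity
  linarith

theorem hardyIso_two_le : D.hardyIso 2 2 Boundary.NN ≤
    D.kappa D.mu (D.nuHat 2) Boundary.NN ^ (1 / 2 : ℝ) := by
  refine iSup₂_le fun x hx => iSup₂_le fun y hy => iSup_le fun hxy => ?_
  have e1 : ((2 - 1) / 2 : ℝ) = 1 / 2 := by norm_num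
  have e2 : (-(1 / (2 - 1)) : ℝ) = -1 := by norm_num
  rw [e1, e2, ENNReal.rpow_neg_one, ENNReal.rpow_neg_one,
    ← ENNReal.div_rpow_of_nonneg _ _ (by norm_num)]
  refine ENNReal.rpow_le_rpow ?_ (by norm_num)
  exact le_iSup₂_of_le x hx (le_iSup₂_of_le y hy (le_iSup_of_le hxy le_rfl))

/-- The killing term only enlarges the right side and is dropped. The Hardy inequality for p = q = 2
provides some constant k, and for mean-zero f the constant 0 is at least as good. -/
theorem poincareConst_NN_inv_le (hD : D.mu D.E < ∞) (c : ℝ → ℝ) :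
    (D.poincareConst c Boundary.NN)⁻¹ ≤ 4 * D.kappa D.mu (D.nuHat 2) Boundary.NN := by
  have := isFiniteMeasure_mu hD
  set κ := D.kappa D.mu (D.nuHat 2) Boundary.NN with hκdef
  rcases eq_or_ne κ ∞ with htop | hκ
  · rw [htop, ENNReal.mul_top (by norm_num)]; exact le_top
  rw [ENNReal.inv_le_iff_inv_le]
  refine le_sSup fun f hf hmz => ?_
  refine le_trans ?_ (le_add_right (a := eLpNorm (deriv f) 2 D.nu ^ 2) le_rfl)
  refine inv_mul_le_of_le_mul ?_
  have hB : D.hardyIsoB {1} 2 2 Boundary.NN ≤ κ ^ (1 / 2 : ℝ) := by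
    rw [hardyIsoB_one (by norm_num)]; exact hardyIso_two_le
  have hBtop : D.hardyIsoB {1} 2 2 Boundary.NN ≠ ∞ :=
    (hB.trans_lt (ENNReal.rpow_lt_top_of_nonneg (by norm_num) hκ)).ne
  have hle : (2 * D.hardyIsoB {1} 2 2 Boundary.NN *
      eLpNorm (deriv f) (ENNReal.ofReal 2) D.nu) ^ (2 : ℝ) ≤
        4 * κ * eLpNorm (deriv f) 2 D.nu ^ 2 := by
    have e : ENNReal.ofReal 2 = 2 := by norm_num
    rw [e, ENNReal.rpow_two, mul_pow, mul_pow]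
    have h1 : D.hardyIsoB {1} 2 2 Boundary.NN ^ 2 ≤ κ := by
      refine (pow_le_pow_left' hB 2).trans (le_of_eq ?_)
      rw [← ENNReal.rpow_two, ← ENNReal.rpow_mul]
      norm_num
    have h2 : (2 : ℝ≥0∞) ^ 2 = 4 := by norm_num
    rw [h2]
    gcongr
  by_cases htop : (2 * D.hardyIsoB {1} 2 2 Boundary.NN *
      eLpNorm (deriv f) (ENNReal.ofReal 2) D.nu) ^ (2 : ℝ) = ∞
  · rw [htop, top_le_iff] at hle
    rw [hle]; exact le_top
  obtain ⟨k, hk⟩ := exists_normB_sub_le (𝒢 := {1})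
    (by rintro g rfl; exact measurable_const) (by norm_num) le_rfl hf.1 hBtop rfl htop
  rw [eLpNorm_two_sq]
  refine (lintegral_sq_le_lintegral_sub_sq hmz.1 hmz.2 k).trans (le_trans (le_of_eq ?_)
    (hk.trans hle))
  rw [normB_one]
  refine lintegral_congr fun x => ?_
  rw [Real.enorm_eq_ofReal (by positivity)]

/-- The test function is the ramp from x to y minus its mean. Its energy is the inverse of ν̂(x, y),
and the killing term vanishes because c = 0 almost everywhere. -/
theorem kappa_NN_le_poincareConst_inv (hD : D.mu D.E < ∞) (hc : ∀ᵐ x, x ∈ D.E → c x = 0) :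
    D.kappa D.mu (D.nuHat 2) Boundary.NN ≤ (D.poincareConst c Boundary.NN)⁻¹ := by
  have := isFiniteMeasure_mu hD
  rw [poincareConst, ENNReal.inv_sSup]
  refine le_iInf₂ fun lam hlam => ?_
  refine iSup₂_le fun x hx => iSup₂_le fun y hy => iSup_le fun hxy => ?_
  have hE := D.measurableSet_E
  have hσ := D.continuousOn_scaleDensity 2
  have hpos : ∀ x ∈ D.E, 0 < D.scaleDensity 2 x := fun x _ => D.scaleDensity_pos 2 x
  have hsub := D.Icc_subset_E hx hy
  set R := ramp (D.scaleDensity 2) x y with hR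
  have hRAC : ∀ u v, AbsolutelyContinuousOnInterval R u v := fun u v =>
    absolutelyContinuousOnInterval_ramp hσ hsub u v
  have hRm : AEStronglyMeasurable R D.mu := by
    have h1 : AEMeasurable R D.mu :=
      aemeasurable_mu (LocAC.continuousOn (D := D) fun u _ v _ => hRAC u v)
    exact h1.aestronglyMeasurable
  obtain ⟨K, hK⟩ := (hRAC x y).exists_bound
  rw [uIcc_of_le hxy.le] at hK
  have hRb : ∀ t, ‖R t‖ ≤ max K 1 := by
    intro t
    rcases lt_or_ge t x with h1 | h1
    · rw [hR, ramp_of_le h1.le]; simp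
    rcases lt_or_ge y t with h2 | h2
    · rw [hR, ramp_of_ge hσ hpos hsub hxy h2.le]; simp
    · exact (hK t ⟨h1, h2⟩).trans (le_max_left _ _)
  have hRi : Integrable R D.mu := Integrable.of_bound hRm _ (ae_of_all _ hRb)
  set k := ⨍ t, R t ∂D.mu with hk
  have hadm : D.Admissible Boundary.NN fun t => R t - k :=
    ⟨fun u hu v hv => (hRAC u v).sub (locAC_const k u hu v hv), fun h => h.elim, fun h => h.elim⟩
  have hmz : D.MeanZero Boundary.NN fun t => R t - k :=
    ⟨hRi.sub (integrable_const _), integral_sub_average _ _⟩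
  have h1 := hlam _ hadm hmz
  have h2 : eLpNorm (fun t => √(c t) * (R t - k)) 2 D.mu = 0 := by
    rw [eLpNorm_congr_ae (g := 0), eLpNorm_zero]
    have : ∀ᵐ t ∂D.mu, c t = 0 := by
      rw [mu]
      exact withDensity_absolutelyContinuous _ _ ((ae_restrict_iff' hE).2 hc)
    filter_upwards [this] with t ht
    simp [ht]
  have h3 : eLpNorm (deriv fun t => R t - k) 2 D.nu ^ 2 = (D.nuHat 2 (Ioo x y))⁻¹ := by
    rw [eLpNorm_two_sq, nu_eq, lintegral_weightMeasure D.aemeasurable_exp_C, nuHat_eq,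
      ← ENNReal.rpow_neg_one]
    have e : (-1 : ℝ) = 1 - 2 := by norm_num
    rw [e, ← lintegral_rpow_ramp hE hσ hpos (by norm_num : (1 : ℝ) < 2) hsub hxy]
    refine lintegral_congr_ae (ae_restrict_of_ae ?_)
    filter_upwards [ae_hasDerivAt_ramp hσ hsub] with t ht
    rw [(ht.sub_const k).deriv, D.scaleDensity_rpow (by norm_num),
      ← ENNReal.ofReal_mul (Real.exp_pos _).le, mul_comm]
  set T := (D.mu (D.leftOf x))⁻¹ + (D.mu (D.rightOf y))⁻¹ with hT
  -- The mean is one particular constant, so the variance is at least the minimum over k of k^2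
  -- μ(-M,x) + (1-k)^2 μ(y,N), which is T⁻¹.
  have h4 : T⁻¹ ≤ eLpNorm (fun t => R t - k) 2 D.mu ^ 2 := by
    have e1 := iInf_rpow_mul_add_eq (q := 2) (by norm_num) (D.mu (D.leftOf x))
      (D.mu (D.rightOf y))
    have e2 : (-(1 / (2 - 1)) : ℝ) = -1 := by norm_num
    have e3 : (-(2 - 1) : ℝ) = -1 := by norm_num
    rw [e2, e3, ENNReal.rpow_neg_one, ENNReal.rpow_neg_one, ENNReal.rpow_neg_one] at e1
    rw [hT, ← e1]
    refine (iInf_le _ k).trans ?_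
    rw [← normB_one_split hxy, eLpNorm_two_sq]
    refine le_trans (normB_mono (g := fun t => |R t - k| ^ (2 : ℝ)) (ae_of_all _ fun t => ?_))
      (le_of_eq ?_)
    · by_cases h1 : t ∈ D.leftOf x
      · have h2 : t ∉ D.rightOf y := fun h2 => lt_asymm (h1.2.trans hxy) h2.2
        rw [indicator_of_mem h1, indicator_of_notMem h2, hR, ramp_of_le (le_of_lt h1.2)]
        simp
      · by_cases h2 : t ∈ D.rightOf y
        · rw [indicator_of_notMem h1, indicator_of_mem h2, hR,
            ramp_of_ge hσ hpos hsub hxy (le_of_lt h2.2)]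
          simp
        · rw [indicator_of_notMem h1, indicator_of_notMem h2, add_zero, abs_zero]
          positivity
    · rw [normB_one]
      refine lintegral_congr fun x => ?_
      rw [Real.enorm_eq_ofReal (by positivity)]
  rw [h2, h3, zero_pow (by norm_num), add_zero] at h1
  have h5 := div_le_inv_of_mul_le ((mul_le_mul_right h4 lam).trans h1)
  rwa [div_eq_mul_inv, inv_inv, mul_comm, ← div_eq_mul_inv] at h5

/-- A monotone flux that tends to 0 at both ends is zero; consequently h is constant and the killing
vanishes. -/
theorem flux_eq_zero (hh : D.IsHarmonic c h) (hc : ∀ x ∈ D.E, 0 ≤ c x)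
    (hpos : ∀ x ∈ D.E, 0 < h x) (hneu : D.IsNeumann Boundary.NN h) {x : ℝ} (hx : x ∈ D.E) :
    D.flux h x = 0 :=
  le_antisymm (flux_nonpos (hh.monotoneOn_flux hc hpos) (hneu.2 id) hx)
    (flux_nonneg (hh.monotoneOn_flux hc hpos) (hneu.1 id) hx)

/-- In the Neumann-Neumann case there is no killing. -/
theorem ae_eq_zero_of_NN (hh : D.IsHarmonic c h) (hc : ∀ x ∈ D.E, 0 ≤ c x)
    (hpos : ∀ x ∈ D.E, 0 < h x) (hneu : D.IsNeumann Boundary.NN h) :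
    ∀ᵐ x, x ∈ D.E → c x = 0 := by
  filter_upwards [hh.ae_hasDerivAt_flux] with x h1 hx
  have e : D.flux h =ᶠ[𝓝 x] fun _ => 0 := by
    filter_upwards [D.isOpen_E.mem_nhds hx] with t ht using flux_eq_zero hh hc hpos hneu ht
  have h2 := (h1 hx).deriv
  rw [e.deriv_eq, deriv_const] at h2
  have ha := a_pos' hx
  have hp := hpos x hx
  have h3 : Real.exp (D.C x) / D.a x ≠ 0 := by positivity
  rcases mul_eq_zero.1 h2.symm with h4 | h4
  · exact (mul_eq_zero.1 h4).resolve_right hp.ne'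
  · exact absurd h4 h3

theorem eq_theta_of_NN (hh : D.IsHarmonic c h) (hc : ∀ x ∈ D.E, 0 ≤ c x)
    (hpos : ∀ x ∈ D.E, 0 < h x) (hneu : D.IsNeumann Boundary.NN h) {x : ℝ} (hx : x ∈ D.E) :
    h x = h D.θ := by
  refine D.isOpen_E.is_const_of_deriv_eq_zero D.ordConnected_E.isPreconnected hh.1
    (fun t ht => ?_) hx D.theta_mem
  have := flux_eq_zero hh hc hpos hneu ht
  exact (mul_eq_zero.1 this).resolve_left (Real.exp_pos _).ne'

theorem muC_of_const {k : ℝ} (hk : ∀ x ∈ D.E, h x = k) :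
    D.muC h = ENNReal.ofReal (k ^ 2) • D.mu := by
  rw [muC, ← withDensity_const]
  refine withDensity_congr_ae ?_
  filter_upwards [mem_ae_iff.2 D.mu_compl] with x hx
  rw [hk x hx]

theorem nuHatC_of_const {k : ℝ} (hk : ∀ x ∈ D.E, h x = k) :
    D.nuHatC h = ENNReal.ofReal ((k ^ 2)⁻¹) • D.nuHat 2 := by
  rw [nuHatC, ← withDensity_const]
  refine withDensity_congr_ae ?_
  filter_upwards [mem_ae_iff.2 (D.nuHat_compl 2)] with x hx
  rw [hk x hx]

/-- For constant h, μ_c and ν̂_c are μ and ν̂ scaled by h^2 and h^(-2). Numerator and denominator of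
κ scale alike, so the statement with killing reduces to the one without. -/
theorem kappa_NN_smul {m s : Measure ℝ} {t : ℝ≥0∞} (h0 : t ≠ 0) (h1 : t ≠ ∞) :
    D.kappa (t • m) (t⁻¹ • s) Boundary.NN = D.kappa m s Boundary.NN := by
  refine iSup_congr fun x => iSup_congr fun _ => iSup_congr fun y => iSup_congr fun _ =>
    iSup_congr fun _ => ?_
  simp only [Measure.smul_apply, smul_eq_mul]
  rw [ENNReal.mul_inv (Or.inl h0) (Or.inl h1), ENNReal.mul_inv (Or.inl h0) (Or.inl h1), ← mul_add,
    ENNReal.mul_div_mul_left _ _ (ENNReal.inv_ne_zero.2 h1) (ENNReal.inv_ne_top.2 h0)]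

/-- The Poincaré-type inequalities with killing. -/
theorem poincare_bounds {bc : Boundary} (hNN : bc = Boundary.NN → D.mu D.E < ∞)
    (hc : ∀ x ∈ D.E, 0 ≤ c x) (hpos : ∀ x ∈ D.E, 0 < h x) (hh : D.IsHarmonic c h)
    (hneu : D.IsNeumann bc h) :
    D.kappa (D.muC h) (D.nuHatC h) bc ≤ (D.poincareConst c bc)⁻¹ ∧
      (D.poincareConst c bc)⁻¹ ≤ 4 * D.kappa (D.muC h) (D.nuHatC h) bc := by
  by_cases hbc : bc = Boundary.NN
  · subst hbc
    have hconst := fun x hx => eq_theta_of_NN hh hc hpos hneu (x := x) hx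
    have hk : 0 < h D.θ ^ 2 := pow_pos (hpos _ D.theta_mem) 2
    have e : D.kappa (D.muC h) (D.nuHatC h) Boundary.NN =
        D.kappa D.mu (D.nuHat 2) Boundary.NN := by
      rw [muC_of_const hconst, nuHatC_of_const hconst, ENNReal.ofReal_inv_of_pos hk]
      exact kappa_NN_smul (ENNReal.ofReal_pos.2 hk).ne' ENNReal.ofReal_ne_top
    rw [e]
    exact ⟨kappa_NN_le_poincareConst_inv (hNN rfl) (ae_eq_zero_of_NN hh hc hpos hneu),
      poincareConst_NN_inv_le (hNN rfl) c⟩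
  · exact ⟨kappa_le_poincareConst_inv hbc hh hc hpos hneu,
      poincareConst_inv_le hbc hh hc hpos hneu⟩

theorem isHarmonic_one : D.IsHarmonic (fun _ => 0) fun _ => 1 := by
  have e : deriv (fun _ : ℝ => (1 : ℝ)) = fun _ => 0 := deriv_const' 1
  refine ⟨differentiableOn_const 1, by rw [e]; exact locAC_const 0, ae_of_all _ fun x => ?_⟩
  simp [Lc, e]

theorem isNeumann_one (bc : Boundary) : D.IsNeumann bc fun _ => 1 := by
  refine ⟨fun _ => ?_, fun _ => ?_⟩ <;> simpa using tendsto_const_nhds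

/-- The constant h = 1 is harmonic for c = 0 and satisfies every Neumann condition, so the
inequality without killing is a special case. -/
theorem poincare_bounds_zero {bc : Boundary} (hNN : bc = Boundary.NN → D.mu D.E < ∞) :
    D.kappa D.mu (D.nuHat 2) bc ≤ (D.poincareConst (fun _ => 0) bc)⁻¹ ∧
      (D.poincareConst (fun _ => 0) bc)⁻¹ ≤ 4 * D.kappa D.mu (D.nuHat 2) bc := by
  have h1 : D.muC (fun _ => 1) = D.mu := by
    rw [muC_of_const fun _ _ => rfl]; simp
  have h2 : D.nuHatC (fun _ => 1) = D.nuHat 2 := by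
    rw [nuHatC_of_const fun _ _ => rfl]; simp
  have := poincare_bounds (c := fun _ => 0) (h := fun _ => 1) hNN (fun _ _ => le_rfl)
    (fun _ _ => one_pos) isHarmonic_one (isNeumann_one bc)
  rwa [h1, h2] at this

end NeumannNeumann
end ChenHardy

theorem mainTheorem2 (D : ChenHardy.Diffusion) (bc : ChenHardy.Boundary) :
    ((bc = ChenHardy.Boundary.NN → D.mu D.E < ∞) →
      (D.kappa D.mu (D.nuHat 2) bc ≤ (D.poincareConst (fun _ => 0) bc)⁻¹ ∧
        (D.poincareConst (fun _ => 0) bc)⁻¹ ≤ 4 * D.kappa D.mu (D.nuHat 2) bc) ∧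
      (∀ c h : ℝ → ℝ, (∀ x ∈ D.E, 0 ≤ c x) → (∀ x ∈ D.E, 0 < h x) →
        D.IsHarmonic c h → D.IsNeumann bc h →
        D.kappa (D.muC h) (D.nuHatC h) bc ≤ (D.poincareConst c bc)⁻¹ ∧
        (D.poincareConst c bc)⁻¹ ≤ 4 * D.kappa (D.muC h) (D.nuHatC h) bc)) ∧
    (∀ p q : ℝ, 1 < p → p ≤ q →
      (D.hardyIso p q bc ≤ D.hardyConst p q bc ∧
        D.hardyConst p q bc ≤ 2 * D.hardyIso p q bc) ∧
      (∀ 𝒢 : Set (ℝ → ℝ≥0), (∀ g ∈ 𝒢, Measurable g) →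
        D.hardyIsoB 𝒢 p q bc ≤ D.hardyConstB 𝒢 p q bc ∧
        D.hardyConstB 𝒢 p q bc ≤ 2 * D.hardyIsoB 𝒢 p q bc)) := by
  exact ⟨fun hNN => ⟨ChenHardy.poincare_bounds_zero hNN, fun c h hc hh hharm hneu =>
      ChenHardy.poincare_bounds hNN hc hh hharm hneu⟩,
    fun p q hp hpq => ⟨⟨ChenHardy.hardyIso_le hp hpq bc, ChenHardy.hardyConst_le hp hpq bc⟩,
      fun 𝒢 h𝒢 => ⟨D.hardyIsoB_le 𝒢 hp (by linarith) bc,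
        ChenHardy.hardyConstB_le_two_mul h𝒢 hp hpq bc⟩⟩⟩
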